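/- Let $(G,\theta)$ be $(\mathrm{SO}(n),\tfrac12)$, $(\mathrm{SU}(n),1)$ or $(\mathrm{USp}(n),2)$, $n\ge 1$, acting by conjugation on the space $\mathcal M$ of $n\times n$ real symmetric, complex Hermitian or quaternionic self-dual matrices respectively, with the Riemannian metric given by $\langle A,B\rangle=\operatorname{tr}(AB)$ (real part of the trace in the quaternionic case). Identify $\mathbb R^{n-1}$ with $\{x\in\mathbb R^n:\sum_i x_i=0\}$, with the Lebesgue measure induced by the Euclidean inner product, let $\mathcal C_+=\{x\in\mathbb R^{n-1}: x_1\ge\dots\ge x_n\}$, $\Delta(x)=\prod_{i<j}(x_i-x_j)$, and $$\kappa_\theta=\frac{(2\pi)^{\frac12 n(n-1)\theta}\,n!}{\prod_{j=1}^n\Gamma(1+j\theta)/\Gamma(1+\theta)} .$$ Let $\Delta_{\mathfrak g}(\rho)=\prod_{\mathbf a>0}\langle \mathbf a,\rho\rangle$ be the product over the positive roots of the Lie algebra of $G$, where $\rho$ is half the sum of the positive roots and long roots have squared length $2$. Let $\alpha,\beta\in\mathcal C_+$ have distinct entries, and let $\mathcal O_\alpha,\mathcal O_\beta\subset\mathcal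 M$ be the $G$-orbits of $\operatorname{diag}(\alpha)$, $\operatorname{diag}(\beta)$. The Horn probability measure is the law of the sorted spectrum of $A+B$, where $A\in\mathcal O_\alpha$ and $B\in\mathcal O_\beta$ are independent and $G$-invariantly distributed. Let $p(\gamma\,|\,\alpha,\beta)$ be its density, taken as the pointwise derivative $\lim_{r\to0^+}$ of the ratio of its mass to the Lebesgue measure on the balls of radius $r$ about $\gamma$, and let $$\mathcal J(\alpha,\beta;\gamma)=\frac{(2\pi)^{\theta n(n-1)}}{\kappa_\theta^2\,\Delta_{\mathfrak g}(\rho)^3}\left(\frac{\Delta(\alpha)\Delta(\beta)}{\Delta(\gamma)}\right)^{\theta}p(\gamma\,|\,\alpha,\beta)$$ be the volume function. Let $\Psi:\mathcal O_\beta\to\mathcal C_+$ send $B$ to the spectrum of $\operatorname{diag}(\alpha)+B$ in non-increasing order, and let $\gamma_0\in\mathcal C_+$ be a regular value of $\Psi$, that is, at every $B\in\Psi^{-1}(\gamma_0)$ the map $\Psi$ is differentiable with differential $T_B\mathcal O_\beta\to\mathbb R^{n-1}$ onto. Then there are an open neighborhood $E$ of $\gamma_0$ in $\mathbb R^{n-1}$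 and a diffeomorphism $\Psi^{-1}(\gamma_0)\times E\cong\Psi^{-1}(E)$ compatible with the projections to $E$, and $\Psi^{-1}(\gamma_0)$ is covered by finitely many local coordinate systems $z=(z_1,\dots,z_m)$, $m=\theta n(n-1)-(n-1)$. For every such $E$ and diffeomorphism, $p(\cdot\,|\,\alpha,\beta)$ is a density of the Horn probability measure on $E$, and for all $\gamma\in E\cap\mathcal C_+$ $$p(\gamma\,|\,\alpha,\beta)=\kappa_\theta^{-1}\Delta(\beta)^{-2\theta}\int_{\Psi^{-1}(\gamma_0)}\sqrt{g_\beta(z,\gamma)}\,dz,$$ $$\mathcal J(\alpha,\beta;\gamma)=\frac{(2\pi)^{\theta n(n-1)}}{\kappa_\theta^{3}\,\Delta_{\mathfrak g}(\rho)^3}\left(\frac{\Delta(\alpha)}{\Delta(\beta)\Delta(\gamma)}\right)^{\theta}\int_{\Psi^{-1}(\gamma_0)}\sqrt{g_\beta(z,\gamma)}\,dz ,$$ where $g_\beta(z,\gamma)$ is the determinant of the induced metric on $\mathcal O_\beta$ in the coordinates $(z,\gamma)$, with $\gamma$ given by orthonormal linear coordinates on $\mathbb R^{n-1}$, and the (convergent)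 integral over $\Psi^{-1}(\gamma_0)$ is computed in the local coordinates $z$ with any finite partition of unity subordinate to the cover. (Where $\Delta(\gamma)=0$, which can happen only if $\Psi^{-1}(\gamma_0)=\emptyset$, both sides are read as $0$.) -/

import Mathlib

open MeasureTheory Filter Topology Set
open scoped ContDiff Quaternion

noncomputable section

namespace Horn

/-! ### The three self-adjoint cases -/

/-- The three cases: real symmetric, complex Hermitian and quaternionic self-dual matrices, acted on
by conjugation by `SO(n)`, `SU(n)` and `USp(n)`. -/
inductive SelfAdjointCase
  | real
  | complex
  | quaternionic

namespace SelfAdjointCase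

/-- The scalars `ℝ`, `ℂ`, `ℍ`. -/
def K : SelfAdjointCase → Type
  | real => ℝ
  | complex => ℂ
  | quaternionic => ℍ[ℝ]

instance (c : SelfAdjointCase) : NormedRing c.K :=
  match c with
  | real => inferInstanceAs (NormedRing ℝ)
  | complex => inferInstanceAs (NormedRing ℂ)
  | quaternionic => inferInstanceAs (NormedRing ℍ[ℝ])

instance (c : SelfAdjointCase) : StarRing c.K :=
  match c with
  | real => inferInstanceAs (StarRing ℝ)
  | complex => inferInstanceAs (StarRing ℂ)
  | quaternionic => inferInstanceAs (StarRing ℍ[ℝ])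

/-- The inner product `Re (x̄ y)` on the scalars. -/
instance (c : SelfAdjointCase) : InnerProductSpace ℝ c.K :=
  match c with
  | real => inferInstanceAs (InnerProductSpace ℝ ℝ)
  | complex => inferInstanceAs (InnerProductSpace ℝ ℂ)
  | quaternionic => inferInstanceAs (InnerProductSpace ℝ ℍ[ℝ])

instance (c : SelfAdjointCase) : ContinuousStar c.K :=
  match c with
  | real => inferInstanceAs (ContinuousStar ℝ)
  | complex => inferInstanceAs (ContinuousStar ℂ)
  | quaternionic => inferInstanceAs (ContinuousStar ℍ[ℝ])

instance (c : SelfAdjointCase) : FiniteDimensional ℝ c.K :=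
  match c with
  | real => inferInstanceAs (FiniteDimensional ℝ ℝ)
  | complex => inferInstanceAs (FiniteDimensional ℝ ℂ)
  | quaternionic => inferInstanceAs (FiniteDimensional ℝ ℍ[ℝ])

theorem star_mul_self_eq (c : SelfAdjointCase) (x : c.K) :
    star x * x = (‖x‖ ^ 2) • (1 : c.K) := by
  cases c with
  | real =>
    have h : ∀ y : ℝ, star y * y = (‖y‖ ^ 2) • (1 : ℝ) := fun y => by
      simp [sq]
    exact h x
  | complex =>
    have h : ∀ y : ℂ, star y * y = (‖y‖ ^ 2) • (1 : ℂ) := fun y => by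
      have := Complex.conj_mul' y
      simpa using this
    exact h x
  | quaternionic =>
    have h : ∀ y : ℍ[ℝ], star y * y = (‖y‖ ^ 2) • (1 : ℍ[ℝ]) := fun y => by
      rw [Quaternion.star_mul_self, Quaternion.normSq_eq_norm_mul_self, ← sq]
      rw [Algebra.smul_def, mul_one]
      rfl
    exact h x

/-- The parameter `θ = 1/2, 1, 2`. -/
def θ : SelfAdjointCase → ℝ
  | real => 1 / 2
  | complex => 1
  | quaternionic => 2

/-- `2θ`, the real dimension of the scalars. -/
def scalarDim : SelfAdjointCase → ℕ
  | real => 1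
  | complex => 2
  | quaternionic => 4

/-- `n × n` matrices over the scalars. -/
abbrev Mat (c : SelfAdjointCase) (n : ℕ) : Type := Matrix (Fin n) (Fin n) c.K

/-- The group `SO(n)`, `SU(n)` or `USp(n)`, as a subgroup of all unitary matrices
over `ℝ`, `ℂ`, `ℍ`. -/
def G (c : SelfAdjointCase) (n : ℕ) : Subgroup (unitary (c.Mat n)) :=
  match c with
  | real => ((Matrix.detMonoidHom (n := Fin n) (R := ℝ)).comp
      (unitary (Matrix (Fin n) (Fin n) ℝ)).subtype).ker
  | complex => ((Matrix.detMonoidHom (n := Fin n) (R := ℂ)).comp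
      (unitary (Matrix (Fin n) (Fin n) ℂ)).subtype).ker
  | quaternionic => ⊤

theorem norm_entry_le_one (c : SelfAdjointCase) {n : ℕ} (u : unitary (c.Mat n)) (i j : Fin n) :
    ‖(u : c.Mat n) i j‖ ≤ 1 := by
  have h1 : (star (u : c.Mat n) * (u : c.Mat n)) j j = 1 := by
    rw [Unitary.coe_star_mul_self, Matrix.one_apply_eq]
  rw [Matrix.mul_apply] at h1
  simp only [Matrix.star_apply, star_mul_self_eq] at h1
  rw [← Finset.sum_smul] at h1
  have h2 : ‖(1 : c.K)‖ = 1 := by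
    cases c
    · exact norm_one (α := ℝ)
    · exact norm_one (α := ℂ)
    · exact norm_one (α := ℍ[ℝ])
  have h3 := congrArg norm h1
  rw [norm_smul, h2, mul_one, Real.norm_of_nonneg (by positivity)] at h3
  have h4 : ‖(u : c.Mat n) i j‖ ^ 2 ≤ 1 := by
    rw [← h3]
    exact Finset.single_le_sum (f := fun k => ‖(u : c.Mat n) k j‖ ^ 2)
      (fun k _ => by positivity) (Finset.mem_univ i)
  exact (sq_le_one_iff₀ (norm_nonneg _)).1 h4

instance (c : SelfAdjointCase) : ProperSpace c.K := FiniteDimensional.proper ℝ c.K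

instance (c : SelfAdjointCase) (n : ℕ) : CompactSpace (unitary (c.Mat n)) := by
  have hK : IsCompact (Set.pi Set.univ fun _ : Fin n => Set.pi Set.univ fun _ : Fin n =>
      Metric.closedBall (0 : c.K) 1) :=
    isCompact_univ_pi fun _ => isCompact_univ_pi fun _ => isCompact_closedBall _ _
  refine isCompact_iff_compactSpace.1 (IsCompact.of_isClosed_subset
    (s := (show Set (c.Mat n) from Set.pi Set.univ fun _ : Fin n => Set.pi Set.univ
      fun _ : Fin n => Metric.closedBall (0 : c.K) 1)) hK isClosed_unitary ?_)
  intro u hu i _ j _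
  simpa using norm_entry_le_one c ⟨u, hu⟩ i j

theorem isClosed_G (c : SelfAdjointCase) (n : ℕ) : IsClosed (c.G n : Set (unitary (c.Mat n))) := by
  cases c with
  | real =>
    have h : IsClosed {u : unitary (Matrix (Fin n) (Fin n) ℝ) |
        (u : Matrix (Fin n) (Fin n) ℝ).det = 1} :=
      isClosed_eq (continuous_subtype_val.matrix_det) continuous_const
    exact h
  | complex =>
    have h : IsClosed {u : unitary (Matrix (Fin n) (Fin n) ℂ) |
        (u : Matrix (Fin n) (Fin n) ℂ).det = 1} :=
      isClosed_eq (continuous_subtype_val.matrix_det) continuous_const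
    exact h
  | quaternionic => exact isClosed_univ

instance (c : SelfAdjointCase) (n : ℕ) : CompactSpace (c.G n) :=
  isCompact_iff_compactSpace.1 (isClosed_G c n).isCompact

/-- The Borel σ-algebra on the space of matrices. -/
instance (c : SelfAdjointCase) (n : ℕ) : MeasurableSpace (c.Mat n) := borel _

instance (c : SelfAdjointCase) (n : ℕ) : BorelSpace (c.Mat n) := ⟨rfl⟩

/-! ### Numerical constants -/

/-- The number of standard coordinates in which the roots of the Lie algebra of `G` are written. -/
def rank : SelfAdjointCase → ℕ → ℕ
  | real, n => n / 2
  | complex, n => n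
  | quaternionic, n => n

/-- The positive roots `e i - e j` with `i < j`. -/
def rootsMinus (r : ℕ) : Finset (Fin r → ℚ) :=
  (Finset.univ.filter fun p : Fin r × Fin r => p.1 < p.2).image
    fun p => Pi.single p.1 1 - Pi.single p.2 1

/-- The positive roots `e i + e j` with `i < j`. -/
def rootsPlus (r : ℕ) : Finset (Fin r → ℚ) :=
  (Finset.univ.filter fun p : Fin r × Fin r => p.1 < p.2).image
    fun p => Pi.single p.1 1 + Pi.single p.2 1

/-- The vectors `t e i`. -/
def rootsSingle (r : ℕ) (t : ℚ) : Finset (Fin r → ℚ) :=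
  Finset.univ.image fun i : Fin r => Pi.single i t

/-- The positive roots of the Lie algebra `𝔤` of `G`, in the usual coordinates:
type `A_{n-1}` for `SU(n)`, type `C_n` for `USp(n)`, and for `SO(n)` type `D_r` if `n = 2r`
and type `B_r` if `n = 2r+1`. -/
def posRoots : (c : SelfAdjointCase) → (n : ℕ) → Finset (Fin (c.rank n) → ℚ)
  | real, n =>
      if Even n then rootsMinus (n / 2) ∪ rootsPlus (n / 2)
      else rootsMinus (n / 2) ∪ rootsPlus (n / 2) ∪ rootsSingle (n / 2) 1
  | complex, n => rootsMinus n
  | quaternionic, n => rootsMinus n ∪ rootsPlus n ∪ rootsSingle n 2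

/-- The scaling of the standard form for which the long roots have squared length `2`. -/
def formScale : SelfAdjointCase → ℕ → ℚ
  | real, n => if n = 3 then 2 else 1
  | complex, _ => 1
  | quaternionic, _ => 1 / 2

/-- The Weyl vector `ρ`, half the sum of the positive roots. -/
def weylVector (c : SelfAdjointCase) (n : ℕ) : Fin (c.rank n) → ℚ :=
  (1 / 2 : ℚ) • ∑ a ∈ c.posRoots n, a

/-- `Δ_𝔤(ρ)`, the product of `⟨a, ρ⟩` over the positive roots `a` of `𝔤`. -/
def deltaRho (c : SelfAdjointCase) (n : ℕ) : ℚ :=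
  ∏ a ∈ c.posRoots n, c.formScale n * ∑ i, a i * c.weylVector n i

/-- `κ_θ = (2π)^{θ n(n-1)/2} n! / ∏_{j=1}^n (Γ(1+jθ) / Γ(1+θ))`. -/
def kappa (c : SelfAdjointCase) (n : ℕ) : ℝ :=
  (2 * Real.pi) ^ (c.θ * n * (n - 1) / 2 : ℝ) * (n.factorial : ℝ) /
    ∏ j ∈ Finset.Icc 1 n, Real.Gamma (1 + j * c.θ) / Real.Gamma (1 + c.θ)

/-- The dimension `θ n(n-1) - (n-1)` of the regular fibers of `Ψ`. -/
def fiberDim (c : SelfAdjointCase) (n : ℕ) : ℕ :=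
  c.scalarDim * (n * (n - 1) / 2) - (n - 1)

end SelfAdjointCase

/-! ### Spectra -/

/-- The hyperplane `∑ xᵢ = 0` of `ℝⁿ`, with the Euclidean inner product; `volume` on it is the
associated Lebesgue measure. -/
def Traceless (n : ℕ) : Submodule ℝ (EuclideanSpace ℝ (Fin n)) where
  carrier := {x | ∑ i, x i = 0}
  add_mem' := by
    intro a b ha hb
    simp only [Set.mem_ofPred_eq] at *
    simp [Finset.sum_add_distrib, ha, hb]
  zero_mem' := by simp
  smul_mem' := by
    intro t a ha
    simp only [Set.mem_ofPred_eq] at *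
    simp [← Finset.mul_sum, ha]

/-- The cone `C₊` of traceless spectra in non-increasing order. -/
def chamber (n : ℕ) : Set (Traceless n) := {x | Antitone fun i => x.1 i}

/-- The Vandermonde product `Δ(x) = ∏_{i<j} (xᵢ - xⱼ)`. -/
def vandermonde {n : ℕ} (x : Traceless n) : ℝ :=
  ∏ i : Fin n, ∏ j ∈ Finset.Ioi i, (x.1 i - x.1 j)

variable {c : SelfAdjointCase} {n : ℕ}

/-- The diagonal matrix with real diagonal entries `x`. -/
def diag (c : SelfAdjointCase) {n : ℕ} (x : Traceless n) : c.Mat n :=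
  Matrix.diagonal fun i => x.1 i • (1 : c.K)

/-- Conjugation of the diagonal matrix `x` by a unitary matrix. -/
def conj (c : SelfAdjointCase) {n : ℕ} (u : unitary (c.Mat n)) (x : Traceless n) : c.Mat n :=
  (u : c.Mat n) * diag c x * star (u : c.Mat n)

/-- The `G`-orbit `O_x` of the diagonal matrix `x`. -/
def orbit (c : SelfAdjointCase) {n : ℕ} (x : Traceless n) : Set (c.Mat n) :=
  Set.range fun g : c.G n => conj c g x

open Classical in
/-- The diagonalization, with non-increasing entries, of a traceless self-adjoint matrix `C`: the
`x ∈ C₊` such that `C` is unitarily conjugate to `diag x`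
(with the value `0` for all other matrices). -/
def sortedSpectrum (c : SelfAdjointCase) {n : ℕ} (C : c.Mat n) : Traceless n :=
  if h : ∃ x ∈ chamber n, ∃ u : unitary (c.Mat n), C = conj c u x then h.choose else 0

/-- The map `Ψ`, sending `B ∈ O_β` to the sorted spectrum of `α + B`. -/
def Psi (c : SelfAdjointCase) {n : ℕ} (α : Traceless n) (B : c.Mat n) : Traceless n :=
  sortedSpectrum c (diag c α + B)

/-! ### The Horn probability measure and the volume function -/

/-- The normalized Haar measure on `G`. -/
def haarProb (c : SelfAdjointCase) (n : ℕ) : Measure (c.G n) := Measure.haarMeasure ⊤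

/-- The `G`-invariant probability measure on the orbit `O_x`. -/
def orbitalMeasure (c : SelfAdjointCase) {n : ℕ} (x : Traceless n) : Measure (c.Mat n) :=
  (haarProb c n).map fun g : c.G n => conj c g x

/-- The Horn probability measure: the law of the sorted spectrum of `A + B`, where `A ∈ O_α` and
`B ∈ O_β` are independent and invariantly distributed. -/
def hornMeasure (c : SelfAdjointCase) {n : ℕ} (α β : Traceless n) : Measure (Traceless n) :=
  ((orbitalMeasure c α).prod (orbitalMeasure c β)).map fun p => sortedSpectrum c (p.1 + p.2)

/-- The density `p(γ | α, β)` of the Horn probability measure with respect to Lebesgue measure,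
as the pointwise derivative of one measure with respect to the other. -/
def hornDensity (c : SelfAdjointCase) {n : ℕ} (α β γ : Traceless n) : ℝ :=
  limUnder (𝓝[>] (0 : ℝ)) fun r =>
    (hornMeasure c α β (Metric.closedBall γ r) / volume (Metric.closedBall γ r)).toReal

/-- The volume function `J(α, β; γ)`. -/
def volumeFunction (c : SelfAdjointCase) {n : ℕ} (α β γ : Traceless n) : ℝ :=
  (2 * Real.pi) ^ (c.θ * n * (n - 1) : ℝ) / (c.kappa n ^ 2 * (c.deltaRho n : ℝ) ^ 3) *
    (vandermonde α * vandermonde β / vandermonde γ) ^ c.θ * hornDensity c α β γ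

/-! ### Smooth structure: regular values, trivializations, coordinates

Matrices carry the elementwise norm here. It is used only to differentiate, for which all norms on a
finite-dimensional space are equivalent; the Riemannian metric is given by `traceForm`. -/

attribute [local instance] Matrix.normedAddCommGroup Matrix.normedSpace

/-- The fiber `Ψ⁻¹(γ) ⊆ O_β`. -/
def fiber (c : SelfAdjointCase) {n : ℕ} (α β γ : Traceless n) : Set (c.Mat n) :=
  {B | B ∈ orbit c β ∧ Psi c α B = γ}

/-- The tangent space of a submanifold `s` at `B`. -/
def tangentSpace (s : Set (c.Mat n)) (B : c.Mat n) : Submodule ℝ (c.Mat n) :=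
  Submodule.span ℝ (tangentConeAt ℝ s B)

/-- `γ` is a regular value of `Ψ : O_β → C₊`: at every point of the fiber over `γ`, the map `Ψ` is
differentiable and its differential maps `T_B O_β` onto the space of traceless diagonal matrices. -/
def IsRegularValue (c : SelfAdjointCase) {n : ℕ} (α β γ : Traceless n) : Prop :=
  ∀ B ∈ fiber c α β γ, ∃ L : c.Mat n →L[ℝ] Traceless n,
    HasFDerivWithinAt (Psi c α) L (orbit c β) B ∧
      (tangentSpace (orbit c β) B).map (L : c.Mat n →ₗ[ℝ] Traceless n) = ⊤

/-- `f` is a smooth diffeomorphism from `s` onto `t` with inverse `g`. -/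
structure IsDiffeoOn {X Y : Type*} [NormedAddCommGroup X] [NormedSpace ℝ X]
    [NormedAddCommGroup Y] [NormedSpace ℝ Y] (f : X → Y) (g : Y → X) (s : Set X) (t : Set Y) :
    Prop where
  mapsTo : MapsTo f s t
  mapsTo_inv : MapsTo g t s
  leftInv : LeftInvOn g f s
  rightInv : RightInvOn g f t
  smooth : ContDiffOn ℝ ∞ f s
  smooth_inv : ContDiffOn ℝ ∞ g t

/-- A diffeomorphism `Ψ⁻¹(γ₀) × E ≃ Ψ⁻¹(E)` over an open neighborhood `E` of `γ₀`. -/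
structure FiberTrivialization (c : SelfAdjointCase) {n : ℕ} (α β γ₀ : Traceless n) where
  E : Set (Traceless n)
  isOpen_E : IsOpen E
  mem_E : γ₀ ∈ E
  toFun : c.Mat n × Traceless n → c.Mat n
  invFun : c.Mat n → c.Mat n × Traceless n
  isDiffeo : IsDiffeoOn toFun invFun (fiber c α β γ₀ ×ˢ E) {B | B ∈ orbit c β ∧ Psi c α B ∈ E}
  psi_toFun : ∀ B ∈ fiber c α β γ₀, ∀ γ ∈ E, Psi c α (toFun (B, γ)) = γ

/-- A finite family of local coordinate systems `z = (z₁, …, z_m)` covering `Ψ⁻¹(γ₀)`, given by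
smooth parametrizations of relatively open pieces of `Ψ⁻¹(γ₀)` by open sets of `ℝ^m`, together with
a partition of unity subordinate to this cover. -/
structure FiberAtlas (c : SelfAdjointCase) {n : ℕ} (α β γ₀ : Traceless n) where
  k : ℕ
  domain : Fin k → Set (EuclideanSpace ℝ (Fin (c.fiberDim n)))
  isOpen_domain : ∀ i, IsOpen (domain i)
  param : Fin k → EuclideanSpace ℝ (Fin (c.fiberDim n)) → c.Mat n
  coord : Fin k → c.Mat n → EuclideanSpace ℝ (Fin (c.fiberDim n))
  isDiffeo : ∀ i, IsDiffeoOn (param i) (coord i) (domain i) (param i '' domain i)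
  isOpen_image : ∀ i, ∃ V : Set (c.Mat n), IsOpen V ∧ param i '' domain i = V ∩ fiber c α β γ₀
  weight : Fin k → c.Mat n → ℝ
  measurable_weight : ∀ i, Measurable (weight i)
  weight_nonneg : ∀ i B, 0 ≤ weight i B
  weight_eq_zero : ∀ i, ∀ B ∈ fiber c α β γ₀, B ∉ param i '' domain i → weight i B = 0
  sum_weight : ∀ B ∈ fiber c α β γ₀, ∑ i, weight i B = 1

/-- The trace form `⟨A, B⟩ = tr (AB)`. (The real part, `inner ℝ 1`, only matters over `ℍ`, where the
trace of a product of two self-dual matrices need not be real.) -/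
def traceForm (A B : c.Mat n) : ℝ := inner ℝ (1 : c.K) (A * B).trace

variable {α β γ₀ : Traceless n}

/-- The coordinate system `(z, γ)` on a piece of `Ψ⁻¹(E) ⊆ O_β`. -/
def coordMap (T : FiberTrivialization c α β γ₀) (A : FiberAtlas c α β γ₀) (i : Fin A.k)
    (p : EuclideanSpace ℝ (Fin (c.fiberDim n)) × Traceless n) : c.Mat n :=
  T.toFun (A.param i p.1, p.2)

/-- The coordinate directions `∂/∂z_a` and `∂/∂γ_b`, where the `γ_b` are orthonormal linear
coordinates on the hyperplane of traceless spectra. -/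
def coordDir (m n : ℕ) :
    Fin m ⊕ Fin (Module.finrank ℝ (Traceless n)) → EuclideanSpace ℝ (Fin m) × Traceless n
  | Sum.inl a => (EuclideanSpace.single a 1, 0)
  | Sum.inr b => (0, stdOrthonormalBasis ℝ (Traceless n) b)

/-- `g_β(z, γ)`: the determinant of the induced metric on `O_β` in the coordinates `(z, γ)`. -/
def metricDet (T : FiberTrivialization c α β γ₀) (A : FiberAtlas c α β γ₀) (i : Fin A.k)
    (z : EuclideanSpace ℝ (Fin (c.fiberDim n))) (γ : Traceless n) : ℝ :=
  (Matrix.of fun a b =>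
    traceForm (fderiv ℝ (coordMap T A i) (z, γ) (coordDir (c.fiberDim n) n a))
      (fderiv ℝ (coordMap T A i) (z, γ) (coordDir (c.fiberDim n) n b))).det

/-- The integrand `√g_β(z, γ)` in the `i`-th coordinate system, weighted by the partition of
unity. -/
def fiberIntegrand (T : FiberTrivialization c α β γ₀) (A : FiberAtlas c α β γ₀) (γ : Traceless n)
    (i : Fin A.k) (z : EuclideanSpace ℝ (Fin (c.fiberDim n))) : ℝ :=
  A.weight i (A.param i z) * √(metricDet T A i z γ)

/-- The fiber integral `∫_{Ψ⁻¹(γ₀)} √g_β(z, γ) dz`. -/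
def fiberIntegral (T : FiberTrivialization c α β γ₀) (A : FiberAtlas c α β γ₀)
    (γ : Traceless n) : ℝ :=
  ∑ i, ∫ z in A.domain i, fiberIntegrand T A γ i z

end Horn

end

noncomputable section

namespace Horn

/-! ### The scalars as real normed algebras with conjugation -/

namespace SelfAdjointCase

variable (c : SelfAdjointCase)

/-! By conjugation invariance one may fix $A=\operatorname{diag}(\alpha)$, so the Horn measure is
the image under $\Psi$ of the invariant probability measure on $\mathcal O_\beta$
(`lintegral_hornMeasure`). That probability measure is the Riemannian measure of the trace form
divided by $\kappa_\theta\Delta(\beta)^{2\theta}$. In the coordinates $(z,\gamma)$ it therefore has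
density $\sqrt{g_\beta}$ over this constant; since $\Psi$ is the projection to $\gamma$, integrating
out $z$ gives a density of the Horn measure on $E$ (`lintegral_hornMeasure_restrict`). The formula
for $\mathcal J$ is then algebra.

The normalization is `lintegral_orbMeas_image`. Given a chart $\varphi$ of the orbit of $x$, the map
sending $(p,y)$ to the matrix with eigenvalues $y$ in the eigenframe of $\varphi(p)$ parametrizes a
piece of the flat space of self-adjoint matrices. Its derivative multiplies the $(i,j)$ entry of a
tangent vector by the divided difference $(y_j-y_i)/(x_j-x_i)$, so its volume factor is that of
$\varphi$ times $(\Delta(y)/\Delta(x))^{2\theta}$ (`gramDet_reSpec`). On the other hand, invariance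
splits Lebesgue measure into the orbital measure and $\kappa_\theta\Delta(y)^{2\theta}dy$
(`lintegral_projOrbit`). Comparing the two identifies the orbital measure.

The splitting uses Weyl's integration formula with its exact constant (`lintegral_spec`), proved by
induction on $n$. A matrix of size $n+1$ is written with blocks $a,b,Q$. For $Q$ with eigenvalues
$q_i$, the corner is $a=t-\sum_i|b_i|^2/(t-q_i)$ with $t$ above all $q_i$, and $b=(t-Q)w$; then
$(1,w)$ is an eigenvector with eigenvalue $t$. With $t-Q=S(t-Y)S$ and $S=(1+ww^*)^{-1/2}$, rotating
$(1,w)$ to the first axis leaves the block matrix $t\oplus Y$ (`border_eq_Ad`). The $w$-integral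
becomes $\int(1+|w|^2)^{-\theta(n+1)}dw$, a quotient of Gamma functions which supplies the ratio of
consecutive constants (`kappa_succ`).

Trivializations and atlases come from the map $X\mapsto(\operatorname{spec}X,\Psi(X))$. A regular
value with nonempty fiber has distinct entries, since otherwise some gap $\gamma_i-\gamma_j\ge0$
would be minimal on the fiber and have zero differential (`strictAnti_of_regular`). Simple
eigenvalues are smooth, so the fiber is a compact regular level set; shifting along normals to level
sets trivializes a neighborhood (`exists_trivialization`), and compactness of the orbit puts
$\Psi^{-1}(E)$ inside it for small $E$.

The density is a pointwise derivative, so the fiber integral must be finite and continuous in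
$\gamma$. Changing the coordinates $z$ multiplies $g_\beta$ by a factor independent of $\gamma$, so
the relative variation of $\sqrt{g_\beta}$ in $\gamma$ does not depend on the chart and is uniformly
small over the compact fiber (`eventually_sqrt_metricDet`). Continuity follows from finiteness, and
finiteness holds because an infinite value would persist on a neighborhood and contradict total mass
$1$. -/

theorem smul_mul_K (r : ℝ) (x y : c.K) : r • x * y = r • (x * y) := by
  cases c with
  | real => exact smul_mul_assoc (α := ℝ) (β := ℝ) r x y
  | complex => exact smul_mul_assoc (α := ℝ) (β := ℂ) r x y
  | quaternionic => exact smul_mul_assoc (α := ℝ) (β := ℍ[ℝ]) r x y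

theorem mul_smul_K (r : ℝ) (x y : c.K) : x * r • y = r • (x * y) := by
  cases c with
  | real => exact mul_smul_comm (α := ℝ) (β := ℝ) r x y
  | complex => exact mul_smul_comm (α := ℝ) (β := ℂ) r x y
  | quaternionic => exact mul_smul_comm (α := ℝ) (β := ℍ[ℝ]) r x y

instance : Algebra ℝ c.K := Algebra.ofModule (smul_mul_K c) (mul_smul_K c)

instance : NormedAlgebra ℝ c.K where
  norm_smul_le := norm_smul_le

instance : StarModule ℝ c.K where
  star_smul := by
    cases c with
    | real => exact fun r x => star_smul (R := ℝ) (A := ℝ) r x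
    | complex => exact fun r x => star_smul (R := ℝ) (A := ℂ) r x
    | quaternionic => exact fun r x => Quaternion.star_smul r x

instance : CompleteSpace c.K := FiniteDimensional.complete ℝ c.K

instance : NormOneClass c.K where
  norm_one := by
    cases c
    · exact norm_one (α := ℝ)
    · exact norm_one (α := ℂ)
    · exact norm_one (α := ℍ[ℝ])

instance : Nontrivial c.K := NormOneClass.nontrivial

variable {c}

/-- The real part of a scalar. -/
def re : c.K →ₗ[ℝ] ℝ := innerₛₗ ℝ (1 : c.K)

theorem re_apply (x : c.K) : re x = inner ℝ (1 : c.K) x := rfl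

theorem norm_star_K (x : c.K) : ‖star x‖ = ‖x‖ := by
  cases c with
  | real => exact norm_star (E := ℝ) x
  | complex => exact norm_star (E := ℂ) x
  | quaternionic => exact norm_star (E := ℍ[ℝ]) x

theorem inner_eq_re (x y : c.K) : inner ℝ x y = re (star x * y) := by
  cases c with
  | real =>
    have h : ∀ x y : ℝ, inner ℝ x y = inner ℝ 1 (star x * y) := fun x y => by
      simp [mul_comm]
    exact h x y
  | complex =>
    have h : ∀ x y : ℂ, inner ℝ x y = inner ℝ 1 (star x * y) := fun x y => by
      simp [Complex.inner]; ring
    exact h x y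
  | quaternionic =>
    have h : ∀ x y : ℍ[ℝ], inner ℝ x y = inner ℝ 1 (star x * y) := fun x y => by
      simp [Quaternion.inner_def]; ring
    exact h x y

/-- The substitute for commutativity over the quaternions; it makes the real part of the trace
cyclic. -/
theorem re_mul_comm (x y : c.K) : re (x * y) = re (y * x) := by
  cases c with
  | real => exact congrArg _ (mul_comm (G := ℝ) x y)
  | complex => exact congrArg _ (mul_comm (G := ℂ) x y)
  | quaternionic =>
    have h : ∀ x y : ℍ[ℝ], inner ℝ (1 : ℍ[ℝ]) (x * y) = inner ℝ 1 (y * x) := fun x y => by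
      simp [Quaternion.inner_def]; ring
    exact h x y

theorem eq_re_of_star_eq (x : c.K) (hx : star x = x) : x = re x • 1 := by
  cases c with
  | real =>
    have h : ∀ x : ℝ, x = inner ℝ (1 : ℝ) x • (1 : ℝ) := fun x => by
      simp
    exact h x
  | complex =>
    have h : ∀ x : ℂ, star x = x → x = inner ℝ (1 : ℂ) x • (1 : ℂ) := fun x hx => by
      simpa [Complex.inner] using (Complex.conj_eq_iff_re.1 hx).symm
    exact h x hx
  | quaternionic =>
    have h : ∀ x : ℍ[ℝ], star x = x → x = inner ℝ (1 : ℍ[ℝ]) x • (1 : ℍ[ℝ]) := fun x hx => by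
      rw [Quaternion.star_eq_self] at hx
      rw [hx, Algebra.smul_def, mul_one]
      simp [Quaternion.inner_def]
    exact h x hx

theorem finrank_K : Module.finrank ℝ c.K = c.scalarDim := by
  cases c with
  | real => exact Module.finrank_self ℝ
  | complex => exact Complex.finrank_real_complex
  | quaternionic => exact Quaternion.finrank_eq_four

theorem two_theta : 2 * c.θ = c.scalarDim := by
  cases c <;> simp [θ, scalarDim]; norm_num

@[simp] theorem re_one : re (1 : c.K) = 1 := by
  rw [re_apply, real_inner_self_eq_norm_sq, norm_one, one_pow]

theorem mul_star_self_eq (x : c.K) : x * star x = (‖x‖ ^ 2) • (1 : c.K) := by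
  simpa [norm_star_K] using star_mul_self_eq c (star x)

end SelfAdjointCase

end Horn

namespace Horn

open SelfAdjointCase

variable {c : SelfAdjointCase} {n : ℕ}

/-! ### The Euclidean space of self-adjoint matrices -/

variable (c n) in
/-- The self-adjoint matrices, as a Euclidean space with the trace form. -/
def Herm : Type := selfAdjoint.submodule ℝ (c.Mat n)

namespace Herm

instance : AddCommGroup (Herm c n) := inferInstanceAs (AddCommGroup (selfAdjoint.submodule ℝ _))

instance : Module ℝ (Herm c n) := inferInstanceAs (Module ℝ (selfAdjoint.submodule ℝ _))

instance : FiniteDimensional ℝ (Herm c n) :=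
  inferInstanceAs (FiniteDimensional ℝ (selfAdjoint.submodule ℝ (c.Mat n)))

/-- The underlying matrix. -/
def mat : Herm c n →ₗ[ℝ] c.Mat n := Submodule.subtype _

theorem mat_injective : Function.Injective (mat : Herm c n → c.Mat n) := Subtype.val_injective

@[ext] theorem ext_mat {X Y : Herm c n} (h : X.mat = Y.mat) : X = Y := mat_injective h

theorem star_mat (X : Herm c n) : star X.mat = X.mat := X.2

theorem star_apply (X : Herm c n) (i j : Fin n) : star (X.mat i j) = X.mat j i := by
  conv_rhs => rw [← star_mat X, Matrix.star_apply]

/-- A self-adjoint matrix as an element of `Herm`. -/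
def mk (A : c.Mat n) (h : star A = A) : Herm c n := ⟨A, h⟩

@[simp] theorem mat_mk (A : c.Mat n) (h : star A = A) : (mk A h).mat = A := rfl

/-- The self-adjoint part of a matrix. -/
def ofMat : c.Mat n →ₗ[ℝ] Herm c n where
  toFun A := mk ((1 / 2 : ℝ) • (A + star A)) (by rw [star_smul, star_add, star_star, add_comm]; rfl)
  map_add' A B := by
    ext1; simp only [mat_mk, map_add, star_add, ← smul_add]; congr 1; abel
  map_smul' r A := by
    ext1; simp only [mat_mk, map_smul, star_smul, RingHom.id_apply]
    rw [star_trivial, ← smul_add, smul_comm]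

theorem mat_ofMat {A : c.Mat n} (h : star A = A) : (ofMat A).mat = A := by
  change (1 / 2 : ℝ) • (A + star A) = A
  rw [h, ← two_smul ℝ, smul_smul]; norm_num

@[simp] theorem ofMat_mat (X : Herm c n) : ofMat X.mat = X := by
  ext1; exact mat_ofMat X.star_mat

end Herm

/-- The trace of $AB^*$ is the entrywise Euclidean pairing. This gives positivity of the trace form
on self-adjoint matrices. -/
theorem traceForm_star (A B : c.Mat n) :
    traceForm A (star B) = ∑ i, ∑ j, inner ℝ (A i j) (B i j) := by
  rw [traceForm, ← re_apply, Matrix.trace, map_sum]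
  refine Finset.sum_congr rfl fun i _ => ?_
  rw [Matrix.diag_apply, Matrix.mul_apply, map_sum]
  refine Finset.sum_congr rfl fun j _ => ?_
  rw [real_inner_comm, inner_eq_re, re_mul_comm, Matrix.star_apply]

theorem traceForm_eq_sum (A : c.Mat n) {B : c.Mat n} (hB : star B = B) :
    traceForm A B = ∑ i, ∑ j, inner ℝ (A i j) (B i j) := by
  conv_lhs => rw [← hB]
  exact traceForm_star A B

theorem traceForm_comm (A B : c.Mat n) : traceForm A B = traceForm B A := by
  simp only [traceForm, ← re_apply, Matrix.trace, map_sum, Matrix.diag_apply, Matrix.mul_apply]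
  rw [Finset.sum_comm]
  exact Finset.sum_congr rfl fun i _ => Finset.sum_congr rfl fun j _ => re_mul_comm _ _

theorem traceForm_mul_comm (A B C : c.Mat n) : traceForm (A * B) C = traceForm B (C * A) := by
  rw [traceForm_comm (A * B) C]
  rw [traceForm_comm B]
  simp only [traceForm, mul_assoc]

theorem traceForm_add_left (A B C : c.Mat n) :
    traceForm (A + B) C = traceForm A C + traceForm B C := by
  simp [traceForm, add_mul, inner_add_right]

theorem traceForm_smul_left (r : ℝ) (A C : c.Mat n) :
    traceForm (r • A) C = r * traceForm A C := by
  simp [traceForm, Matrix.trace_smul, inner_smul_right]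

namespace Herm

/-- The trace form is an inner product on self-adjoint matrices. -/
@[reducible] def core : InnerProductSpace.Core ℝ (Herm c n) where
  inner X Y := traceForm X.mat Y.mat
  conj_inner_symm X Y := traceForm_comm _ _
  re_inner_nonneg X := by
    have h : 0 ≤ traceForm X.mat X.mat := by
      rw [traceForm_eq_sum X.mat X.star_mat]
      exact Finset.sum_nonneg fun i _ => Finset.sum_nonneg fun j _ =>
        real_inner_self_nonneg (x := X.mat i j)
    exact h
  add_left X Y Z := by rw [map_add, traceForm_add_left]
  smul_left X Y r := by rw [map_smul, traceForm_smul_left]; rfl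
  definite X h := by
    have hnn : ∀ i j, 0 ≤ inner ℝ (X.mat i j) (X.mat i j) := fun i j => real_inner_self_nonneg
    have h0 := (traceForm_eq_sum X.mat X.star_mat).symm.trans h
    have h1 := (Finset.sum_eq_zero_iff_of_nonneg
      (fun i _ => Finset.sum_nonneg fun j _ => hnn i j)).1 h0
    ext i j
    have h2 := (Finset.sum_eq_zero_iff_of_nonneg (fun j _ => hnn i j)).1 (h1 i (Finset.mem_univ _))
    exact inner_self_eq_zero.1 (h2 j (Finset.mem_univ _))

instance : NormedAddCommGroup (Herm c n) := core.toNormedAddCommGroup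

instance : InnerProductSpace ℝ (Herm c n) := .ofCore core.toCore

instance : MeasurableSpace (Herm c n) := borel _

instance : BorelSpace (Herm c n) := ⟨rfl⟩

theorem inner_eq (X Y : Herm c n) : inner ℝ X Y = traceForm X.mat Y.mat := rfl

theorem norm_sq_eq (X : Herm c n) : ‖X‖ ^ 2 = ∑ i, ∑ j, ‖X.mat i j‖ ^ 2 := by
  rw [← real_inner_self_eq_norm_sq, inner_eq, traceForm_eq_sum _ X.star_mat]
  simp only [real_inner_self_eq_norm_sq]

/-- The diagonal matrix with real entries `x`. -/
def diagonal : (Fin n → ℝ) →ₗ[ℝ] Herm c n where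
  toFun x := mk (Matrix.diagonal fun i => x i • (1 : c.K)) (by
    rw [Matrix.star_eq_conjTranspose, Matrix.diagonal_conjTranspose]
    congr 1; ext i; simp)
  map_add' x y := by ext1; simp [add_smul]
  map_smul' r x := by ext1; simp [← Matrix.diagonal_smul, Pi.smul_def, smul_smul]

theorem mat_diagonal (x : Fin n → ℝ) :
    (diagonal x : Herm c n).mat = Matrix.diagonal fun i => x i • (1 : c.K) := rfl

/-- The diagonal entries of a self-adjoint matrix, which are real. -/
def diagPart : Herm c n →ₗ[ℝ] (Fin n → ℝ) :=
  LinearMap.pi fun i => re ∘ₗ (LinearMap.proj i ∘ₗ LinearMap.proj i) ∘ₗ mat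

theorem diagPart_apply (X : Herm c n) (i : Fin n) : diagPart X i = re (X.mat i i) := rfl

theorem apply_self (X : Herm c n) (i : Fin n) : X.mat i i = diagPart X i • (1 : c.K) :=
  eq_re_of_star_eq _ (star_apply X i i)

@[simp] theorem diagPart_diagonal (x : Fin n → ℝ) : diagPart (diagonal x : Herm c n) = x := by
  ext i; simp [diagPart_apply, mat_diagonal]

/-- Conjugation by a unitary matrix. -/
def Ad (u : unitary (c.Mat n)) : Herm c n →ₗ[ℝ] Herm c n where
  toFun X := mk (u * X.mat * star (u : c.Mat n)) (by
    simp only [star_mul, star_star, star_mat, mul_assoc])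
  map_add' X Y := by ext1; simp [mul_add, add_mul]
  map_smul' r X := by ext1; simp

theorem mat_Ad (u : unitary (c.Mat n)) (X : Herm c n) :
    (Ad u X).mat = u * X.mat * star (u : c.Mat n) := rfl

theorem Ad_mul (u v : unitary (c.Mat n)) (X : Herm c n) : Ad (u * v) X = Ad u (Ad v X) := by
  ext1; simp [mat_Ad, mul_assoc]

@[simp] theorem Ad_one (X : Herm c n) : Ad 1 X = X := by
  ext1; simp [mat_Ad]

@[simp] theorem Ad_inv_Ad (u : unitary (c.Mat n)) (X : Herm c n) : Ad u⁻¹ (Ad u X) = X := by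
  rw [← Ad_mul]; simp

@[simp] theorem Ad_Ad_inv (u : unitary (c.Mat n)) (X : Herm c n) : Ad u (Ad u⁻¹ X) = X := by
  rw [← Ad_mul]; simp

theorem inner_Ad (u : unitary (c.Mat n)) (X Y : Herm c n) :
    inner ℝ (Ad u X) (Ad u Y) = inner ℝ X Y := by
  have h : star (u : c.Mat n) * u = 1 := Unitary.coe_star_mul_self u
  simp only [inner_eq, mat_Ad]
  rw [mul_assoc, traceForm_mul_comm, mul_assoc, mul_assoc, h, mul_one, traceForm_comm,
    traceForm_mul_comm, mul_assoc, h, mul_one, traceForm_comm]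

/-- Conjugation by a unitary matrix as a linear isometry. -/
def AdIso (u : unitary (c.Mat n)) : Herm c n ≃ₗᵢ[ℝ] Herm c n :=
  LinearIsometryEquiv.mk (LinearEquiv.ofLinearMap (Ad u) (Ad u⁻¹) (by ext1; simp) (by ext1; simp))
    fun X => by
      have h : ‖Ad u X‖ ^ 2 = ‖X‖ ^ 2 := by
        simp only [← real_inner_self_eq_norm_sq, inner_Ad]
      exact (sq_eq_sq₀ (norm_nonneg _) (norm_nonneg _)).1 h

@[simp] theorem AdIso_apply (u : unitary (c.Mat n)) (X : Herm c n) : AdIso u X = Ad u X := rfl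

/-- Entrywise multiplication by a symmetric real matrix. -/
def schur (s : Fin n → Fin n → ℝ) (hs : ∀ i j, s i j = s j i) : Herm c n →ₗ[ℝ] Herm c n where
  toFun X := mk (Matrix.of fun i j => s i j • X.mat i j) (by
    ext i j; rw [Matrix.star_apply, Matrix.of_apply, Matrix.of_apply, star_smul, star_apply, hs]
    rfl)
  map_add' X Y := by ext i j; simp
  map_smul' r X := by ext i j; simp [smul_comm r]

@[simp] theorem schur_apply (s : Fin n → Fin n → ℝ) (hs : ∀ i j, s i j = s j i) (X : Herm c n)
    (i j : Fin n) : (schur s hs X).mat i j = s i j • X.mat i j := rfl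

variable (c n) in
/-- A self-adjoint matrix is given by its diagonal and its entries above the diagonal. -/
def entries :
    Herm c n ≃ₗ[ℝ] (Fin n → ℝ) × ({p : Fin n × Fin n // p.1 < p.2} → c.K) where
  toFun X := (diagPart X, fun p => X.mat p.1.1 p.1.2)
  map_add' X Y := by ext <;> simp
  map_smul' r X := by ext <;> simp
  invFun q := mk (Matrix.of fun i j => if h : i < j then q.2 ⟨(i, j), h⟩ else
      if h : j < i then star (q.2 ⟨(j, i), h⟩) else q.1 i • 1) (by
    ext i j
    rw [Matrix.star_apply, Matrix.of_apply, Matrix.of_apply]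
    rcases lt_trichotomy i j with h | h | h
    · simp [h, h.not_gt]
    · subst h; simp
    · simp [h, h.not_gt])
  left_inv X := by
    ext i j
    rw [mat_mk, Matrix.of_apply]
    rcases lt_trichotomy i j with h | h | h
    · simp [h]
    · subst h; simp [apply_self]
    · simp [h, h.not_gt, star_apply]
  right_inv q := by
    ext i
    · simp [diagPart_apply]
    · simp [i.2]

/-- In the coordinates `entries` the map is diagonal: a diagonal entry contributes one real
coordinate, an entry above the diagonal a full copy of the scalars, of dimension `c.scalarDim`. -/
theorem det_schur (s : Fin n → Fin n → ℝ) (hs : ∀ i j, s i j = s j i) :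
    LinearMap.det (schur s hs : Herm c n →ₗ[ℝ] Herm c n) =
      (∏ i, s i i) * ∏ p : {p : Fin n × Fin n // p.1 < p.2}, s p.1.1 p.1.2 ^ c.scalarDim := by
  rw [← LinearMap.det_conj _ (entries c n)]
  have h : (entries c n : Herm c n →ₗ[ℝ] _) ∘ₗ schur s hs ∘ₗ ((entries c n).symm : _ →ₗ[ℝ] _) =
      LinearMap.prodMap
        (LinearMap.pi fun i : Fin n => (s i i • LinearMap.id (M := ℝ)) ∘ₗ LinearMap.proj i)
        (LinearMap.pi fun p : {p : Fin n × Fin n // p.1 < p.2} =>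
          (s p.1.1 p.1.2 • LinearMap.id (M := c.K)) ∘ₗ LinearMap.proj p) := by
    refine LinearMap.ext fun q => ?_
    obtain ⟨X, rfl⟩ := (entries c n).surjective q
    rw [LinearMap.comp_apply, LinearMap.comp_apply, LinearEquiv.coe_coe, LinearEquiv.coe_coe,
      LinearEquiv.symm_apply_apply]
    refine Prod.ext (funext fun i => ?_) (funext fun p => rfl)
    simp [entries, diagPart_apply]
  rw [h, LinearMap.det_prodMap, LinearMap.det_pi, LinearMap.det_pi]
  simp [LinearMap.det_smul, finrank_K]

theorem finrank_eq : Module.finrank ℝ (Herm c n) = n + c.scalarDim * (n * (n - 1) / 2) := by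
  rw [(entries c n).finrank_eq, Module.finrank_prod, Module.finrank_fintype_fun_eq_card,
    Fintype.card_fin, Module.finrank_pi_fintype]
  simp only [finrank_K, Finset.sum_const, Finset.card_univ, smul_eq_mul]
  rw [mul_comm c.scalarDim]
  congr 2
  rw [Fintype.card_subtype, ← Finset.univ_product_univ, Finset.card_filter, Finset.sum_product]
  have h : ∀ x : Fin n, (∑ y : Fin n, if (x, y).1 < (x, y).2 then 1 else 0) = n - 1 - x := by
    intro x
    rw [← Finset.card_filter, ← Fin.card_Ioi]
    congr 1; ext y; simp
  rw [Finset.sum_congr rfl fun x _ => h x, Fin.sum_univ_eq_sum_range fun k => n - 1 - k,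
    Finset.sum_range_reflect fun k => k, Finset.sum_range_id]

end Herm

/-- Products over pairs `i < j`. -/
theorem prod_pairs {M : Type*} [CommMonoid M] (f : Fin n → Fin n → M) :
    ∏ p : {p : Fin n × Fin n // p.1 < p.2}, f p.1.1 p.1.2 =
      ∏ i, ∏ j ∈ Finset.Ioi i, f i j := by
  rw [← Finset.prod_subtype (Finset.univ.filter fun p : Fin n × Fin n => p.1 < p.2) (by simp)
    (fun p => f p.1 p.2), Finset.prod_filter, ← Finset.univ_product_univ, Finset.prod_product]
  refine Finset.prod_congr rfl fun i _ => ?_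
  rw [← Finset.prod_filter]
  congr 1; ext j; simp

end Horn

/-! ### A smooth chart of the unitary group at the identity -/

/-- The exponential of a Banach algebra. -/
def ringExp {A : Type*} [NormedRing A] [NormedAlgebra ℝ A] (a : A) : A := NormedSpace.exp a

section RingExp

variable {A : Type*} [NormedRing A] [NormedAlgebra ℝ A]

theorem ringExp_zero : ringExp (0 : A) = 1 := NormedSpace.exp_zero

theorem star_ringExp [StarRing A] (hs : Continuous (star : A → A)) (a : A) :
    star (ringExp a) = ringExp (star a) :=
  have : ContinuousStar A := ⟨hs⟩
  NormedSpace.star_exp a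

variable [CompleteSpace A]

theorem ringExp_mul_ringExp_neg (a : A) : ringExp a * ringExp (-a) = 1 := by
  let : NormedAlgebra ℚ A := NormedAlgebra.restrictScalars ℚ ℝ A
  rw [ringExp, ringExp, ← NormedSpace.exp_add_of_commute (Commute.neg_right (Commute.refl a)),
    add_neg_cancel, NormedSpace.exp_zero]

theorem ringExp_mem_unitary [StarRing A] (hs : Continuous (star : A → A)) {a : A}
    (ha : star a = -a) : ringExp a ∈ unitary A := by
  rw [Unitary.mem_iff, star_ringExp hs, ha]
  exact ⟨by simpa using ringExp_mul_ringExp_neg (-a), ringExp_mul_ringExp_neg a⟩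

theorem contDiff_ringExp : ContDiff ℝ ∞ (ringExp : A → A) :=
  contDiff_iff_contDiffAt.2 fun x => (NormedSpace.exp_analytic (𝕂 := ℝ) x).contDiffAt

theorem hasStrictFDerivAt_ringExp_zero :
    HasStrictFDerivAt (ringExp : A → A) (ContinuousLinearMap.id ℝ A) 0 :=
  hasStrictFDerivAt_exp_zero

variable {E : Type*} [NormedAddCommGroup E] [NormedSpace ℝ E]

theorem contDiff_conj_ringExp {k D : E → A} (hk : ContDiff ℝ ∞ k) (hD : ContDiff ℝ ∞ D) :
    ContDiff ℝ ∞ fun x => ringExp (k x) * D x * ringExp (-k x) :=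
  ((contDiff_ringExp.comp hk).mul hD).mul (contDiff_ringExp.comp hk.neg)

/-- Product rule: where `k` vanishes both exponentials equal $1$ and have derivatives $\pm k'$,
which leaves a commutator with `D x₀` plus the derivative of `D`. -/
theorem hasStrictFDerivAt_conj_ringExp {k D : E → A} {k' D' F : E →L[ℝ] A} {x₀ : E}
    (hx₀ : k x₀ = 0) (hk : HasStrictFDerivAt k k' x₀) (hD : HasStrictFDerivAt D D' x₀)
    (hF : ∀ x, F x = k' x * D x₀ - D x₀ * k' x + D' x) :
    HasStrictFDerivAt (fun x => ringExp (k x) * D x * ringExp (-k x)) F x₀ := by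
  have h1 : HasStrictFDerivAt (fun x => ringExp (k x)) _ x₀ :=
    HasStrictFDerivAt.comp x₀ (hx₀.symm ▸ hasStrictFDerivAt_ringExp_zero) hk
  have h2 : HasStrictFDerivAt (fun x => ringExp (-k x)) _ x₀ :=
    HasStrictFDerivAt.comp x₀ (f := fun x => -k x)
      (by rw [hx₀, neg_zero]; exact hasStrictFDerivAt_ringExp_zero) hk.neg
  refine ((h1.mul' hD).mul' h2).congr_fderiv ?_
  ext1 x
  rw [hF]
  simp [hx₀, ringExp_zero]
  abel

end RingExp

namespace Horn

open SelfAdjointCase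

variable {c : SelfAdjointCase} {n : ℕ}

section Exp

open scoped Matrix.Norms.Operator

theorem exp_mem_unitary (a : c.Mat n) (ha : star a = -a) : ringExp a ∈ unitary (c.Mat n) :=
  let L : c.Mat n →ₗ[ℝ] c.Mat n :=
    { toFun := star, map_add' := star_add, map_smul' := fun r x => by simp [star_smul] }
  ringExp_mem_unitary L.continuous_of_finiteDimensional ha

open Classical in
/-- The exponential, as a map from skew-adjoint matrices to unitary matrices. -/
def expU (a : c.Mat n) : unitary (c.Mat n) :=
  if ha : star a = -a then ⟨ringExp a, exp_mem_unitary a ha⟩ else 1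

theorem coe_expU {a : c.Mat n} (ha : star a = -a) : (expU a : c.Mat n) = ringExp a := by
  rw [expU, dif_pos ha]

theorem star_coe_expU {a : c.Mat n} (ha : star a = -a) :
    star (expU a : c.Mat n) = ringExp (-a) := by
  let L : c.Mat n →ₗ[ℝ] c.Mat n :=
    { toFun := star, map_add' := star_add, map_smul' := fun r x => by simp [star_smul] }
  rw [coe_expU ha, star_ringExp L.continuous_of_finiteDimensional, ha]

theorem expU_zero : expU (0 : c.Mat n) = 1 := by
  have h : star (0 : c.Mat n) = -0 := by rw [neg_zero, star_zero]
  exact Subtype.ext ((coe_expU h).trans ringExp_zero)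

variable {E : Type*} [NormedAddCommGroup E] [NormedSpace ℝ E]

/-- Replacing the adjoint of $e^k$ by $e^{-k}$ and projecting with the linear map `ofMat` exhibits
the conjugation as a composite of visibly smooth maps. -/
theorem Ad_expU {k : E →ₗ[ℝ] c.Mat n} (hk : ∀ x, star (k x) = -k x) (D : E → Herm c n) :
    (fun x => Herm.Ad (expU (k x)) (D x)) = fun x => LinearMap.toContinuousLinearMap Herm.ofMat
      (ringExp (k x) * (D x).mat * ringExp (-k x)) := by
  ext1 x
  rw [← star_coe_expU (hk x), ← coe_expU (hk x), ← Herm.mat_Ad]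
  exact (Herm.ofMat_mat _).symm

variable [FiniteDimensional ℝ E]

/-- A family of self-adjoint matrices conjugated by exponentials is smooth. -/
theorem contDiff_Ad_expU (k : E →ₗ[ℝ] c.Mat n) (hk : ∀ x, star (k x) = -k x)
    {D : E → Herm c n} (hD : ContDiff ℝ ∞ D) :
    ContDiff ℝ ∞ fun x => Herm.Ad (expU (k x)) (D x) := by
  rw [Ad_expU hk]
  have hm : ContDiff ℝ ∞ fun x => (D x).mat :=
    (LinearMap.toContinuousLinearMap (Herm.mat (c := c) (n := n))).contDiff.comp hD
  exact (ContinuousLinearMap.contDiff _).comp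
    (contDiff_conj_ringExp (LinearMap.toContinuousLinearMap k).contDiff hm)

/-- The operator norm on matrices serves only to form and differentiate the exponential;
differentiation here is between `E` and `Herm c n`, whose norms do not involve it. -/
theorem hasStrictFDerivAt_Ad_expU (k : E →ₗ[ℝ] c.Mat n) (hk : ∀ x, star (k x) = -k x)
    {D : E → Herm c n} {D' : E →L[ℝ] Herm c n} {x₀ : E} (hx₀ : k x₀ = 0)
    (hD : HasStrictFDerivAt D D' x₀) {F : E →L[ℝ] Herm c n}
    (hF : ∀ x, (F x).mat = k x * (D x₀).mat - (D x₀).mat * k x + (D' x).mat) :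
    HasStrictFDerivAt (fun x => Herm.Ad (expU (k x)) (D x)) F x₀ := by
  rw [Ad_expU hk]
  have hm := (LinearMap.toContinuousLinearMap
    (Herm.mat (c := c) (n := n))).hasStrictFDerivAt.comp x₀ hD
  have h := hasStrictFDerivAt_conj_ringExp (k := k) (D := fun x => (D x).mat)
    (F := (LinearMap.toContinuousLinearMap (Herm.mat (c := c) (n := n))).comp F) hx₀
    (LinearMap.toContinuousLinearMap k).hasStrictFDerivAt hm (fun x => hF x)
  refine ((ContinuousLinearMap.hasStrictFDerivAt _).comp x₀ h).congr_fderiv ?_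
  ext1 x
  exact Herm.ofMat_mat _

end Exp

end Horn

namespace Horn

open SelfAdjointCase

variable {c : SelfAdjointCase} {n : ℕ}

namespace Herm

theorem continuous_mat : Continuous (mat : Herm c n → c.Mat n) :=
  mat.continuous_of_finiteDimensional

theorem continuous_ofMat : Continuous (ofMat : c.Mat n → Herm c n) :=
  ofMat.continuous_of_finiteDimensional

theorem continuous_iff {α : Type*} [TopologicalSpace α] {f : α → Herm c n} :
    Continuous f ↔ Continuous fun a => (f a).mat :=
  ⟨fun h => continuous_mat.comp h, fun h =>
    (continuous_ofMat.comp h).congr fun _ => ofMat_mat _⟩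

theorem continuous_Ad {α : Type*} [TopologicalSpace α] {f : α → unitary (c.Mat n)}
    {g : α → Herm c n} (hf : Continuous f) (hg : Continuous g) :
    Continuous fun a => Ad (f a) (g a) := by
  rw [continuous_iff]
  simp only [mat_Ad]
  have h1 : Continuous fun a => (f a : c.Mat n) := continuous_subtype_val.comp hf
  exact (h1.mul (continuous_mat.comp hg)).mul h1.star

theorem continuous_diagonal : Continuous (diagonal : (Fin n → ℝ) → Herm c n) :=
  diagonal.continuous_of_finiteDimensional

/-! ### The spectral theorem -/

/-- Maximize $u\mapsto\langle uXu^*,D\rangle$ over the compact unitary group. At a maximum the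
derivative in the skew direction $Y=[X',D]$ vanishes, and it is $-|Y|^2$. The argument is the same
over all three kinds of scalars. -/
theorem exists_Ad_commute (X D : Herm c n) :
    ∃ u : unitary (c.Mat n), (Ad u X).mat * D.mat = D.mat * (Ad u X).mat := by
  have hc : Continuous fun u : unitary (c.Mat n) => inner ℝ (Ad u X) D :=
    (continuous_Ad continuous_id continuous_const).inner continuous_const
  obtain ⟨u, -, hu⟩ := isCompact_univ.exists_isMaxOn univ_nonempty hc.continuousOn
  refine ⟨u, ?_⟩
  set X' := Ad u X with hX'
  set Y := X'.mat * D.mat - D.mat * X'.mat with hY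
  have hYs : star Y = -Y := by simp [hY, star_mat]
  let k : ℝ →ₗ[ℝ] c.Mat n := LinearMap.toSpanSingleton ℝ _ Y
  have hk : ∀ t, star (k t) = -k t := fun t => by
    simp [k, LinearMap.toSpanSingleton_apply, hYs]
  let F : ℝ →L[ℝ] Herm c n := ContinuousLinearMap.toSpanSingleton ℝ (ofMat (Y * X'.mat - X'.mat * Y))
  have hsa : star (Y * X'.mat - X'.mat * Y) = Y * X'.mat - X'.mat * Y := by
    simp [hYs, star_mat]; abel
  have h1 : HasStrictFDerivAt (fun t => Ad (expU (k t)) X') F 0 := by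
    refine hasStrictFDerivAt_Ad_expU k hk (by simp) (hasStrictFDerivAt_const X' 0) fun t => ?_
    rw [ContinuousLinearMap.toSpanSingleton_apply, map_smul, mat_ofMat hsa]
    simp [k, LinearMap.toSpanSingleton_apply, smul_sub]
  have h2 : HasDerivAt (fun t => inner ℝ (Ad (expU (k t)) X') D)
      (inner ℝ (ofMat (Y * X'.mat - X'.mat * Y)) D) 0 := by
    have := h1.hasFDerivAt.hasDerivAt.inner ℝ (hasDerivAt_const (0 : ℝ) D)
    simpa [F] using this
  have h3 : IsLocalMax (fun t => inner ℝ (Ad (expU (k t)) X') D) 0 := by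
    refine Eventually.of_forall fun t => ?_
    simp only [map_zero, expU_zero, Ad_one]
    rw [hX', ← Ad_mul]
    exact hu (mem_univ _)
  have h4 := h3.hasDerivAt_eq_zero h2
  rw [inner_eq, mat_ofMat hsa] at h4
  -- Cyclicity turns $\langle[Y,X'],D\rangle$ into $\langle Y,[X',D]\rangle=\langle Y,Y\rangle$, and
  -- $Y^*=-Y$ makes this minus a sum of squares.
  have h5 : traceForm Y (star Y) = 0 := by
    have : traceForm (Y * X'.mat - X'.mat * Y) D.mat =
        traceForm Y (X'.mat * D.mat - D.mat * X'.mat) := by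
      rw [sub_eq_add_neg, traceForm_add_left, ← neg_one_smul ℝ (X'.mat * Y), traceForm_smul_left,
        traceForm_mul_comm X'.mat Y]
      simp only [traceForm, mul_sub, Matrix.trace_sub, inner_sub_right, mul_assoc]
      ring
    rw [hYs, traceForm_comm, ← neg_one_smul ℝ Y, traceForm_smul_left, ← this, h4, mul_zero]
  rw [traceForm_star] at h5
  have hnn : ∀ i j, 0 ≤ inner ℝ (Y i j) (Y i j) := fun i j => real_inner_self_nonneg
  have h6 := (Finset.sum_eq_zero_iff_of_nonneg
    (fun i _ => Finset.sum_nonneg fun j _ => hnn i j)).1 h5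
  have h7 : Y = 0 := by
    ext i j
    have h2 := (Finset.sum_eq_zero_iff_of_nonneg (fun j _ => hnn i j)).1 (h6 i (Finset.mem_univ _))
    exact inner_self_eq_zero.1 (h2 j (Finset.mem_univ _))
  exact sub_eq_zero.1 h7

theorem mul_diagonal_apply (A : c.Mat n) (x : Fin n → ℝ) (i j : Fin n) :
    (A * (diagonal x : Herm c n).mat) i j = x j • A i j := by
  rw [mat_diagonal, Matrix.mul_diagonal, mul_smul_comm, mul_one]

theorem diagonal_mul_apply (A : c.Mat n) (x : Fin n → ℝ) (i j : Fin n) :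
    ((diagonal x : Herm c n).mat * A) i j = x i • A i j := by
  rw [mat_diagonal, Matrix.diagonal_mul, smul_mul_assoc, one_mul]

theorem eq_diagonal {X : Herm c n} (h : ∀ i j, i ≠ j → X.mat i j = 0) :
    X = diagonal (diagPart X) := by
  ext i j
  rw [mat_diagonal]
  by_cases hij : i = j
  · subst hij; rw [Matrix.diagonal_apply_eq, apply_self]
  · rw [Matrix.diagonal_apply_ne _ hij, h i j hij]

/-- The permutation matrix of `σ`. -/
def permU (c : SelfAdjointCase) (σ : Equiv.Perm (Fin n)) : unitary (c.Mat n) :=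
  ⟨(1 : c.Mat n).submatrix σ id, by
    have h : star ((1 : c.Mat n).submatrix σ id) = (1 : c.Mat n).submatrix id σ := by
      rw [Matrix.star_eq_conjTranspose, Matrix.conjTranspose_submatrix, Matrix.conjTranspose_one]
    rw [Unitary.mem_iff, h]
    constructor
    · rw [Matrix.submatrix_mul_equiv, mul_one, Matrix.submatrix_id_id]
    · have := Matrix.submatrix_mul_equiv (1 : c.Mat n) (1 : c.Mat n) σ (Equiv.refl _) σ
      simp only [Equiv.coe_refl] at this
      rw [this, mul_one, Matrix.submatrix_one_equiv]⟩

theorem Ad_permU (σ : Equiv.Perm (Fin n)) (x : Fin n → ℝ) :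
    Ad (permU c σ) (diagonal x) = diagonal (x ∘ σ) := by
  have h : star ((1 : c.Mat n).submatrix σ id) = (1 : c.Mat n).submatrix id σ := by
    rw [Matrix.star_eq_conjTranspose, Matrix.conjTranspose_submatrix, Matrix.conjTranspose_one]
  ext i j
  have h1 : (1 : c.Mat n).submatrix σ id * (diagonal x : Herm c n).mat =
      (diagonal x : Herm c n).mat.submatrix σ id := by
    have := Matrix.submatrix_mul_equiv (1 : c.Mat n) (diagonal x : Herm c n).mat σ
      (Equiv.refl _) id
    rwa [one_mul] at this
  have h2 : (diagonal x : Herm c n).mat.submatrix σ id * (1 : c.Mat n).submatrix id σ =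
      (diagonal x : Herm c n).mat.submatrix σ σ := by
    have := Matrix.submatrix_mul_equiv (diagonal x : Herm c n).mat (1 : c.Mat n) σ
      (Equiv.refl _) σ
    rwa [mul_one] at this
  rw [mat_Ad, permU, h, h1, h2, mat_diagonal, mat_diagonal, Matrix.submatrix_diagonal_equiv]
  rfl

theorem exists_diagonalization (X : Herm c n) :
    ∃ x : Fin n → ℝ, Antitone x ∧ ∃ u : unitary (c.Mat n), X = Ad u (diagonal x) := by
  -- Any diagonal matrix with distinct entries would do: commuting with it forces the off-diagonal
  -- entries to vanish.
  obtain ⟨u, hu⟩ := exists_Ad_commute X (diagonal fun i => (i : ℝ))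
  have h1 : Ad u X = diagonal (diagPart (Ad u X)) := by
    refine eq_diagonal fun i j hij => ?_
    have h := congrFun (congrFun hu i) j
    rw [mul_diagonal_apply, diagonal_mul_apply, ← sub_eq_zero, ← sub_smul] at h
    refine (smul_eq_zero.1 h).resolve_left (sub_ne_zero.2 ?_)
    exact fun h => hij (Fin.ext (Nat.cast_injective h)).symm
  set x := diagPart (Ad u X)
  -- Sorting produces a non-decreasing tuple, hence the sign.
  let σ := Tuple.sort (-x)
  refine ⟨x ∘ σ, fun i j hij => ?_, u⁻¹ * (permU c σ)⁻¹, ?_⟩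
  · have := Tuple.monotone_sort (-x) hij
    simpa using this
  · rw [← Ad_permU, ← Ad_mul, mul_assoc, inv_mul_cancel, mul_one, ← h1, Ad_inv_Ad]

end Herm

end Horn

namespace Horn

open SelfAdjointCase

variable {c : SelfAdjointCase} {n : ℕ}

namespace Herm

/-! ### The sorted spectrum -/

theorem coe_mul_star (u : unitary (c.Mat n)) : (u : c.Mat n) * star (u : c.Mat n) = 1 :=
  Unitary.mul_star_self_of_mem u.2

theorem coe_star_mul (u : unitary (c.Mat n)) : star (u : c.Mat n) * (u : c.Mat n) = 1 :=
  Unitary.star_mul_self_of_mem u.2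

theorem sum_norm_sq_row (u : unitary (c.Mat n)) (i : Fin n) :
    ∑ j, ‖(u : c.Mat n) i j‖ ^ 2 = 1 := by
  have h1 : ((u : c.Mat n) * star (u : c.Mat n)) i i = 1 :=
    (congrFun (congrFun (coe_mul_star u) i) i).trans (Matrix.one_apply_eq i)
  rw [Matrix.mul_apply] at h1
  simp only [Matrix.star_apply, mul_star_self_eq] at h1
  rw [← Finset.sum_smul] at h1
  simpa using congrArg re h1

theorem sum_norm_sq_col (u : unitary (c.Mat n)) (j : Fin n) :
    ∑ i, ‖(u : c.Mat n) i j‖ ^ 2 = 1 := by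
  rw [← sum_norm_sq_row u⁻¹ j]
  refine Finset.sum_congr rfl fun i _ => ?_
  rw [← norm_star_K]
  rfl

/-- The unitary $w=v^{-1}u$ satisfies $w\operatorname{diag}(x)=\operatorname{diag}(y)w$; compare
entries. -/
theorem intertwine {u v : unitary (c.Mat n)} {x y : Fin n → ℝ}
    (h : Ad u (diagonal x) = Ad v (diagonal y)) (i j : Fin n) :
    ((v⁻¹ * u : unitary (c.Mat n)) : c.Mat n) i j = 0 ∨ x j = y i := by
  have h1 : Ad (v⁻¹ * u) (diagonal x) = diagonal y := by rw [Ad_mul, h, Ad_inv_Ad]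
  set w := v⁻¹ * u
  have h2 : (w : c.Mat n) * (diagonal x : Herm c n).mat = (diagonal y : Herm c n).mat * w := by
    rw [← h1, mat_Ad, mul_assoc, coe_star_mul, mul_one]
  have h3 := congrFun (congrFun h2 i) j
  rw [mul_diagonal_apply, diagonal_mul_apply, ← sub_eq_zero, ← sub_smul, smul_eq_zero,
    sub_eq_zero] at h3
  exact h3.symm

/-- The numbers $|w_{ij}|^2$ have row and column sums $1$ and vanish unless $x_j=y_i$, so $x$ and
$y$ have equally many entries at least $x_k$. If $y_k<x_k$, monotonicity gives at least $k+1$ of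
them in $x$ and at most $k$ in $y$. -/
theorem diagonal_unique_le {u v : unitary (c.Mat n)} {x y : Fin n → ℝ} (hx : Antitone x)
    (hy : Antitone y) (h : Ad u (diagonal x) = Ad v (diagonal y)) : x ≤ y := by
  intro k
  by_contra! hk
  set w : c.Mat n := ((v⁻¹ * u : unitary (c.Mat n)) : c.Mat n)
  have hcard : ((Finset.univ.filter fun j => x k ≤ x j).card : ℝ) =
      (Finset.univ.filter fun i => x k ≤ y i).card := by
    have h1 : ((Finset.univ.filter fun j => x k ≤ x j).card : ℝ) =
        ∑ j, ∑ i, if x k ≤ x j then ‖w i j‖ ^ 2 else 0 := by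
      rw [Finset.card_filter, Nat.cast_sum]
      refine Finset.sum_congr rfl fun j _ => ?_
      split_ifs
      · rw [sum_norm_sq_col, Nat.cast_one]
      · simp
    have h2 : ((Finset.univ.filter fun i => x k ≤ y i).card : ℝ) =
        ∑ i, ∑ j, if x k ≤ y i then ‖w i j‖ ^ 2 else 0 := by
      rw [Finset.card_filter, Nat.cast_sum]
      refine Finset.sum_congr rfl fun j _ => ?_
      split_ifs
      · rw [sum_norm_sq_row, Nat.cast_one]
      · simp
    rw [h1, h2, Finset.sum_comm]
    refine Finset.sum_congr rfl fun i _ => Finset.sum_congr rfl fun j _ => ?_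
    rcases intertwine h i j with h0 | h0
    · rw [show w i j = 0 from h0]; simp
    · rw [h0]
  have h3 : (k : ℕ) + 1 ≤ (Finset.univ.filter fun j => x k ≤ x j).card := by
    rw [← Fin.card_Iic]
    exact Finset.card_le_card fun j hj => by simpa using hx (Finset.mem_Iic.1 hj)
  have h4 : (Finset.univ.filter fun i => x k ≤ y i).card ≤ k := by
    rw [← Fin.card_Iio]
    refine Finset.card_le_card fun j hj => ?_
    simp only [Finset.mem_filter, Finset.mem_univ, true_and] at hj
    rw [Finset.mem_Iio]
    by_contra! hjk
    exact absurd (hy hjk) (not_le.2 (hk.trans_le hj))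
  have h5 := Nat.cast_injective (R := ℝ) hcard
  omega

theorem diagonal_unique {u v : unitary (c.Mat n)} {x y : Fin n → ℝ} (hx : Antitone x)
    (hy : Antitone y) (h : Ad u (diagonal x) = Ad v (diagonal y)) : x = y :=
  le_antisymm (diagonal_unique_le hx hy h) (diagonal_unique_le hy hx h.symm)

/-- The spectrum in non-increasing order. -/
def spec (X : Herm c n) : Fin n → ℝ := (exists_diagonalization X).choose

theorem antitone_spec (X : Herm c n) : Antitone (spec X) :=
  (exists_diagonalization X).choose_spec.1

/-- An orthonormal frame of eigenvectors. -/
def frame (X : Herm c n) : unitary (c.Mat n) := (exists_diagonalization X).choose_spec.2.choose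

theorem eq_Ad_frame (X : Herm c n) : X = Ad (frame X) (diagonal (spec X)) :=
  (exists_diagonalization X).choose_spec.2.choose_spec

theorem spec_Ad_diagonal (u : unitary (c.Mat n)) {x : Fin n → ℝ} (hx : Antitone x) :
    spec (Ad u (diagonal x)) = x :=
  diagonal_unique (antitone_spec _) hx (eq_Ad_frame _).symm

theorem spec_diagonal {x : Fin n → ℝ} (hx : Antitone x) : spec (diagonal x : Herm c n) = x := by
  simpa using spec_Ad_diagonal (c := c) 1 hx

@[simp] theorem spec_Ad (u : unitary (c.Mat n)) (X : Herm c n) : spec (Ad u X) = spec X := by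
  conv_lhs => rw [eq_Ad_frame X, ← Ad_mul]
  exact spec_Ad_diagonal _ (antitone_spec X)

theorem norm_sq_diagonal (x : Fin n → ℝ) : ‖(diagonal x : Herm c n)‖ ^ 2 = ∑ i, x i ^ 2 := by
  rw [norm_sq_eq]
  refine Finset.sum_congr rfl fun i _ => ?_
  rw [Finset.sum_eq_single i]
  · rw [mat_diagonal, Matrix.diagonal_apply_eq, norm_smul, norm_one, mul_one, Real.norm_eq_abs,
      sq_abs]
  · intro j _ hj
    rw [mat_diagonal, Matrix.diagonal_apply_ne _ hj.symm]; simp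
  · simp

theorem norm_Ad (u : unitary (c.Mat n)) (X : Herm c n) : ‖Ad u X‖ = ‖X‖ := (AdIso u).norm_map X

theorem norm_le_norm_diagonal (x : Fin n → ℝ) : ‖x‖ ≤ ‖(diagonal x : Herm c n)‖ := by
  refine (pi_norm_le_iff_of_nonneg (norm_nonneg _)).2 fun i => ?_
  refine (Real.norm_eq_abs _).trans_le (abs_le_of_sq_le_sq ?_ (norm_nonneg _))
  rw [norm_sq_diagonal]
  exact Finset.single_le_sum (f := fun i => x i ^ 2) (fun i _ => sq_nonneg _) (Finset.mem_univ i)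

variable (c n) in
/-- The map sending a frame and a sorted spectrum to the corresponding matrix. -/
def assemble (p : unitary (c.Mat n) × {x : Fin n → ℝ // Antitone x}) : Herm c n :=
  Ad p.1 (diagonal p.2.1)

theorem continuous_assemble : Continuous (assemble c n) :=
  continuous_Ad continuous_fst
    (continuous_diagonal.comp (continuous_subtype_val.comp continuous_snd))

theorem surjective_assemble : Function.Surjective (assemble c n) := fun X =>
  ⟨(frame X, ⟨spec X, antitone_spec X⟩), (eq_Ad_frame X).symm⟩

theorem isClosed_antitone : IsClosed {x : Fin n → ℝ | Antitone x} := by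
  simp only [Antitone, ofPred_forall]
  exact isClosed_iInter fun i => isClosed_iInter fun j => isClosed_iInter fun _ =>
    isClosed_le (continuous_apply _) (continuous_apply _)

/-- The map is proper: the unitary group is compact, and the norm of the matrix bounds its
eigenvalues. -/
theorem isClosedMap_assemble : IsClosedMap (assemble c n) := by
  refine IsProperMap.isClosedMap (isProperMap_iff_isCompact_preimage.2
    ⟨continuous_assemble, fun K hK => ?_⟩)
  obtain ⟨R, hR⟩ := hK.isBounded.exists_norm_le
  have h1 : IsCompact ((Subtype.val : {x : Fin n → ℝ // Antitone x} → _) ⁻¹'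
      Metric.closedBall 0 R) :=
    isClosed_antitone.isClosedEmbedding_subtypeVal.isCompact_preimage
      (isCompact_closedBall (0 : Fin n → ℝ) R)
  refine (isCompact_univ.prod h1).of_isClosed_subset
    (hK.isClosed.preimage continuous_assemble) fun p hp => ⟨mem_univ _, ?_⟩
  rw [mem_preimage, mem_closedBall_zero_iff]
  refine (norm_le_norm_diagonal (c := c) _).trans ?_
  rw [← norm_Ad p.1]
  exact hR _ hp

theorem isQuotientMap_assemble : IsQuotientMap (assemble c n) :=
  isClosedMap_assemble.isQuotientMap continuous_assemble surjective_assemble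

/-- No perturbation estimate is needed: composed with the quotient map `assemble`, the spectrum is a
coordinate projection. -/
theorem continuous_spec : Continuous (spec : Herm c n → Fin n → ℝ) := by
  rw [isQuotientMap_assemble.continuous_iff]
  have : spec ∘ assemble c n = fun p => p.2.1 := funext fun p => spec_Ad_diagonal _ p.2.2
  rw [this]
  exact continuous_subtype_val.comp continuous_snd

/-- The matrix with the same eigenvectors as `X` and with eigenvalues `y`. -/
def reSpec (y : Fin n → ℝ) (X : Herm c n) : Herm c n := Ad (frame X) (diagonal y)

/-- When $x$ has distinct entries, $v^{-1}u$ is a diagonal matrix and so commutes with every real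
diagonal matrix. This makes `reSpec` independent of the chosen eigenframe on matrices with simple
spectrum. -/
theorem Ad_diagonal_congr {u v : unitary (c.Mat n)} {x : Fin n → ℝ} (hx : Function.Injective x)
    (h : Ad u (diagonal x) = Ad v (diagonal x)) (y : Fin n → ℝ) :
    Ad u (diagonal y) = Ad v (diagonal y) := by
  have h1 : ((v⁻¹ * u : unitary (c.Mat n)) : c.Mat n) * (diagonal y : Herm c n).mat =
      (diagonal y : Herm c n).mat * (v⁻¹ * u : unitary (c.Mat n)) := by
    ext i j
    rw [mul_diagonal_apply, diagonal_mul_apply]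
    rcases intertwine h i j with h0 | h0
    · rw [h0, smul_zero, smul_zero]
    · rw [hx h0]
  have h2 : Ad (v⁻¹ * u) (diagonal y) = diagonal y := by
    ext1
    rw [mat_Ad, h1, mul_assoc, coe_mul_star, mul_one]
  rw [Ad_mul] at h2
  rw [← h2, Ad_Ad_inv, h2]

theorem reSpec_Ad_diagonal (y : Fin n → ℝ) (u : unitary (c.Mat n)) {x : Fin n → ℝ}
    (hx : StrictAnti x) : reSpec y (Ad u (diagonal x)) = Ad u (diagonal y) := by
  refine Ad_diagonal_congr hx.injective ?_ y
  conv_rhs => rw [eq_Ad_frame (Ad u (diagonal x))]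
  rw [spec_Ad_diagonal _ hx.antitone]

theorem reSpec_Ad (y : Fin n → ℝ) (u : unitary (c.Mat n)) {X : Herm c n}
    (hX : StrictAnti (spec X)) : reSpec y (Ad u X) = Ad u (reSpec y X) := by
  conv_lhs => rw [eq_Ad_frame X, ← Ad_mul]
  rw [reSpec_Ad_diagonal y _ hX, Ad_mul]; rfl

theorem isOpen_strictAnti : IsOpen {x : Fin n → ℝ | StrictAnti x} := by
  simp only [StrictAnti, ofPred_forall]
  exact isOpen_iInter_of_finite fun i => isOpen_iInter_of_finite fun j =>
    isOpen_iInter_of_finite fun _ => isOpen_lt (continuous_apply _) (continuous_apply _)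

variable (c n) in
/-- The self-adjoint matrices with simple spectrum. -/
def simple : Set (Herm c n) := {X | StrictAnti (spec X)}

theorem isOpen_simple : IsOpen (simple c n) := isOpen_strictAnti.preimage continuous_spec

/-- Eigenframes cannot be chosen continuously in general, so continuity is again tested on the
quotient map, restricted to the saturated set of simple spectra. -/
theorem continuousOn_reSpec (y : Fin n → ℝ) : ContinuousOn (reSpec y) (simple c n) := by
  rw [continuousOn_iff_continuous_domRestrict]
  have hq : IsQuotientMap ((simple c n).restrictPreimage (assemble c n)) :=
    (isClosedMap_assemble.restrictPreimage _).isQuotientMap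
      (continuous_assemble.restrictPreimage) (surjective_assemble.restrictPreimage _)
  rw [hq.continuous_iff]
  have : (simple c n).domRestrict (reSpec y) ∘ (simple c n).restrictPreimage (assemble c n) =
      fun p => Ad p.1.1 (diagonal y) := by
    ext1 p
    refine reSpec_Ad_diagonal y _ ?_
    have h : StrictAnti (spec (assemble c n p.1)) := p.2
    rwa [assemble, spec_Ad_diagonal _ p.1.2.2] at h
  rw [this]
  exact continuous_Ad (continuous_fst.comp continuous_subtype_val) continuous_const

/-! ### Smoothness of simple eigenvalues -/

/-- The skew-adjoint matrix `Y` with `[Y, diagonal x] = Z` off the diagonal. -/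
def skewOf (x : Fin n → ℝ) : Herm c n →ₗ[ℝ] c.Mat n where
  -- On the diagonal the inverse of $0$ is $0$, so the diagonal of `Z` is discarded.
  toFun Z := Matrix.of fun i j => (x j - x i)⁻¹ • Z.mat i j
  map_add' Y Z := by ext i j; simp
  map_smul' r Z := by ext i j; simp [smul_comm r]

theorem skewOf_apply (x : Fin n → ℝ) (Z : Herm c n) (i j : Fin n) :
    skewOf x Z i j = (x j - x i)⁻¹ • Z.mat i j := rfl

theorem star_skewOf (x : Fin n → ℝ) (Z : Herm c n) : star (skewOf x Z) = -skewOf x Z := by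
  ext i j
  rw [Matrix.star_apply, Matrix.neg_apply, skewOf_apply, skewOf_apply, star_smul, star_apply,
    ← neg_smul, ← neg_sub (x j), inv_neg, star_trivial]

/-- A local parametrization of self-adjoint matrices near a simple diagonal matrix. -/
def spectralChart (x : Fin n → ℝ) (Z : Herm c n) : Herm c n :=
  Ad (expU (skewOf x Z)) (diagonal (diagPart Z))

theorem skewOf_diagonal (x y : Fin n → ℝ) : skewOf x (diagonal y : Herm c n) = 0 := by
  ext i j
  rw [skewOf_apply, mat_diagonal]
  by_cases h : i = j
  · subst h; simp
  · rw [Matrix.diagonal_apply_ne _ h]; simp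

theorem spectralChart_diagonal (x y : Fin n → ℝ) :
    spectralChart x (diagonal y : Herm c n) = diagonal y := by
  rw [spectralChart, skewOf_diagonal, expU_zero, diagPart_diagonal, Ad_one]

theorem contDiff_spectralChart (x : Fin n → ℝ) :
    ContDiff ℝ ∞ (spectralChart x : Herm c n → Herm c n) :=
  contDiff_Ad_expU _ (star_skewOf x)
    (LinearMap.toContinuousLinearMap (diagonal (c := c) ∘ₗ diagPart)).contDiff

/-- The commutator with $\operatorname{diag}(x)$ multiplies the $(i,j)$ entry by $x_j-x_i$,
cancelling the denominator in `skewOf`; the moving diagonal supplies the diagonal entries. -/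
theorem hasStrictFDerivAt_spectralChart {x : Fin n → ℝ} (hx : StrictAnti x) :
    HasStrictFDerivAt (spectralChart x : Herm c n → Herm c n) (ContinuousLinearMap.id ℝ _)
      (diagonal x) := by
  refine hasStrictFDerivAt_Ad_expU _ (star_skewOf x) (skewOf_diagonal x x)
    (LinearMap.toContinuousLinearMap (diagonal (c := c) ∘ₗ diagPart)).hasStrictFDerivAt fun Z => ?_
  ext i j
  rw [Matrix.add_apply, Matrix.sub_apply]
  change Z.mat i j = (skewOf x Z * (diagonal (diagPart (diagonal x : Herm c n)) : Herm c n).mat) i j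
    - ((diagonal (diagPart (diagonal x : Herm c n)) : Herm c n).mat * skewOf x Z) i j
    + (diagonal (diagPart Z) : Herm c n).mat i j
  rw [diagPart_diagonal, mul_diagonal_apply, diagonal_mul_apply, mat_diagonal, skewOf_apply,
    smul_smul, smul_smul, ← sub_smul, ← sub_mul]
  by_cases h : i = j
  · subst h; simp [apply_self]
  · rw [Matrix.diagonal_apply_ne _ h, add_zero, mul_inv_cancel₀, one_smul]
    exact sub_ne_zero.2 fun h' => h (hx.injective h').symm

/-- Inverse function theorem. Strict decrease is an open condition, so near $\operatorname{diag}(x)$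
the diagonal of `g X` lists the eigenvalues of `X` already sorted. -/
theorem exists_spectralChart_inverse {x : Fin n → ℝ} (hx : StrictAnti x) :
    ∃ g : Herm c n → Herm c n, ContDiffAt ℝ ∞ g (diagonal x) ∧ g (diagonal x) = diagonal x ∧
      HasStrictFDerivAt g (ContinuousLinearMap.id ℝ _) (diagonal x) ∧
      ∀ᶠ X in 𝓝 (diagonal x), spectralChart x (g X) = X ∧ StrictAnti (diagPart (g X)) := by
  have h1 : HasStrictFDerivAt (spectralChart x : Herm c n → Herm c n)
    ((ContinuousLinearEquiv.refl ℝ (Herm c n) : Herm c n ≃L[ℝ] Herm c n) : Herm c n →L[ℝ] Herm c n)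
      (diagonal x) := hasStrictFDerivAt_spectralChart hx
  have h0 := spectralChart_diagonal (c := c) x x
  have hd : ContDiffAt ℝ ∞ (spectralChart x : Herm c n → Herm c n) (diagonal x) :=
    (contDiff_spectralChart x).contDiffAt
  have hg := hd.to_localInverse h1.hasFDerivAt (by simp)
  have hga := hd.localInverse_apply_image h1.hasFDerivAt (by simp)
  have hg' := h1.to_localInverse
  have hr := h1.eventually_right_inverse
  rw [h0] at hg hga hg' hr
  refine ⟨_, hg, hga, hg', ?_⟩
  have hcont : ContinuousAt (fun X => diagPart (h1.localInverse _ _ _ X)) (diagonal x) :=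
    (LinearMap.continuous_of_finiteDimensional diagPart).continuousAt.comp hg.continuousAt
  have hs : ∀ᶠ X in 𝓝 (diagonal x), StrictAnti (diagPart (h1.localInverse _ _ _ X)) := by
    refine hcont.eventually_mem (isOpen_strictAnti.mem_nhds ?_)
    have hga' : h1.localInverse _ _ _ (diagonal x) = diagonal x := hga
    change StrictAnti _
    rw [hga', diagPart_diagonal]
    exact hx
  exact hr.and hs

theorem spec_eventuallyEq {x : Fin n → ℝ} (hx : StrictAnti x) :
    ∃ g : Herm c n → Herm c n, ContDiffAt ℝ ∞ g (diagonal x) ∧ g (diagonal x) = diagonal x ∧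
      HasStrictFDerivAt g (ContinuousLinearMap.id ℝ _) (diagonal x) ∧
      spec =ᶠ[𝓝 (diagonal x)] fun X => diagPart (g X) := by
  obtain ⟨g, h1, h2, h3, h4⟩ := exists_spectralChart_inverse (c := c) hx
  refine ⟨g, h1, h2, h3, ?_⟩
  filter_upwards [h4] with X hX
  conv_lhs => rw [← hX.1, spectralChart]
  exact spec_Ad_diagonal _ hX.2.antitone

/-- Conjugation invariance moves the point to a diagonal matrix, where the spectrum is the diagonal
of the smooth local inverse of `spectralChart`. -/
theorem contDiffAt_spec {X : Herm c n} (hX : X ∈ simple c n) : ContDiffAt ℝ ∞ spec X := by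
  obtain ⟨g, hg, hg0, -, hs⟩ := spec_eventuallyEq (c := c) (show StrictAnti (spec X) from hX)
  have h1 : ContDiffAt ℝ ∞ spec (diagonal (spec X) : Herm c n) :=
    ((LinearMap.toContinuousLinearMap (diagPart (c := c) (n := n))).contDiff.contDiffAt.comp _
      hg).congr_of_eventuallyEq hs
  have h2 : spec = spec ∘ AdIso (frame X)⁻¹ := by ext1 Y; simp
  rw [h2]
  refine ContDiffAt.comp _ ?_ (AdIso (frame X)⁻¹).contDiff.contDiffAt
  have h3 : AdIso (frame X)⁻¹ X = diagonal (spec X) := by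
    have h := Ad_inv_Ad (frame X) (diagonal (spec X))
    rwa [← eq_Ad_frame] at h
  rwa [h3]

/-- The derivative of the spectrum at a matrix with simple spectrum. -/
theorem hasStrictFDerivAt_spec (u : unitary (c.Mat n)) {x : Fin n → ℝ} (hx : StrictAnti x) :
    HasStrictFDerivAt spec (LinearMap.toContinuousLinearMap (diagPart ∘ₗ Ad u⁻¹))
      (Ad u (diagonal x) : Herm c n) := by
  obtain ⟨g, -, hg0, hg, hs⟩ := spec_eventuallyEq (c := c) hx
  have h1 : HasStrictFDerivAt spec (LinearMap.toContinuousLinearMap diagPart)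
      (diagonal x : Herm c n) :=
    ((LinearMap.toContinuousLinearMap (diagPart (c := c) (n := n))).hasStrictFDerivAt.comp _
      hg).congr_of_eventuallyEq hs.symm
  have h2 : spec = spec ∘ AdIso (c := c) (n := n) u⁻¹ := by ext1 Y; simp
  rw [h2]
  have h3 : AdIso (c := c) u⁻¹ (Ad u (diagonal x)) = diagonal x := by simp
  rw [← h3] at h1
  have h4 : HasStrictFDerivAt (AdIso (c := c) (n := n) u⁻¹)
      ((AdIso u⁻¹ : Herm c n ≃L[ℝ] Herm c n) : Herm c n →L[ℝ] Herm c n) (Ad u (diagonal x)) :=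
    ((AdIso u⁻¹ : Herm c n ≃L[ℝ] Herm c n)).hasStrictFDerivAt
  exact h1.comp _ h4

end Herm

end Horn

/-! ### Lebesgue integrals on Euclidean spaces -/

theorem lintegral_linearMap {E : Type*} [NormedAddCommGroup E] [NormedSpace ℝ E]
    [FiniteDimensional ℝ E] [MeasurableSpace E] [BorelSpace E] (μ : Measure E) [μ.IsAddHaarMeasure]
    (L : E →ₗ[ℝ] E) (hL : LinearMap.det L ≠ 0) {g : E → ENNReal} (hg : Measurable g) :
    ∫⁻ y, g y ∂μ = ENNReal.ofReal |LinearMap.det L| * ∫⁻ x, g (L x) ∂μ := by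
  have h1 : Measurable L := L.continuous_of_finiteDimensional.measurable
  rw [← lintegral_map hg h1, Measure.map_linearMap_addHaar_eq_smul_addHaar μ hL,
    lintegral_smul_measure, smul_eq_mul, ← mul_assoc, ← ENNReal.ofReal_mul (abs_nonneg _), abs_inv,
    mul_inv_cancel₀ (abs_ne_zero.2 hL), ENNReal.ofReal_one, one_mul]

section Gaussian

variable (V : Type*) [NormedAddCommGroup V] [InnerProductSpace ℝ V] [FiniteDimensional ℝ V]
  [MeasurableSpace V] [BorelSpace V]

theorem lintegral_exp_neg_mul_norm_sq {b : ℝ} (hb : 0 < b) :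
    ∫⁻ v : V, ENNReal.ofReal (Real.exp (-b * ‖v‖ ^ 2)) =
      ENNReal.ofReal ((Real.pi / b) ^ (Module.finrank ℝ V / 2 : ℝ)) := by
  rw [← ofReal_integral_eq_lintegral_ofReal, GaussianFourier.integral_rexp_neg_mul_sq_norm hb]
  -- Without integrability the Bochner integral would be $0$, while the known value is positive.
  · by_contra h
    have h1 := GaussianFourier.integral_rexp_neg_mul_sq_norm (V := V) hb
    rw [integral_undef h] at h1
    have : 0 < (Real.pi / b) ^ (Module.finrank ℝ V / 2 : ℝ) := by positivity
    exact this.ne h1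
  · exact Eventually.of_forall fun v => (Real.exp_pos _).le

theorem lintegral_rpow_mul_exp {a r : ℝ} (ha : 0 < a) (hr : 0 < r) :
    ∫⁻ t in Ioi (0 : ℝ), ENNReal.ofReal (t ^ (a - 1) * Real.exp (-(r * t))) =
      ENNReal.ofReal ((1 / r) ^ a * Real.Gamma a) := by
  have h1 := Real.integral_rpow_mul_exp_neg_mul_Ioi ha hr
  rw [← ofReal_integral_eq_lintegral_ofReal, h1]
  · by_contra h
    rw [integral_undef h] at h1
    have h2 := Real.Gamma_pos_of_pos ha
    have : 0 < (1 / r) ^ a * Real.Gamma a := by positivity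
    exact this.ne h1
  · filter_upwards [ae_restrict_mem measurableSet_Ioi] with t ht
    have := mem_Ioi.1 ht
    positivity

/-- The integral of `(1 + ‖v‖²)^(-s)`. -/
theorem lintegral_one_add_norm_sq_rpow {s : ℝ} (hs : (Module.finrank ℝ V / 2 : ℝ) < s) :
    ∫⁻ v : V, ENNReal.ofReal ((1 + ‖v‖ ^ 2) ^ (-s)) =
      ENNReal.ofReal (Real.pi ^ (Module.finrank ℝ V / 2 : ℝ) *
        Real.Gamma (s - Module.finrank ℝ V / 2) / Real.Gamma s) := by
  set m : ℝ := (Module.finrank ℝ V / 2 : ℝ) with hm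
  have hm0 : 0 ≤ m := by positivity
  have hs0 : 0 < s := hm0.trans_lt hs
  have hG := Real.Gamma_pos_of_pos hs0
  -- Writing the power as a Gamma integral in $t$ makes the integral over $v$ Gaussian after
  -- exchanging the order.
  have h1 : ∀ v : V, ENNReal.ofReal ((1 + ‖v‖ ^ 2) ^ (-s)) = ENNReal.ofReal (Real.Gamma s)⁻¹ *
      ∫⁻ t in Ioi (0 : ℝ), ENNReal.ofReal (t ^ (s - 1) * Real.exp (-((1 + ‖v‖ ^ 2) * t))) := by
    intro v
    have : 0 < 1 + ‖v‖ ^ 2 := by positivity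
    rw [lintegral_rpow_mul_exp hs0 this, ← ENNReal.ofReal_mul (by positivity)]
    congr 1
    rw [one_div, Real.inv_rpow this.le, Real.rpow_neg this.le]
    field_simp
  simp_rw [h1]
  rw [lintegral_const_mul', lintegral_lintegral_swap]
  · have h2 : ∀ t ∈ Ioi (0 : ℝ), ∫⁻ v : V,
        ENNReal.ofReal (t ^ (s - 1) * Real.exp (-((1 + ‖v‖ ^ 2) * t))) =
        ENNReal.ofReal (Real.pi ^ m) *
          ENNReal.ofReal (t ^ ((s - m) - 1) * Real.exp (-(1 * t))) := by
      intro t ht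
      have ht : 0 < t := ht
      have h3 : ∀ v : V, ENNReal.ofReal (t ^ (s - 1) * Real.exp (-((1 + ‖v‖ ^ 2) * t))) =
          ENNReal.ofReal (t ^ (s - 1) * Real.exp (-t)) *
            ENNReal.ofReal (Real.exp (-t * ‖v‖ ^ 2)) := by
        intro v
        rw [← ENNReal.ofReal_mul (by positivity), mul_assoc, ← Real.exp_add]
        congr 3; ring
      simp_rw [h3]
      rw [lintegral_const_mul' _ _ ENNReal.ofReal_ne_top, lintegral_exp_neg_mul_norm_sq V ht,
        ← ENNReal.ofReal_mul (by positivity), ← ENNReal.ofReal_mul (by positivity), ← hm]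
      congr 1
      rw [Real.div_rpow Real.pi_pos.le ht.le, sub_right_comm s m 1, Real.rpow_sub ht (s - 1) m,
        one_mul]
      ring
    rw [setLIntegral_congr_fun measurableSet_Ioi h2, lintegral_const_mul' _ _ ENNReal.ofReal_ne_top,
      lintegral_rpow_mul_exp (sub_pos.2 hs) one_pos, ← ENNReal.ofReal_mul (by positivity),
      ← ENNReal.ofReal_mul (by positivity)]
    congr 1
    simp; ring
  · refine Measurable.aemeasurable ?_
    fun_prop
  · exact ENNReal.ofReal_ne_top

end Gaussian

/-! ### A secular equation -/

section Secular

variable {n : ℕ} {q r : Fin n → ℝ}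

/-- The function `t - ∑ rᵢ / (t - qᵢ)`. -/
def secular (q r : Fin n → ℝ) (t : ℝ) : ℝ := t - ∑ i, r i / (t - q i)

theorem hasDerivAt_secular {t : ℝ} (ht : ∀ i, q i < t) :
    HasDerivAt (secular q r) (1 + ∑ i, r i / (t - q i) ^ 2) t := by
  have h1 : ∀ i ∈ Finset.univ, HasDerivAt (fun t => r i / (t - q i)) (-(r i / (t - q i) ^ 2)) t := by
    intro i _
    have := (hasDerivAt_const t (r i)).div ((hasDerivAt_id t).sub_const (q i))
      (sub_ne_zero.2 (ht i).ne')
    refine this.congr_deriv ?_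
    simp [neg_div]
  have h2 := (hasDerivAt_id t).sub (HasDerivAt.fun_sum h1)
  refine h2.congr_deriv ?_
  simp

theorem convex_above (q : Fin n → ℝ) : Convex ℝ {t | ∀ i, q i < t} := by
  rw [ofPred_forall]
  exact convex_iInter fun i => convex_Ioi (q i)

theorem isOpen_above (q : Fin n → ℝ) : IsOpen {t | ∀ i, q i < t} := by
  rw [ofPred_forall]
  exact isOpen_iInter_of_finite fun i => isOpen_Ioi

theorem strictMonoOn_secular (hr : ∀ i, 0 ≤ r i) :
    StrictMonoOn (secular q r) {t | ∀ i, q i < t} := by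
  refine strictMonoOn_of_deriv_pos (convex_above q)
    (fun t ht => (hasDerivAt_secular ht).continuousAt.continuousWithinAt) fun t ht => ?_
  rw [(isOpen_above q).interior_eq] at ht
  rw [(hasDerivAt_secular ht).deriv]
  have : 0 ≤ ∑ i, r i / (t - q i) ^ 2 := Finset.sum_nonneg fun i _ => div_nonneg (hr i) (sq_nonneg _)
  linarith

/-- The function tends to $-\infty$ at the largest pole, because all $r_i$ are positive, and to
$+\infty$ at infinity. The proof picks two explicit points for the intermediate value theorem. -/
theorem image_secular (hr : ∀ i, 0 < r i) : secular q r '' {t | ∀ i, q i < t} = univ := by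
  refine eq_univ_of_forall fun y => ?_
  have hc : ContinuousOn (secular q r) {t | ∀ i, q i < t} :=
    fun t ht => (hasDerivAt_secular ht).continuousAt.continuousWithinAt
  have hconn := (convex_above q).isPreconnected
  rcases isEmpty_or_nonempty (Fin n) with hn | hn
  · exact ⟨y, fun i => hn.elim i, by simp [secular]⟩
  obtain ⟨k, hk⟩ := Finite.exists_max q
  -- At $q_k+\varepsilon$ the term $r_k/\varepsilon$ exceeds $q_k+1-y$, which brings the value down
  -- to at most $y$.
  obtain ⟨ε, hε0, hε1, hε⟩ : ∃ ε : ℝ, 0 < ε ∧ ε ≤ 1 ∧ (q k + 1 - y) * ε ≤ r k := by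
    refine ⟨min 1 (r k / (|q k + 1 - y| + 1)), by have := hr k; positivity, min_le_left _ _, ?_⟩
    have h1 : 0 < min 1 (r k / (|q k + 1 - y| + 1)) := by have := hr k; positivity
    calc (q k + 1 - y) * min 1 (r k / (|q k + 1 - y| + 1))
        ≤ (|q k + 1 - y| + 1) * (r k / (|q k + 1 - y| + 1)) := by
          refine mul_le_mul ?_ (min_le_right _ _) h1.le (by positivity)
          linarith [le_abs_self (q k + 1 - y)]
      _ = r k := by field_simp
  have ha : q k + ε ∈ {t | ∀ i, q i < t} := fun i => (hk i).trans_lt (by linarith)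
  -- From $q_k+1$ on every denominator is at least $1$, so the sum is at most $\sum r_i$.
  have hb : max (q k + 1) (y + ∑ i, r i) ∈ {t | ∀ i, q i < t} := fun i =>
    (hk i).trans_lt (lt_of_lt_of_le (by linarith) (le_max_left _ _))
  refine hconn.intermediate_value ha hb hc ⟨?_, ?_⟩
  · have h1 : r k / (q k + ε - q k) ≤ ∑ i, r i / (q k + ε - q i) :=
      Finset.single_le_sum (f := fun i => r i / (q k + ε - q i))
        (fun i _ => div_nonneg (hr i).le (sub_nonneg.2 (ha i).le)) (Finset.mem_univ k)
    rw [add_sub_cancel_left] at h1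
    have h2 : q k + 1 - y ≤ r k / ε := by rwa [le_div_iff₀ hε0]
    rw [secular]; linarith
  · have h1 : ∑ i, r i / (max (q k + 1) (y + ∑ i, r i) - q i) ≤ ∑ i, r i := by
      refine Finset.sum_le_sum fun i _ => div_le_self (hr i).le ?_
      have := le_max_left (q k + 1) (y + ∑ i, r i)
      linarith [hk i]
    have := le_max_right (q k + 1) (y + ∑ i, r i)
    rw [secular]; linarith

end Secular

namespace Horn

open SelfAdjointCase

variable {c : SelfAdjointCase} {n : ℕ}

/-! ### Column vectors and the secular substitution -/

instance (c : SelfAdjointCase) : MeasurableSpace c.K := borel _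

instance (c : SelfAdjointCase) : BorelSpace c.K := ⟨rfl⟩

/-- The Euclidean space of column vectors over the scalars. -/
abbrev Vec (c : SelfAdjointCase) (n : ℕ) : Type := PiLp 2 fun _ : Fin n => c.K

/-- Multiplication of the entries of a vector by real numbers. -/
def scale (x : Fin n → ℝ) : Vec c n →ₗ[ℝ] Vec c n where
  toFun w := WithLp.toLp 2 fun i => x i • w i
  map_add' v w := by ext i; simp
  map_smul' r w := by ext i; simp [smul_comm r]

@[simp] theorem scale_apply (x : Fin n → ℝ) (w : Vec c n) (i : Fin n) :
    scale x w i = x i • w i := rfl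

theorem det_scale (x : Fin n → ℝ) :
    LinearMap.det (scale x : Vec c n →ₗ[ℝ] Vec c n) = ∏ i, x i ^ c.scalarDim := by
  rw [← LinearMap.det_conj _ (WithLp.linearEquiv 2 ℝ (Fin n → c.K))]
  have h : (WithLp.linearEquiv 2 ℝ (Fin n → c.K) : Vec c n →ₗ[ℝ] _) ∘ₗ scale x ∘ₗ
      ((WithLp.linearEquiv 2 ℝ (Fin n → c.K)).symm : _ →ₗ[ℝ] Vec c n) =
      LinearMap.pi fun i : Fin n => (x i • LinearMap.id (M := c.K)) ∘ₗ LinearMap.proj i := by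
    ext1 w; rfl
  rw [h, LinearMap.det_pi]
  simp [LinearMap.det_smul, finrank_K]

theorem finrank_Vec : Module.finrank ℝ (Vec c n) = n * c.scalarDim := by
  rw [(WithLp.linearEquiv 2 ℝ (Fin n → c.K)).finrank_eq, Module.finrank_pi_fintype]
  simp [finrank_K]

theorem norm_sq_Vec (w : Vec c n) : ‖w‖ ^ 2 = ∑ i, ‖w i‖ ^ 2 := PiLp.norm_sq_eq_of_L2 _ w

/-- Each exceptional set is a proper subspace. Off these sets all residues $|b_i|^2$ are positive,
as surjectivity of the secular function requires. -/
theorem ae_ne_zero : ∀ᵐ b : Vec c n, ∀ i, b i ≠ 0 := by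
  rw [ae_all_iff]
  intro i
  let W : Submodule ℝ (Vec c n) := LinearMap.ker (PiLp.projₗ 2 (fun _ : Fin n => c.K) i)
  have hW : W ≠ ⊤ := by
    intro h
    have : PiLp.single 2 i (1 : c.K) ∈ W := h ▸ Submodule.mem_top
    simp [W] at this
  have := Measure.addHaar_submodule volume W hW
  rw [ae_iff]
  convert this using 2
  ext b; simp [W]

/-- For fixed $b$ substitute $a=t-\sum_i|b_i|^2/(t-q_i)$, then for fixed $t$ rescale
$b_i=(t-q_i)w_i$. The first Jacobian, $1+\sum_i|b_i|^2/(t-q_i)^2$, becomes $1+|w|^2$; the second is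
$\prod_i(t-q_i)^{2\theta}$. -/
theorem lintegral_secular (q : Fin n → ℝ) {f : Vec c n × ℝ → ENNReal} (hf : Measurable f) :
    ∫⁻ b, ∫⁻ a, f (b, a) = ∫⁻ t in {t | ∀ i, q i < t}, ∫⁻ w : Vec c n,
      f (scale (fun i => t - q i) w, t - ∑ i, (t - q i) * ‖w i‖ ^ 2) *
        ENNReal.ofReal ((1 + ‖w‖ ^ 2) * ∏ i, (t - q i) ^ c.scalarDim) := by
  have hS := (isOpen_above q).measurableSet
  have h1 : ∀ᵐ b : Vec c n, ∫⁻ a, f (b, a) = ∫⁻ t in {t | ∀ i, q i < t},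
      f (b, secular q (fun i => ‖b i‖ ^ 2) t) *
        ENNReal.ofReal (1 + ∑ i, ‖b i‖ ^ 2 / (t - q i) ^ 2) := by
    filter_upwards [ae_ne_zero] with b hb
    have hr : ∀ i, 0 < ‖b i‖ ^ 2 := fun i => by have := norm_pos_iff.2 (hb i); positivity
    have h2 := lintegral_image_eq_lintegral_abs_deriv_mul hS
      (fun t ht => (hasDerivAt_secular (r := fun i => ‖b i‖ ^ 2) ht).hasDerivWithinAt)
      (strictMonoOn_secular fun i => (hr i).le).injOn (fun a => f (b, a))
    rw [image_secular hr, Measure.restrict_univ] at h2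
    rw [h2]
    refine lintegral_congr fun t => ?_
    rw [mul_comm, abs_of_nonneg]
    exact add_nonneg zero_le_one (Finset.sum_nonneg fun i _ => by positivity)
  rw [lintegral_congr_ae h1, lintegral_lintegral_swap]
  · refine setLIntegral_congr_fun hS fun t ht => ?_
    have hp : 0 < ∏ i, (t - q i) ^ c.scalarDim :=
      Finset.prod_pos fun i _ => pow_pos (sub_pos.2 (ht i)) _
    have hdet := det_scale (c := c) fun i => t - q i
    have h3 := lintegral_linearMap volume (scale (c := c) fun i => t - q i)
      (by rw [hdet]; exact hp.ne') (g := fun b => f (b, secular q (fun i => ‖b i‖ ^ 2) t) *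
        ENNReal.ofReal (1 + ∑ i, ‖b i‖ ^ 2 / (t - q i) ^ 2))
        (by unfold secular; fun_prop)
    simp only [h3, hdet, abs_of_pos hp]
    rw [← lintegral_const_mul' _ _ ENNReal.ofReal_ne_top]
    refine lintegral_congr fun w => ?_
    rw [mul_left_comm, ← ENNReal.ofReal_mul hp.le, mul_comm (∏ i, _)]
    have hne : ∀ i, t - q i ≠ 0 := fun i => sub_ne_zero.2 (ht i).ne'
    have e1 : secular q (fun i => ‖scale (fun i => t - q i) w i‖ ^ 2) t =
        t - ∑ i, (t - q i) * ‖w i‖ ^ 2 := by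
      rw [secular]
      refine congrArg (t - ·) (Finset.sum_congr rfl fun i _ => ?_)
      have := hne i
      rw [scale_apply, norm_smul, mul_pow, Real.norm_eq_abs, sq_abs]; field_simp
    have e2 : ∑ i, ‖scale (fun i => t - q i) w i‖ ^ 2 / (t - q i) ^ 2 = ‖w‖ ^ 2 := by
      rw [norm_sq_Vec]
      refine Finset.sum_congr rfl fun i _ => ?_
      have := hne i
      rw [scale_apply, norm_smul, mul_pow, Real.norm_eq_abs, sq_abs]; field_simp
    rw [e1, e2]
  · refine Measurable.aemeasurable ?_
    unfold secular
    fun_prop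

end Horn

theorem LinearMap.det_one_add_comp_comm {U V : Type*} [AddCommGroup U] [Module ℝ U]
    [FiniteDimensional ℝ U] [AddCommGroup V] [Module ℝ V] [FiniteDimensional ℝ V]
    (A : U →ₗ[ℝ] V) (B : V →ₗ[ℝ] U) :
    LinearMap.det (1 + B ∘ₗ A) = LinearMap.det (1 + A ∘ₗ B) := by
  have b := Module.finBasis ℝ U
  have b' := Module.finBasis ℝ V
  rw [← LinearMap.det_toMatrix b, ← LinearMap.det_toMatrix b', map_add, map_add,
    LinearMap.toMatrix_one, LinearMap.toMatrix_one, LinearMap.toMatrix_comp b b' b,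
    LinearMap.toMatrix_comp b' b b', Matrix.det_one_add_mul_comm]

/-! ### Matrices acting on column vectors, quadratic forms and congruences -/

namespace Horn

open SelfAdjointCase

variable {c : SelfAdjointCase} {n : ℕ}

open Matrix in
/-- Multiplication of a column vector by a matrix. -/
def mulV : c.Mat n →ₗ[ℝ] Vec c n →ₗ[ℝ] Vec c n :=
  LinearMap.mk₂ ℝ (fun A w => WithLp.toLp 2 (A *ᵥ w.ofLp))
    (fun A B w => by ext i; simp [Matrix.add_mulVec])
    (fun r A w => by ext i; simp [Matrix.smul_mulVec])
    (fun A v w => by ext i; simp [Matrix.mulVec_add])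
    (fun r A w => by ext i; simp [Matrix.mulVec_smul])

open Matrix in
theorem ofLp_mulV (A : c.Mat n) (w : Vec c n) : (mulV A w).ofLp = A *ᵥ w.ofLp := rfl

theorem mulV_mul (A B : c.Mat n) : mulV (A * B) = mulV A ∘ₗ mulV B := by
  ext1 w; apply WithLp.ofLp_injective; simp [ofLp_mulV, Matrix.mulVec_mulVec]

theorem mulV_one : mulV (1 : c.Mat n) = LinearMap.id := by
  ext1 w; apply WithLp.ofLp_injective; simp [ofLp_mulV]

theorem inner_Vec (v w : Vec c n) : inner ℝ v w = re (star v.ofLp ⬝ᵥ w.ofLp) := by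
  rw [PiLp.inner_apply, dotProduct, map_sum]
  exact Finset.sum_congr rfl fun i _ => inner_eq_re _ _

theorem inner_mulV (A : c.Mat n) (v w : Vec c n) :
    inner ℝ v (mulV A w) = inner ℝ (mulV (star A) v) w := by
  rw [inner_Vec, inner_Vec, ofLp_mulV, ofLp_mulV, Matrix.star_mulVec,
    ← Matrix.star_eq_conjTranspose, star_star, Matrix.dotProduct_mulVec]

theorem mulV_diagonal (x : Fin n → ℝ) : mulV (Herm.diagonal x : Herm c n).mat = scale x := by
  ext1 w; apply WithLp.ofLp_injective
  ext1 i
  rw [ofLp_mulV, Herm.mat_diagonal, Matrix.mulVec_diagonal]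
  simp

/-- A unitary matrix acting on column vectors. -/
def mulVIso (u : unitary (c.Mat n)) : Vec c n ≃ₗᵢ[ℝ] Vec c n :=
  LinearIsometryEquiv.mk (LinearEquiv.ofLinearMap (mulV (u : c.Mat n)) (mulV (star (u : c.Mat n)))
    (by rw [← mulV_mul, Herm.coe_mul_star, mulV_one])
    (by rw [← mulV_mul, Herm.coe_star_mul, mulV_one])) fun w => by
      change ‖mulV (u : c.Mat n) w‖ = ‖w‖
      rw [norm_eq_sqrt_real_inner, inner_mulV, ← LinearMap.comp_apply, ← mulV_mul,
        Herm.coe_star_mul, mulV_one, LinearMap.id_apply, ← norm_eq_sqrt_real_inner]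

theorem mulVIso_apply (u : unitary (c.Mat n)) (w : Vec c n) :
    mulVIso u w = mulV (u : c.Mat n) w := rfl

theorem mulV_Ad (u : unitary (c.Mat n)) (X : Herm c n) :
    mulV (Herm.Ad u X).mat = mulV (u : c.Mat n) ∘ₗ mulV X.mat ∘ₗ mulV (star (u : c.Mat n)) := by
  rw [Herm.mat_Ad, mulV_mul, mulV_mul, LinearMap.comp_assoc]

theorem det_mulV_Ad (u : unitary (c.Mat n)) (X : Herm c n) :
    LinearMap.det (mulV (Herm.Ad u X).mat) = LinearMap.det (mulV X.mat) := by
  rw [mulV_Ad]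
  exact LinearMap.det_conj (mulV X.mat) (mulVIso u).toLinearEquiv

theorem det_mulV (X : Herm c n) :
    LinearMap.det (mulV X.mat) = ∏ i, Herm.spec X i ^ c.scalarDim := by
  conv_lhs => rw [Herm.eq_Ad_frame X]
  rw [det_mulV_Ad, mulV_diagonal, det_scale]

/-- The quadratic form of a self-adjoint matrix. -/
def quad (X : Herm c n) (w : Vec c n) : ℝ := inner ℝ w (mulV X.mat w)

theorem quad_Ad (u : unitary (c.Mat n)) (X : Herm c n) (w : Vec c n) :
    quad (Herm.Ad u X) w = quad X (mulV (star (u : c.Mat n)) w) := by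
  rw [quad, mulV_Ad, LinearMap.comp_apply, inner_mulV]; rfl

theorem quad_diagonal (x : Fin n → ℝ) (w : Vec c n) :
    quad (Herm.diagonal x) w = ∑ i, x i * ‖w i‖ ^ 2 := by
  rw [quad, mulV_diagonal, PiLp.inner_apply]
  refine Finset.sum_congr rfl fun i _ => ?_
  rw [scale_apply, inner_smul_right, real_inner_self_eq_norm_sq]

/-- Positive definite matrices. -/
def PosDef (X : Herm c n) : Prop := ∀ w : Vec c n, w ≠ 0 → 0 < quad X w

theorem posDef_iff (X : Herm c n) : PosDef X ↔ ∀ i, 0 < Herm.spec X i := by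
  have hX := Herm.eq_Ad_frame X
  set u := Herm.frame X
  set x := Herm.spec X
  constructor
  · intro h i
    have h1 := h (mulVIso u (PiLp.single 2 i 1)) (by simp)
    rw [hX, quad_Ad, mulVIso_apply, ← LinearMap.comp_apply, ← mulV_mul, Herm.coe_star_mul, mulV_one,
      LinearMap.id_apply, quad_diagonal, Finset.sum_eq_single i] at h1
    · simpa using h1
    · intro j _ hj
      simp [hj]
    · simp
  · intro h w hw
    rw [hX, quad_Ad, quad_diagonal]
    set v := mulV (star (u : c.Mat n)) w with hv
    have hv0 : v ≠ 0 := by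
      rw [hv]
      exact (mulVIso u).symm.map_eq_zero_iff.not.2 hw
    have h2 : ∃ i, v i ≠ 0 := by
      by_contra! h0
      exact hv0 (WithLp.ofLp_injective 2 (funext h0))
    obtain ⟨i, hi⟩ := h2
    exact Finset.sum_pos' (fun j _ => mul_nonneg (h j).le (sq_nonneg _))
      ⟨i, Finset.mem_univ _, mul_pos (h i) (by have := norm_pos_iff.2 hi; positivity)⟩

/-- The congruence `X ↦ S X S`. -/
def congr (S : Herm c n) : Herm c n →ₗ[ℝ] Herm c n where
  toFun X := Herm.mk (S.mat * X.mat * S.mat) (by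
    simp only [star_mul, Herm.star_mat, mul_assoc])
  map_add' X Y := by ext1; simp [mul_add, add_mul]
  map_smul' r X := by ext1; simp

theorem mat_congr (S X : Herm c n) : (congr S X).mat = S.mat * X.mat * S.mat := rfl

theorem quad_congr (S X : Herm c n) (w : Vec c n) : quad (congr S X) w = quad X (mulV S.mat w) := by
  rw [quad, mat_congr, mulV_mul, mulV_mul, LinearMap.comp_apply, LinearMap.comp_apply, inner_mulV,
    Herm.star_mat]; rfl

/-- In an eigenframe of $S$ the congruence multiplies the $(i,j)$ entry by $s_is_j$, so it is
conjugate to an entrywise multiplier and `det_schur` applies. -/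
theorem det_congr (S : Herm c n) :
    LinearMap.det (congr S : Herm c n →ₗ[ℝ] Herm c n) = (∏ i, Herm.spec S i ^ 2) *
      ∏ p : {p : Fin n × Fin n // p.1 < p.2},
        (Herm.spec S p.1.1 * Herm.spec S p.1.2) ^ c.scalarDim := by
  have hS := Herm.eq_Ad_frame S
  set u := Herm.frame S
  set x := Herm.spec S
  have h1 : congr S = ((Herm.AdIso u).toLinearEquiv : Herm c n →ₗ[ℝ] Herm c n) ∘ₗ
      Herm.schur (fun i j => x i * x j) (fun i j => mul_comm _ _) ∘ₗ
      ((Herm.AdIso u).toLinearEquiv.symm : Herm c n →ₗ[ℝ] Herm c n) := by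
    have h2 : ∀ Y : Herm c n, congr (Herm.diagonal x) Y =
        Herm.schur (fun i j => x i * x j) (fun i j => mul_comm _ _) Y := by
      intro Y
      ext i j
      rw [mat_congr, Herm.mul_diagonal_apply, Herm.diagonal_mul_apply, Herm.schur_apply, smul_smul,
        mul_comm]
    ext1 X
    rw [LinearMap.comp_apply, LinearMap.comp_apply, ← h2]
    change congr S X = Herm.Ad u (congr (Herm.diagonal x) (Herm.Ad u⁻¹ X))
    ext1
    rw [mat_congr, hS]
    change _ = (u : c.Mat n) * ((Herm.diagonal x : Herm c n).mat *
      (star (u : c.Mat n) * X.mat * star (star (u : c.Mat n))) * (Herm.diagonal x : Herm c n).mat) *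
      star (u : c.Mat n)
    simp only [Herm.mat_Ad, mul_assoc, star_star]
  rw [h1, LinearMap.det_conj, Herm.det_schur]
  simp only [sq]

/-- Each index lies in $n-1$ pairs. -/
theorem prod_pairs_mul {M : Type*} [CommMonoid M] (x : Fin n → M) :
    ∏ p : {p : Fin n × Fin n // p.1 < p.2}, x p.1.1 * x p.1.2 = (∏ i, x i) ^ (n - 1) := by
  rw [prod_pairs fun i j => x i * x j]
  simp only [Finset.prod_mul_distrib]
  have h1 : ∏ i : Fin n, ∏ j ∈ Finset.Ioi i, x j = ∏ j : Fin n, ∏ i ∈ Finset.Iio j, x j :=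
    Finset.prod_comm' (by simp)
  rw [h1]
  simp only [Finset.prod_const, Fin.card_Ioi, Fin.card_Iio]
  rw [← Finset.prod_mul_distrib, ← Finset.prod_pow]
  refine Finset.prod_congr rfl fun i _ => ?_
  rw [← pow_add]
  congr 1
  omega

theorem abs_det_congr (S : Herm c n) :
    |LinearMap.det (congr S : Herm c n →ₗ[ℝ] Herm c n)| =
      (∏ i, |Herm.spec S i|) ^ (2 + (n - 1) * c.scalarDim) := by
  rw [det_congr, abs_mul, Finset.abs_prod, Finset.abs_prod]
  simp only [abs_pow, abs_mul]
  rw [Finset.prod_pow, Finset.prod_pow, prod_pairs_mul fun i => |Herm.spec S i|, ← pow_mul, pow_add]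

theorem abs_det_mulV (S : Herm c n) :
    |LinearMap.det (mulV S.mat)| = (∏ i, |Herm.spec S i|) ^ c.scalarDim := by
  rw [det_mulV, Finset.abs_prod]
  simp only [abs_pow]
  rw [Finset.prod_pow]

end Horn

namespace Horn

open SelfAdjointCase

variable {c : SelfAdjointCase} {n : ℕ}

/-! ### Bordered matrices -/

/-- A block matrix with a first row and a first column. -/
def blk (a : c.K) (r b : Fin n → c.K) (Q : c.Mat n) : c.Mat (n + 1) :=
  Matrix.of (Fin.cons (Fin.cons a r) fun i => Fin.cons (b i) (Q i))

section blk

variable (a a' : c.K) (r r' b b' : Fin n → c.K) (Q Q' : c.Mat n)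

@[simp] theorem blk_zero_zero : blk a r b Q 0 0 = a := rfl
@[simp] theorem blk_zero_succ (j : Fin n) : blk a r b Q 0 j.succ = r j := rfl
@[simp] theorem blk_succ_zero (i : Fin n) : blk a r b Q i.succ 0 = b i := rfl
@[simp] theorem blk_succ_succ (i j : Fin n) : blk a r b Q i.succ j.succ = Q i j := rfl

theorem ext_blk {A B : c.Mat (n + 1)} (h1 : A 0 0 = B 0 0) (h2 : ∀ j : Fin n, A 0 j.succ = B 0 j.succ)
    (h3 : ∀ i : Fin n, A i.succ 0 = B i.succ 0)
    (h4 : ∀ i j : Fin n, A i.succ j.succ = B i.succ j.succ) : A = B := by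
  ext i j
  refine Fin.cases (Fin.cases h1 h2 j) (fun i => Fin.cases (h3 i) (h4 i) j) i

open Matrix in
theorem blk_mul : blk a r b Q * blk a' r' b' Q' =
    blk (a * a' + r ⬝ᵥ b') (fun j => a * r' j + (r ᵥ* Q') j) (fun i => b i * a' + (Q *ᵥ b') i)
      (vecMulVec b r' + Q * Q') := by
  apply ext_blk <;> intros <;>
    simp [Matrix.mul_apply, Fin.sum_univ_succ, dotProduct, vecMul, mulVec, vecMulVec_apply]

theorem star_blk : star (blk a r b Q) = blk (star a) (star b) (star r) (star Q) := by
  apply ext_blk <;> intros <;> simp [Matrix.star_apply]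

theorem blk_one : blk (1 : c.K) 0 0 (1 : c.Mat n) = 1 := by
  apply ext_blk <;> intros <;> simp [Matrix.one_apply, (Fin.succ_ne_zero _).symm]

end blk

variable (c n) in
/-- Self-adjoint matrices as bordered matrices. -/
def border : (Herm c n × Vec c n × ℝ) ≃ₗ[ℝ] Herm c (n + 1) where
  toFun p := Herm.mk (blk (p.2.2 • 1) (star p.2.1.ofLp) p.2.1.ofLp p.1.mat) (by
    rw [star_blk, star_star, Herm.star_mat]; simp)
  map_add' p q := by
    ext1; apply ext_blk <;> intros <;> simp [add_smul]
  map_smul' t p := by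
    ext1; apply ext_blk <;> intros <;> simp [smul_smul]
  invFun X := (Herm.mk (X.mat.submatrix Fin.succ Fin.succ) (by
    ext i j; simp [Matrix.star_apply, Herm.star_apply]),
    WithLp.toLp 2 fun i => X.mat i.succ 0, Herm.diagPart X 0)
  left_inv p := by
    refine Prod.ext ?_ (Prod.ext ?_ ?_)
    · ext i j; simp
    · ext i; simp
    · simp [Herm.diagPart_apply]
  right_inv X := by
    ext1
    exact ext_blk (Herm.apply_self X 0).symm (fun j => by simp [Herm.star_apply]) (fun i => rfl)
      fun i j => rfl

theorem mat_border (Q : Herm c n) (b : Vec c n) (a : ℝ) :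
    (border c n (Q, b, a)).mat = blk (a • 1) (star b.ofLp) b.ofLp Q.mat := rfl

theorem norm_sq_border (Q : Herm c n) (b : Vec c n) (a : ℝ) :
    ‖border c n (Q, b, a)‖ ^ 2 = ‖Q‖ ^ 2 + 2 * ‖b‖ ^ 2 + a ^ 2 := by
  rw [Herm.norm_sq_eq, Herm.norm_sq_eq, norm_sq_Vec, mat_border]
  simp [Fin.sum_univ_succ, norm_star_K, norm_smul, Finset.sum_add_distrib]
  ring

/-- The normalization of Lebesgue measure in bordered coordinates. -/
theorem lintegral_border {F : Herm c (n + 1) → ENNReal} (hF : Measurable F) :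
    ∫⁻ X, F X = ENNReal.ofReal (2 ^ (n * c.scalarDim / 2 : ℝ)) *
      ∫⁻ Q, ∫⁻ b, ∫⁻ a, F (border c n (Q, b, a)) := by
  let e := (border c n).toContinuousLinearEquiv
  have : (volume : Measure (Herm c n × Vec c n × ℝ)).IsAddHaarMeasure := by
    rw [Measure.volume_eq_prod, Measure.volume_eq_prod]
    have : (volume : Measure (Vec c n)).IsAddHaarMeasure := inferInstance
    have : (volume : Measure (Herm c n)).IsAddHaarMeasure := inferInstance
    have : SFinite (volume : Measure (Vec c n)) := inferInstance
    have : MeasurableAdd (Vec c n) := inferInstance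
    have : MeasurableAdd (Herm c n) := inferInstance
    have : ((volume : Measure (Vec c n)).prod (volume : Measure ℝ)).IsAddHaarMeasure := inferInstance
    infer_instance
  let μ : Measure (Herm c (n + 1)) := Measure.map e volume
  have hμ : μ.IsAddHaarMeasure := e.isAddHaarMeasure_map volume
  -- Uniqueness of Haar measure reduces the statement to one constant, to be read off from a
  -- Gaussian.
  obtain ⟨C, hC⟩ : ∃ C : NNReal, (volume : Measure (Herm c (n + 1))) = C • μ :=
    ⟨_, Measure.isAddLeftInvariant_eq_smul _ _⟩
  have key : ∀ F : Herm c (n + 1) → ENNReal, Measurable F → ∫⁻ X, F X =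
      C * ∫⁻ Q, ∫⁻ b, ∫⁻ a, F (border c n (Q, b, a)) := by
    intro F hF
    have hm : Measurable fun p => F (e p) := hF.comp e.continuous.measurable
    conv_lhs => rw [hC]
    rw [lintegral_smul_measure, lintegral_map hF e.continuous.measurable, Measure.volume_eq_prod,
      lintegral_prod _ hm.aemeasurable, Measure.volume_eq_prod]
    have h1 : ∀ Q : Herm c n, ∫⁻ y, F (e (Q, y)) ∂((volume : Measure (Vec c n)).prod volume) =
        ∫⁻ b, ∫⁻ a, F (border c n (Q, b, a)) := fun Q =>
      lintegral_prod _ (hm.comp measurable_prodMk_left).aemeasurable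
    simp_rw [h1]
    rfl
  have hN := (border c n).finrank_eq
  rw [Module.finrank_prod, Module.finrank_prod, finrank_Vec, Module.finrank_self] at hN
  -- The border vector occurs twice in the norm, so its Gaussian has parameter $2$; this is the
  -- source of the power of $2$.
  have h1 := key (fun X => ENNReal.ofReal (Real.exp (-1 * ‖X‖ ^ 2))) (by fun_prop)
  rw [lintegral_exp_neg_mul_norm_sq _ one_pos] at h1
  have h2 : ∀ (Q : Herm c n) (b : Vec c n) (a : ℝ),
      ENNReal.ofReal (Real.exp (-1 * ‖border c n (Q, b, a)‖ ^ 2)) =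
      ENNReal.ofReal (Real.exp (-1 * ‖Q‖ ^ 2)) * (ENNReal.ofReal (Real.exp (-2 * ‖b‖ ^ 2)) *
        ENNReal.ofReal (Real.exp (-1 * ‖a‖ ^ 2))) := by
    intro Q b a
    rw [norm_sq_border, ← ENNReal.ofReal_mul (by positivity), ← ENNReal.ofReal_mul (by positivity),
      ← Real.exp_add, ← Real.exp_add, Real.norm_eq_abs, sq_abs]
    congr 2; ring
  have h3 : ∀ (Q : Herm c n) (b : Vec c n),
      ∫⁻ a, ENNReal.ofReal (Real.exp (-1 * ‖border c n (Q, b, a)‖ ^ 2)) =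
      ENNReal.ofReal (Real.exp (-1 * ‖Q‖ ^ 2)) * (ENNReal.ofReal (Real.exp (-2 * ‖b‖ ^ 2)) *
        ENNReal.ofReal ((Real.pi / 1) ^ (Module.finrank ℝ ℝ / 2 : ℝ))) := by
    intro Q b
    rw [lintegral_congr (h2 Q b), lintegral_const_mul' _ _ ENNReal.ofReal_ne_top,
      lintegral_const_mul' _ _ ENNReal.ofReal_ne_top, lintegral_exp_neg_mul_norm_sq ℝ one_pos]
  have h4 : ∀ Q : Herm c n,
      ∫⁻ b, ∫⁻ a, ENNReal.ofReal (Real.exp (-1 * ‖border c n (Q, b, a)‖ ^ 2)) =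
      ENNReal.ofReal (Real.exp (-1 * ‖Q‖ ^ 2)) *
      (ENNReal.ofReal ((Real.pi / 2) ^ (Module.finrank ℝ (Vec c n) / 2 : ℝ)) *
        ENNReal.ofReal ((Real.pi / 1) ^ (Module.finrank ℝ ℝ / 2 : ℝ))) := by
    intro Q
    rw [lintegral_congr (h3 Q), lintegral_const_mul' _ _ ENNReal.ofReal_ne_top,
      lintegral_mul_const' _ _ ENNReal.ofReal_ne_top, lintegral_exp_neg_mul_norm_sq _ two_pos]
  rw [lintegral_congr h4] at h1
  rw [lintegral_mul_const' _ _ (by finiteness), lintegral_exp_neg_mul_norm_sq _ one_pos,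
    ← ENNReal.ofReal_coe_nnreal, ← ENNReal.ofReal_mul (by positivity),
    ← ENNReal.ofReal_mul (by positivity), ← ENNReal.ofReal_mul (by positivity),
    ENNReal.ofReal_eq_ofReal_iff (by positivity) (by positivity), ← hN, finrank_Vec,
    Module.finrank_self, div_one] at h1
  have h4 : (C : ℝ) = 2 ^ (n * c.scalarDim / 2 : ℝ) := by
    push_cast at h1
    rw [Real.div_rpow Real.pi_pos.le two_pos.le, add_div, add_div, Real.rpow_add Real.pi_pos,
      Real.rpow_add Real.pi_pos] at h1
    have : (0 : ℝ) < Real.pi ^ ((Module.finrank ℝ (Herm c n) : ℝ) / 2) := by positivity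
    have : (0 : ℝ) < Real.pi ^ (n * c.scalarDim / 2 : ℝ) := by positivity
    have : (0 : ℝ) < Real.pi ^ (1 / 2 : ℝ) := by positivity
    have : (0 : ℝ) < 2 ^ (n * c.scalarDim / 2 : ℝ) := by positivity
    field_simp at h1
    exact h1.symm
  rw [key F hF, ← h4, ENNReal.ofReal_coe_nnreal]

/-! ### The rank one perturbation of the identity -/

/-- `√(1 + ‖w‖²)`. -/
def rt (w : Vec c n) : ℝ := √(1 + ‖w‖ ^ 2)

theorem rt_pos (w : Vec c n) : 0 < rt w := Real.sqrt_pos.2 (by positivity)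

theorem rt_sq (w : Vec c n) : rt w ^ 2 = 1 + ‖w‖ ^ 2 := Real.sq_sqrt (by positivity)

open Matrix in
/-- The matrix `w w*`. -/
def outer (w : Vec c n) : Herm c n := Herm.mk (vecMulVec w.ofLp (star w.ofLp)) (by
  rw [star_eq_conjTranspose, conjTranspose_vecMulVec, star_star])

theorem star_dotProduct_self (w : Vec c n) : star w.ofLp ⬝ᵥ w.ofLp = ‖w‖ ^ 2 • (1 : c.K) := by
  rw [norm_sq_Vec, Finset.sum_smul, dotProduct]
  exact Finset.sum_congr rfl fun i _ => star_mul_self_eq c _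

open Matrix in
theorem outer_mulVec (w : Vec c n) : (outer w).mat *ᵥ w.ofLp = ‖w‖ ^ 2 • w.ofLp := by
  ext i
  simp [outer, vecMulVec_mulVec, star_dotProduct_self]

theorem outer_mul_outer (w : Vec c n) : (outer w).mat * (outer w).mat = ‖w‖ ^ 2 • (outer w).mat := by
  ext i j
  simp only [outer, Herm.mat_mk, Matrix.vecMulVec_mul_vecMulVec, star_dotProduct_self,
    Matrix.smul_apply, Matrix.vecMulVec_apply]
  simp

/-- The identity as a self-adjoint matrix. -/
def hone : Herm c n := Herm.mk 1 (star_one _)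

/-- The matrix `(1 + w w*)^(-1/2)`. -/
def isqrt (w : Vec c n) : Herm c n := hone - (1 / (rt w * (1 + rt w))) • outer w

theorem mat_isqrt (w : Vec c n) :
    (isqrt w).mat = 1 - (1 / (rt w * (1 + rt w))) • (outer w).mat := by
  simp [isqrt, hone]

/-- The right side is $(1+ww^*)^{-1}$, since $ww^*$ satisfies $(ww^*)^2=|w|^2ww^*$. The same
relation determines the coefficient in `isqrt`. -/
theorem isqrt_mul_isqrt (w : Vec c n) :
    (isqrt w).mat * (isqrt w).mat = 1 - (1 / rt w ^ 2) • (outer w).mat := by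
  have h1 := rt_pos w
  have h2 := rt_sq w
  have h3 : ‖w‖ ^ 2 = rt w ^ 2 - 1 := by linarith
  rw [mat_isqrt, mul_sub, sub_mul, sub_mul, one_mul, mul_one, one_mul, smul_mul_smul_comm,
    outer_mul_outer, h3, smul_smul, sub_sub, sub_right_inj, ← sub_smul, ← add_smul]
  congr 1
  field_simp
  ring

open Matrix in
theorem isqrt_mulVec (w : Vec c n) : (isqrt w).mat *ᵥ w.ofLp = (1 / rt w) • w.ofLp := by
  have h1 := rt_pos w
  have h3 : ‖w‖ ^ 2 = rt w ^ 2 - 1 := by linarith [rt_sq w]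
  rw [mat_isqrt, sub_mulVec, one_mulVec, smul_mulVec, outer_mulVec, h3, smul_smul]
  nth_rewrite 1 [← one_smul ℝ w.ofLp]
  rw [← sub_smul]
  congr 1
  field_simp
  ring

open Matrix in
theorem vecMul_isqrt (w : Vec c n) : star w.ofLp ᵥ* (isqrt w).mat = (1 / rt w) • star w.ofLp := by
  have := congrArg star (isqrt_mulVec w)
  rwa [star_mulVec, ← star_eq_conjTranspose, Herm.star_mat, star_smul,
    star_trivial (1 / rt w)] at this

/-- Exchanging the two factors of the rank one part reduces $\det(1+ww^*)$ to a determinant on the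
scalars. Absolute values make it unnecessary to know that `isqrt w` is positive. -/
theorem prod_spec_isqrt (w : Vec c n) :
    (∏ i, |Herm.spec (isqrt w) i|) ^ 2 = (1 + ‖w‖ ^ 2)⁻¹ := by
  have h1 := rt_pos w
  have h2 : (isqrt w).mat * (isqrt w).mat * (1 + (outer w).mat) = 1 := by
    have h3 : ‖w‖ ^ 2 = rt w ^ 2 - 1 := by linarith [rt_sq w]
    rw [isqrt_mul_isqrt, mul_add, mul_one, sub_mul, one_mul, smul_mul_assoc, outer_mul_outer, h3,
      smul_smul, sub_add, sub_eq_self]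
    nth_rewrite 2 [← one_smul ℝ (outer w).mat]
    rw [← sub_smul, ← sub_smul]
    convert zero_smul ℝ _
    field_simp
    ring
  have h3 : LinearMap.det (mulV (1 + (outer w).mat)) = (1 + ‖w‖ ^ 2) ^ c.scalarDim := by
    let A : Vec c n →ₗ[ℝ] c.K :=
      { toFun := fun v => star w.ofLp ⬝ᵥ v.ofLp
        map_add' := fun u v => by simp
        map_smul' := fun r v => by simp }
    let B : c.K →ₗ[ℝ] Vec c n :=
      { toFun := fun k => WithLp.toLp 2 fun i => w i * k
        map_add' := fun u v => by ext i; simp [mul_add]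
        map_smul' := fun r v => by ext i; simp }
    have h4 : mulV (1 + (outer w).mat) = 1 + B ∘ₗ A := by
      rw [map_add, mulV_one]
      ext1 v
      apply WithLp.ofLp_injective
      ext i
      simp [ofLp_mulV, outer, Matrix.vecMulVec_mulVec, A, B]
    have h5 : 1 + A ∘ₗ B = (1 + ‖w‖ ^ 2) • LinearMap.id := by
      ext1 k
      have : (star w.ofLp ⬝ᵥ fun i => w i * k) = ‖w‖ ^ 2 • k := by
        rw [← one_mul k, ← smul_mul_assoc, ← star_dotProduct_self, dotProduct, dotProduct,
          Finset.sum_mul]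
        simp [mul_assoc]
      simp [A, B, this, add_smul]
    rw [h4, LinearMap.det_one_add_comp_comm, h5, LinearMap.det_smul, finrank_K, LinearMap.det_id,
      mul_one]
  have h4 := congrArg (fun A => |LinearMap.det (mulV A)|) h2
  simp only [mulV_mul, mulV_one, LinearMap.det_comp, LinearMap.det_id, abs_mul, abs_one,
    abs_det_mulV, h3] at h4
  have h6 : (0 : ℝ) < 1 + ‖w‖ ^ 2 := by positivity
  rw [abs_of_pos (pow_pos h6 _), ← mul_pow, ← mul_pow] at h4
  have hd : c.scalarDim ≠ 0 := by cases c <;> simp [scalarDim]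
  have h7 := (pow_eq_one_iff_of_nonneg (by positivity) hd).1 h4
  rw [sq]
  exact eq_inv_of_mul_eq_one_left h7

end Horn

namespace Horn

open SelfAdjointCase

variable {c : SelfAdjointCase} {n : ℕ}

/-! ### The unitary matrix with first column proportional to `(1, w)` -/

/-- The matrix of `rotU`. -/
def rotM (w : Vec c n) : c.Mat (n + 1) :=
  blk ((1 / rt w) • 1) (-((1 / rt w) • star w.ofLp)) ((1 / rt w) • w.ofLp) (isqrt w).mat

theorem rt_neg (w : Vec c n) : rt (-w) = rt w := by simp [rt]

theorem outer_neg (w : Vec c n) : outer (-w) = outer w := by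
  ext1; simp [outer]

theorem isqrt_neg (w : Vec c n) : isqrt (-w) = isqrt w := by
  simp [isqrt, rt_neg, outer_neg]

theorem star_rotM (w : Vec c n) : star (rotM w) = rotM (-w) := by
  rw [rotM, star_blk, rotM, rt_neg, isqrt_neg, Herm.star_mat]
  simp [star_smul]

open Matrix in
theorem rotM_mul_neg (w : Vec c n) : rotM w * rotM (-w) = 1 := by
  have h1 := rt_pos w
  have h3 : ‖w‖ ^ 2 = rt w ^ 2 - 1 := by linarith [rt_sq w]
  rw [rotM, rotM, rt_neg, isqrt_neg, blk_mul, ← blk_one]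
  congr 1
  · simp only [WithLp.ofLp_neg, smul_neg, dotProduct_neg, neg_dotProduct, neg_neg, smul_dotProduct,
      dotProduct_smul, star_dotProduct_self, h3, smul_smul, smul_mul_smul_comm, one_mul, ← add_smul]
    convert one_smul ℝ (1 : c.K)
    field_simp
    ring
  · ext j
    simp only [neg_vecMul, smul_vecMul, vecMul_isqrt]
    simp
  · ext i
    simp only [WithLp.ofLp_neg, smul_neg, mulVec_neg, mulVec_smul, isqrt_mulVec]
    simp
  · rw [isqrt_mul_isqrt]
    ext i j
    simp [outer, vecMulVec_apply, smul_smul]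
    rw [← sq, inv_pow]
    abel

/-- The unitary matrix with first column proportional to `(1, w)`. -/
def rotU (w : Vec c n) : unitary (c.Mat (n + 1)) :=
  ⟨rotM w, by
    rw [Unitary.mem_iff, star_rotM]
    exact ⟨by simpa using rotM_mul_neg (-w), rotM_mul_neg w⟩⟩

-- The algebraic heart of the induction on $n$. Put $T=S(t-Y)S$ with $S=(1+ww^*)^{-1/2}$. The
-- bordered matrix with blocks $t-T$, $Tw$, $t-\langle w,Tw\rangle$ sends $(1,w)$ to $t(1,w)$. The
-- first column of `rotU w` is this eigenvector normalized, and on its orthogonal complement the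
-- factors $S$ cancel to leave $Y$.
open Matrix in
theorem border_eq_Ad (t : ℝ) (w : Vec c n) (Y : Herm c n) :
    border c n (t • hone - congr (isqrt w) (t • hone - Y),
      mulV (congr (isqrt w) (t • hone - Y)).mat w,
      t - quad (congr (isqrt w) (t • hone - Y)) w) =
    Herm.Ad (rotU w) (border c n (Y, 0, t)) := by
  have h1 := rt_pos w
  have h3 : ‖w‖ ^ 2 = rt w ^ 2 - 1 := by linarith [rt_sq w]
  have hT : (congr (isqrt w) (t • hone - Y)).mat =
      t • (1 - (1 / rt w ^ 2) • (outer w).mat) - (isqrt w).mat * Y.mat * (isqrt w).mat := by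
    rw [← isqrt_mul_isqrt, mat_congr, map_sub, map_smul, mul_sub, sub_mul]
    simp [hone]
  have hR : (rotU w : c.Mat (n + 1)) * (border c n (Y, 0, t)).mat =
      blk ((t * (1 / rt w)) • 1) (-((1 / rt w) • (star w.ofLp ᵥ* Y.mat)))
        ((t * (1 / rt w)) • w.ofLp) ((isqrt w).mat * Y.mat) := by
    rw [mat_border]
    change rotM w * _ = _
    rw [rotM, blk_mul]
    congr 1
    · simp [smul_smul]
    · ext j; simp [neg_vecMul, smul_vecMul]
    · ext i; simp [smul_smul]
    · ext i j; simp
  have hS : star (rotU w : c.Mat (n + 1)) = blk ((1 / rt w) • 1) ((1 / rt w) • star w.ofLp)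
      (-((1 / rt w) • w.ofLp)) (isqrt w).mat := by
    change star (rotM w) = _
    rw [star_rotM, rotM, rt_neg, isqrt_neg]
    simp
  apply (border c n).symm.injective
  rw [LinearEquiv.symm_apply_apply]
  have hM : (Herm.Ad (rotU w) (border c n (Y, 0, t))).mat = _ := Herm.mat_Ad _ _
  rw [hR, hS, blk_mul] at hM
  have hq : quad (congr (isqrt w) (t • hone - Y)) w =
      (1 / rt w) ^ 2 * (t * ‖w‖ ^ 2 - inner ℝ w (mulV Y.mat w)) := by
    have e1 : mulV (isqrt w).mat w = (1 / rt w) • w := WithLp.ofLp_injective 2 (isqrt_mulVec w)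
    have e2 : mulV (t • hone - Y : Herm c n).mat w = t • w - mulV Y.mat w := by
      rw [map_sub, map_smul, map_sub, map_smul]
      simp [hone, mulV_one]
    rw [quad_congr, e1, quad, map_smul, inner_smul_left, inner_smul_right, e2, inner_sub_right,
      inner_smul_right, real_inner_self_eq_norm_sq]
    simp
    ring
  set T := congr (isqrt w) (t • hone - Y)
  have hT' : (t • hone - T).mat = t • 1 - T.mat := by rw [map_sub, map_smul]; rfl
  refine Prod.ext ?_ (Prod.ext ?_ ?_)
  · ext i j
    change _ = (Herm.Ad (rotU w) (border c n (Y, 0, t))).mat i.succ j.succ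
    rw [hM, blk_succ_succ, hT', hT]
    simp [outer, vecMulVec_apply, smul_smul, smul_sub, sq, mul_assoc]
    rw [show (rt w)⁻¹ * (t * (rt w)⁻¹) = t * ((rt w)⁻¹ * (rt w)⁻¹) by ring]
    abel
  · ext i
    change _ = (Herm.Ad (rotU w) (border c n (Y, 0, t))).mat i.succ 0
    rw [hM, blk_succ_zero]
    change (T.mat *ᵥ w.ofLp) i = _
    rw [hT, sub_mulVec, smul_mulVec, sub_mulVec, one_mulVec, smul_mulVec, outer_mulVec,
      ← mulVec_mulVec, isqrt_mulVec, mulVec_neg, mulVec_smul, h3]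
    simp only [Pi.sub_apply, Pi.smul_apply, Pi.neg_apply, smul_smul, smul_mul_smul_comm, mul_one,
      ← sub_eq_add_neg, smul_sub]
    rw [← sub_smul]
    congr 2
    field_simp
    ring
  · change _ = re ((Herm.Ad (rotU w) (border c n (Y, 0, t))).mat 0 0)
    rw [hM, blk_zero_zero]
    change t - quad T w = _
    rw [hq, h3, inner_Vec, ofLp_mulV, dotProduct_mulVec]
    simp only [neg_dotProduct, dotProduct_neg, neg_neg, smul_dotProduct, dotProduct_smul, smul_neg,
      smul_mul_smul_comm, mul_one, map_add, map_smul, re_one, smul_eq_mul]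
    field_simp
    ring

/-- A diagonalization of $Y$ extends by $1$ in the corner, and placing $t$ in front keeps the
eigenvalues sorted. -/
theorem spec_border_diag (Y : Herm c n) (t : ℝ) (h : ∀ i, Herm.spec Y i ≤ t) :
    Herm.spec (border c n (Y, 0, t)) = Fin.cons t (Herm.spec Y) := by
  have hY := Herm.eq_Ad_frame Y
  set u := Herm.frame Y
  set y := Herm.spec Y with hy
  have hanti : Antitone (Fin.cons t y : Fin (n + 1) → ℝ) := by
    intro i j
    refine Fin.cases (fun _ => ?_) (fun i => ?_) i
    · refine Fin.cases le_rfl (fun j => ?_) j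
      simpa using h j
    · refine Fin.cases (fun h => absurd h (by simp)) (fun j hij => ?_) j
      simpa using Herm.antitone_spec Y (Fin.succ_le_succ_iff.1 hij)
  let v : unitary (c.Mat (n + 1)) := ⟨blk 1 0 0 (u : c.Mat n), by
    rw [Unitary.mem_iff, star_blk, blk_mul, blk_mul, ← blk_one]
    exact ⟨by apply ext_blk <;> intros <;> simp,
      by apply ext_blk <;> intros <;> simp⟩⟩
  have hv : border c n (Y, 0, t) = Herm.Ad v (Herm.diagonal (Fin.cons t y)) := by
    have hd : (Herm.diagonal (Fin.cons t y) : Herm c (n + 1)).mat =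
        blk (t • 1) 0 0 (Herm.diagonal y : Herm c n).mat := by
      rw [Herm.mat_diagonal, Herm.mat_diagonal]
      apply ext_blk <;> intros <;> simp [Matrix.diagonal_apply, (Fin.succ_ne_zero _).symm]
    ext1
    rw [Herm.mat_Ad, hd, mat_border]
    change _ = blk 1 0 0 (u : c.Mat n) * _ * star (blk 1 0 0 (u : c.Mat n))
    rw [star_blk, blk_mul, blk_mul]
    conv_lhs => rw [hY, Herm.mat_Ad]
    apply ext_blk <;> intros <;> simp [Matrix.vecMul, dotProduct]
  rw [hv, Herm.spec_Ad_diagonal _ hanti]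

end Horn

namespace Horn

open SelfAdjointCase

variable {c : SelfAdjointCase} {n : ℕ}

/-! ### Integration of spectral functions -/

theorem scalarDim_pos (c : SelfAdjointCase) : 0 < c.scalarDim := by cases c <;> simp [scalarDim]

theorem posDef_Ad (u : unitary (c.Mat n)) (X : Herm c n) : PosDef (Herm.Ad u X) ↔ PosDef X := by
  rw [posDef_iff, posDef_iff, Herm.spec_Ad]

theorem posDef_diagonal (x : Fin n → ℝ) :
    PosDef (Herm.diagonal x : Herm c n) ↔ ∀ i, 0 < x i := by
  constructor
  · intro h i
    have h1 := h (PiLp.single 2 i 1) (by simp)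
    rw [quad_diagonal, Finset.sum_eq_single i] at h1
    · simpa using h1
    · intro j _ hj; simp [hj]
    · simp
  · intro h w hw
    rw [quad_diagonal]
    obtain ⟨i, hi⟩ : ∃ i, w i ≠ 0 := by
      by_contra! hc; exact hw (by ext i; exact hc i)
    exact Finset.sum_pos' (fun j _ => mul_nonneg (h j).le (by positivity))
      ⟨i, Finset.mem_univ i, mul_pos (h i) (by have := norm_pos_iff.2 hi; positivity)⟩

open Classical in
/-- The determinant of a positive definite matrix as an operator on column vectors, and zero for
all other matrices. -/
def pdet (X : Herm c n) : ENNReal :=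
  if PosDef X then ENNReal.ofReal (LinearMap.det (mulV X.mat)) else 0

theorem measurable_pdet : Measurable (pdet : Herm c n → ENNReal) := by
  refine Measurable.ite ?_ ?_ measurable_const
  · have : {X : Herm c n | PosDef X} = ⋂ i, {X | 0 < Herm.spec X i} := by
      ext X; simp [posDef_iff]
    rw [this]
    exact MeasurableSet.iInter fun i => (isOpen_lt continuous_const
      ((continuous_apply i).comp Herm.continuous_spec)).measurableSet
  · simp only [det_mulV]
    refine ENNReal.measurable_ofReal.comp (Continuous.measurable ?_)
    exact continuous_finsetProd _ fun i _ =>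
      ((continuous_apply i).comp Herm.continuous_spec).pow _

theorem pdet_Ad_diagonal (u : unitary (c.Mat n)) (x : Fin n → ℝ) [Decidable (∀ i, 0 < x i)] :
    pdet (Herm.Ad u (Herm.diagonal x)) =
      if ∀ i, 0 < x i then ENNReal.ofReal (∏ i, x i ^ c.scalarDim) else 0 := by
  rw [pdet, posDef_Ad, posDef_diagonal, det_mulV_Ad, mulV_diagonal, det_scale]
  congr

theorem Ad_hone (u : unitary (c.Mat n)) : Herm.Ad u (hone : Herm c n) = hone := by
  ext1; simp [Herm.mat_Ad, hone]

theorem diagonal_const (t : ℝ) : (Herm.diagonal (fun _ => t) : Herm c n) = t • hone := by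
  ext1
  rw [Herm.mat_diagonal, map_smul]
  ext i j
  rcases eq_or_ne i j with rfl | h
  · simp [hone]
  · simp [hone, h]

theorem smul_hone_sub_Ad_diagonal (t : ℝ) (u : unitary (c.Mat n)) (x : Fin n → ℝ) :
    t • hone - Herm.Ad u (Herm.diagonal x) = Herm.Ad u (Herm.diagonal fun i => t - x i) := by
  have : (fun i => t - x i) = (fun _ => t) - x := rfl
  rw [this, map_sub, map_sub, diagonal_const, map_smul, Ad_hone]

/-- The cutoff in `pdet` encodes that $t$ lies above the spectrum, so $t$ may be integrated over the
whole line. -/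
theorem pdet_sub (t : ℝ) (X : Herm c n) [Decidable (∀ i, Herm.spec X i < t)] :
    pdet (t • hone - X) = if ∀ i, Herm.spec X i < t then
      ENNReal.ofReal (∏ i, (t - Herm.spec X i) ^ c.scalarDim) else 0 := by
  classical
  conv_lhs => rw [Herm.eq_Ad_frame X, smul_hone_sub_Ad_diagonal, pdet_Ad_diagonal]
  simp only [sub_pos]

/-- Rotating both $b$ and $w$ by an eigenframe of $Q$ reduces this to the diagonal case
`lintegral_secular`. -/
theorem lintegral_secular_Herm (Q : Herm c n) {f : Vec c n × ℝ → ENNReal} (hf : Measurable f) :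
    ∫⁻ b, ∫⁻ a, f (b, a) = ∫⁻ t : ℝ, ∫⁻ w : Vec c n,
      f (mulV (t • hone - Q).mat w, t - quad (t • hone - Q) w) * pdet (t • hone - Q) *
        ENNReal.ofReal (1 + ‖w‖ ^ 2) := by
  classical
  have hQ := Herm.eq_Ad_frame Q
  set u := Herm.frame Q
  set q := Herm.spec Q
  have hu : Measurable (mulVIso u) := (mulVIso u).continuous.measurable
  have hmp := (mulVIso u).measurePreserving
  have hemb := (mulVIso u).toHomeomorph.measurableEmbedding
  rw [← hmp.lintegral_comp_emb hemb,
    lintegral_secular q (f := fun p => f (mulVIso u p.1, p.2)) (by fun_prop),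
    ← lintegral_indicator (isOpen_above q).measurableSet]
  refine lintegral_congr fun t => ?_
  rw [hQ, smul_hone_sub_Ad_diagonal, pdet_Ad_diagonal]
  simp only [sub_pos, indicator_apply, mem_ofPred_eq]
  split_ifs with h
  · conv_rhs => rw [← hmp.lintegral_comp_emb hemb]
    refine lintegral_congr fun w => ?_
    have h1 : mulV (star (u : c.Mat n)) (mulVIso u w) = w := by
      rw [mulVIso_apply, ← LinearMap.comp_apply, ← mulV_mul, Herm.coe_star_mul, mulV_one]; rfl
    rw [mulV_Ad, quad_Ad, LinearMap.comp_apply, LinearMap.comp_apply, h1, mulV_diagonal,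
      quad_diagonal, mul_assoc, ← ENNReal.ofReal_mul, LinearIsometryEquiv.norm_map, mul_comm (1 + _)]
    · rfl
    · exact Finset.prod_nonneg fun i _ => pow_nonneg (sub_pos.2 (h i)).le _
  · simp

theorem bijective_mulV_isqrt (w : Vec c n) : Function.Bijective (mulV (isqrt w).mat) := by
  have h1 : LinearMap.det (mulV (isqrt w).mat) ≠ 0 := by
    have h2 := prod_spec_isqrt w
    rw [← abs_ne_zero, abs_det_mulV]
    refine pow_ne_zero _ fun h => ?_
    rw [h] at h2
    have : 0 < (1 + ‖w‖ ^ 2)⁻¹ := by positivity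
    simp at h2
    rw [← h2] at this
    simp at this
  exact (LinearMap.equivOfDetNeZero _ h1).bijective

/-- Congruence by an invertible matrix preserves positivity and multiplies the determinant by a
square. -/
theorem pdet_congr (w : Vec c n) (T : Herm c n) :
    pdet (congr (isqrt w) T) =
      ENNReal.ofReal ((∏ i, |Herm.spec (isqrt w) i|) ^ (2 * c.scalarDim)) * pdet T := by
  have hb := bijective_mulV_isqrt w
  have h1 : PosDef (congr (isqrt w) T) ↔ PosDef T := by
    simp only [PosDef, quad_congr]
    constructor
    · intro h v hv
      obtain ⟨v', rfl⟩ := hb.2 v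
      exact h v' fun h0 => hv (by rw [h0, map_zero])
    · intro h v hv
      exact h _ fun h0 => hv (hb.1 (by rw [h0, map_zero]))
  rw [pdet, pdet, h1, mat_congr, mulV_mul, mulV_mul, LinearMap.det_comp, LinearMap.det_comp]
  split_ifs
  · rw [← ENNReal.ofReal_mul (by positivity), pow_mul', ← abs_det_mulV, sq_abs]
    congr 1; ring
  · simp

theorem lintegral_congr_isqrt (w : Vec c n) {g : Herm c n → ENNReal} (hg : Measurable g) :
    (∫⁻ T, g T) = ENNReal.ofReal ((∏ i, |Herm.spec (isqrt w) i|) ^ (2 + (n - 1) * c.scalarDim)) *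
      ∫⁻ T, g (congr (isqrt w) T) := by
  rw [← abs_det_congr]
  refine lintegral_linearMap volume _ ?_ hg
  rw [← abs_ne_zero, abs_det_congr]
  refine pow_ne_zero _ fun h => ?_
  have h2 := prod_spec_isqrt w
  rw [h] at h2
  have : 0 < (1 + ‖w‖ ^ 2)⁻¹ := by positivity
  rw [← h2] at this
  simp at this

/-- Collects every power of $1+|w|^2$: the Jacobian of the congruence, its effect on `pdet`, and the
factor from the secular substitution. -/
theorem prod_spec_isqrt_pow (w : Vec c n) :
    (∏ i, |Herm.spec (isqrt w) i|) ^ (2 + (n - 1) * c.scalarDim) *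
      (∏ i, |Herm.spec (isqrt w) i|) ^ (2 * c.scalarDim) * (1 + ‖w‖ ^ 2) =
    (1 + ‖w‖ ^ 2) ^ (-(c.scalarDim * (n + 1) / 2 : ℝ)) := by
  have h1 : (0 : ℝ) < 1 + ‖w‖ ^ 2 := by positivity
  -- For $n=0$ the truncated $n-1$ would break the count of exponents, but then $w=0$ and both sides
  -- are $1$.
  rcases n.eq_zero_or_pos with rfl | hn
  · have : w = 0 := Subsingleton.elim _ _
    simp [this]
  have h2 := prod_spec_isqrt w
  set p := ∏ i, |Herm.spec (isqrt w) i|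
  have hp : 0 ≤ p := Finset.prod_nonneg fun _ _ => abs_nonneg _
  have h3 : p = (1 + ‖w‖ ^ 2) ^ (-(1 / 2) : ℝ) := by
    rw [Real.rpow_neg h1.le, ← Real.inv_rpow h1.le, ← h2, ← Real.sqrt_eq_rpow, Real.sqrt_sq hp]
  rw [← pow_add, h3, ← Real.rpow_natCast, ← Real.rpow_mul h1.le]
  nth_rewrite 2 [← Real.rpow_one (1 + ‖w‖ ^ 2)]
  rw [← Real.rpow_add h1]
  congr 1
  obtain ⟨m, rfl⟩ : ∃ m, n = m + 1 := ⟨n - 1, by omega⟩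
  push_cast
  simp
  ring

theorem continuous_hone_sub {X : Type*} [TopologicalSpace X] {t : X → ℝ} {Q : X → Herm c n}
    (ht : Continuous t) (hQ : Continuous Q) : Continuous fun x => t x • hone - Q x :=
  (ht.smul continuous_const).sub hQ

theorem continuous_mulV {X : Type*} [TopologicalSpace X] {T : X → Herm c n} {w : X → Vec c n}
    (hT : Continuous T) (hw : Continuous w) : Continuous fun x => mulV (T x).mat (w x) := by
  refine (PiLp.continuous_toLp 2 _).comp ?_
  exact (Herm.continuous_mat.comp hT).matrix_mulVec ((PiLp.continuous_ofLp 2 _).comp hw)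

/-- The ratio of the constants in the integration formulas in sizes `n + 1` and `n`. -/
def weylRatio (c : SelfAdjointCase) (n : ℕ) : ℝ :=
  2 ^ (n * c.scalarDim / 2 : ℝ) * (Real.pi ^ (n * c.scalarDim / 2 : ℝ) *
    Real.Gamma (c.scalarDim / 2) / Real.Gamma (c.scalarDim * (n + 1) / 2))

/-- After the secular substitution and the change from $Q$ to $Y$, the bordered matrix is conjugate
to $t\oplus Y$. An invariant integrand then no longer sees $w$, whose integral splits off as a
constant. -/
theorem lintegral_class_function {F : Herm c (n + 1) → ENNReal} (hF : Measurable F)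
    (hinv : ∀ u X, F (Herm.Ad u X) = F X) :
    ∫⁻ X, F X = ENNReal.ofReal (weylRatio c n) *
      ∫⁻ t : ℝ, ∫⁻ Y : Herm c n, F (border c n (Y, 0, t)) * pdet (t • hone - Y) := by
  have hd : (0 : ℝ) < c.scalarDim := by exact_mod_cast scalarDim_pos c
  have hbc : Continuous (border c n) := (border c n).toLinearMap.continuous_of_finiteDimensional
  rw [lintegral_border hF, weylRatio, ENNReal.ofReal_mul (by positivity), mul_assoc]
  congr 1
  let g : Herm c n × ℝ × Vec c n → ENNReal := fun p =>
    F (border c n (p.1, mulV (p.2.1 • hone - p.1).mat p.2.2,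
      p.2.1 - quad (p.2.1 • hone - p.1) p.2.2)) * pdet (p.2.1 • hone - p.1) *
        ENNReal.ofReal (1 + ‖p.2.2‖ ^ 2)
  have hT : Continuous fun p : Herm c n × ℝ × Vec c n => p.2.1 • hone - p.1 :=
    continuous_hone_sub continuous_snd.fst continuous_fst
  have hmv := continuous_mulV hT continuous_snd.snd
  have hg : Measurable g := by
    refine ((hF.comp (Continuous.measurable ?_)).mul
      (measurable_pdet.comp hT.measurable)).mul (by fun_prop)
    refine hbc.comp (continuous_fst.prodMk (hmv.prodMk (continuous_snd.fst.sub ?_)))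
    exact continuous_snd.snd.inner hmv
  have e1 : ∀ Q : Herm c n, ∫⁻ b, ∫⁻ a, F (border c n (Q, b, a)) = ∫⁻ t, ∫⁻ w, g (Q, t, w) :=
    fun Q => lintegral_secular_Herm Q (f := fun p => F (border c n (Q, p)))
      (hF.comp (hbc.measurable.comp (measurable_const.prodMk measurable_id)))
  have e2 : ∀ (t : ℝ) (w : Vec c n), ∫⁻ Q, g (Q, t, w) =
      (∫⁻ Y : Herm c n, F (border c n (Y, 0, t)) * pdet (t • hone - Y)) *
        ENNReal.ofReal ((1 + ‖w‖ ^ 2) ^ (-(c.scalarDim * (n + 1) / 2 : ℝ))) := by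
    intro t w
    have hgt : Measurable fun T => g (t • hone - T, t, w) :=
      hg.comp (Continuous.measurable
        ((continuous_hone_sub continuous_const continuous_id).prodMk continuous_const))
    -- The change of variables from $Q$ to $Y$ in three moves: the reflection $Q=t-T$, the
    -- congruence by `isqrt w`, and a second reflection.
    rw [← lintegral_sub_left_eq_self (fun Q => g (Q, t, w)) (t • hone),
      lintegral_congr_isqrt w hgt,
      ← lintegral_sub_left_eq_self (fun Q => g (t • hone - congr (isqrt w) Q, t, w)) (t • hone),
      ← prod_spec_isqrt_pow]
    rw [ENNReal.ofReal_mul (by positivity), ENNReal.ofReal_mul (by positivity),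
      mul_assoc (ENNReal.ofReal _), mul_left_comm]
    congr 1
    rw [mul_comm, ← lintegral_const_mul' _ _
      (ENNReal.mul_ne_top ENNReal.ofReal_ne_top ENNReal.ofReal_ne_top)]
    refine lintegral_congr fun Y => ?_
    simp only [g, sub_sub_cancel]
    rw [border_eq_Ad, hinv, pdet_congr]
    ring
  have e3 : ∫⁻ w : Vec c n, ENNReal.ofReal ((1 + ‖w‖ ^ 2) ^ (-(c.scalarDim * (n + 1) / 2 : ℝ))) =
      ENNReal.ofReal (Real.pi ^ (n * c.scalarDim / 2 : ℝ) *
        Real.Gamma (c.scalarDim / 2) / Real.Gamma (c.scalarDim * (n + 1) / 2)) := by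
    rw [lintegral_one_add_norm_sq_rpow, finrank_Vec]
    · push_cast
      congr 4
      ring
    · rw [finrank_Vec]; push_cast; nlinarith
  simp only [e1]
  rw [lintegral_lintegral_swap]
  · rw [mul_comm, ← lintegral_mul_const']
    · refine lintegral_congr fun t => ?_
      rw [lintegral_lintegral_swap, ← e3]
      · simp only [e2]
        rw [lintegral_const_mul'']
        refine Measurable.aemeasurable ?_
        fun_prop
      · exact (hg.comp (by fun_prop : Measurable fun p : Herm c n × Vec c n =>
          (p.1, t, p.2))).aemeasurable
    · exact ENNReal.ofReal_ne_top
  · exact (Measurable.lintegral_prod_right' (f := fun p : (Herm c n × ℝ) × Vec c n =>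
      g (p.1.1, p.1.2, p.2)) (hg.comp (by fun_prop))).aemeasurable

end Horn

namespace Horn

open SelfAdjointCase

variable {c : SelfAdjointCase} {n : ℕ}

/-! ### The Weyl integration formula -/

/-- Writing $\Gamma(1+(n+1)\theta)=(n+1)\theta\,\Gamma((n+1)\theta)$ and
$\Gamma(1+\theta)=\theta\,\Gamma(\theta)$ cancels the new factor $n+1$ of the factorial. -/
theorem kappa_succ (c : SelfAdjointCase) (n : ℕ) : c.kappa (n + 1) = weylRatio c n * c.kappa n := by
  have hθ : (c.scalarDim : ℝ) = 2 * c.θ := two_theta.symm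
  have hθ0 : 0 < c.θ := by
    have : (0 : ℝ) < c.scalarDim := by exact_mod_cast scalarDim_pos c
    linarith
  have h1 : Real.Gamma (1 + c.θ) = c.θ * Real.Gamma c.θ := by
    rw [add_comm, Real.Gamma_add_one hθ0.ne']
  have h2 : Real.Gamma (1 + (n + 1 : ℕ) * c.θ) =
      ((n + 1) * c.θ) * Real.Gamma ((n + 1) * c.θ) := by
    rw [add_comm, Real.Gamma_add_one (by positivity)]; push_cast; ring
  have g0 := Real.Gamma_pos_of_pos hθ0
  have g1 : 0 < Real.Gamma ((n + 1) * c.θ) := Real.Gamma_pos_of_pos (by positivity)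
  have hP : 0 < ∏ j ∈ Finset.Icc 1 n, Real.Gamma (1 + j * c.θ) / Real.Gamma (1 + c.θ) :=
    Finset.prod_pos fun j _ => div_pos (Real.Gamma_pos_of_pos (by positivity))
      (Real.Gamma_pos_of_pos (by positivity))
  rw [kappa, kappa, weylRatio, hθ, Finset.prod_Icc_succ_top (by omega), h1, h2,
    Nat.factorial_succ, show (2 * c.θ * (n + 1) / 2 : ℝ) = (n + 1) * c.θ by ring,
    show (2 * c.θ / 2 : ℝ) = c.θ by ring,
    show (c.θ * (n + 1 : ℕ) * ((n + 1 : ℕ) - 1) / 2 : ℝ) =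
      n * (2 * c.θ) / 2 + c.θ * n * (n - 1) / 2 by push_cast; ring,
    Real.rpow_add (by positivity), Real.mul_rpow (x := 2) (z := n * (2 * c.θ) / 2) (by norm_num)
      Real.pi_pos.le]
  rw [h1] at hP
  push_cast
  field_simp

theorem kappa_zero (c : SelfAdjointCase) : c.kappa 0 = 1 := by simp [kappa]

theorem weylRatio_pos (c : SelfAdjointCase) (n : ℕ) : 0 < weylRatio c n := by
  have : (0 : ℝ) < c.scalarDim := by exact_mod_cast scalarDim_pos c
  have h1 : 0 < Real.Gamma (c.scalarDim / 2) := Real.Gamma_pos_of_pos (by positivity)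
  have h2 : 0 < Real.Gamma (c.scalarDim * (n + 1) / 2) := Real.Gamma_pos_of_pos (by positivity)
  rw [weylRatio]
  positivity

theorem kappa_pos (c : SelfAdjointCase) (n : ℕ) : 0 < c.kappa n := by
  induction n with
  | zero => simp [kappa_zero]
  | succ n ih => rw [kappa_succ]; exact mul_pos (weylRatio_pos c n) ih

/-- The Vandermonde product of a vector. -/
def vdm (x : Fin n → ℝ) : ℝ := ∏ i : Fin n, ∏ j ∈ Finset.Ioi i, (x i - x j)

theorem vdm_cons (t : ℝ) (y : Fin n → ℝ) :
    vdm (Fin.cons t y : Fin (n + 1) → ℝ) = (∏ i, (t - y i)) * vdm y := by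
  simp [vdm, Fin.prod_univ_succ, Fin.prod_Ioi_succ]

theorem vdm_nonneg {x : Fin n → ℝ} (hx : Antitone x) : 0 ≤ vdm x :=
  Finset.prod_nonneg fun _ _ => Finset.prod_nonneg fun _ hj =>
    sub_nonneg.2 (hx (Finset.mem_Ioi.1 hj).le)

theorem vdm_pos {x : Fin n → ℝ} (hx : StrictAnti x) : 0 < vdm x :=
  Finset.prod_pos fun _ _ => Finset.prod_pos fun _ hj =>
    sub_pos.2 (hx (Finset.mem_Ioi.1 hj))

theorem continuous_vdm : Continuous (vdm : (Fin n → ℝ) → ℝ) := by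
  unfold vdm; fun_prop

theorem antitone_cons {t : ℝ} {y : Fin n → ℝ} :
    Antitone (Fin.cons t y : Fin (n + 1) → ℝ) ↔ (∀ i, y i ≤ t) ∧ Antitone y := by
  constructor
  · intro h
    refine ⟨fun i => by simpa using h (Fin.zero_le i.succ), fun i j hij => ?_⟩
    simpa using h (Fin.succ_le_succ_iff.2 hij)
  · rintro ⟨h1, h2⟩ i j
    refine Fin.cases (fun _ => ?_) (fun i => ?_) i
    · refine Fin.cases le_rfl (fun j => ?_) j
      simpa using h1 j
    · refine Fin.cases (fun h => absurd h (by simp)) (fun j hij => ?_) j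
      simpa using h2 (Fin.succ_le_succ_iff.1 hij)

theorem lintegral_fin_cons {f : (Fin (n + 1) → ℝ) → ENNReal} (hf : Measurable f) :
    ∫⁻ x, f x = ∫⁻ t : ℝ, ∫⁻ y : Fin n → ℝ, f (Fin.cons t y) := by
  have h := (volume_preserving_piFinSuccAbove (fun _ : Fin (n + 1) => ℝ) 0).symm
  rw [← h.lintegral_comp_emb (MeasurableEquiv.measurableEmbedding _), Measure.volume_eq_prod,
    lintegral_prod]
  · simp [MeasurableEquiv.piFinSuccAbove_symm_apply, Fin.insertNthEquiv]
  · exact (hf.comp (MeasurableEquiv.measurable _)).aemeasurable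

/-- Weyl's integration formula, by induction on $n$: `lintegral_class_function` peels off the
largest eigenvalue $t$, and the determinant of $t-Y$ is the factor by which the Vandermonde power
grows. -/
theorem lintegral_spec {h : (Fin n → ℝ) → ENNReal} (hh : Measurable h) :
    ∫⁻ X : Herm c n, h (Herm.spec X) = ENNReal.ofReal (c.kappa n) *
      ∫⁻ x in {x | Antitone x}, h x * ENNReal.ofReal (vdm x ^ c.scalarDim) := by
  induction n with
  | zero =>
    have h1 : (volume : Measure (Herm c 0)) univ = 1 := by
      have := lintegral_exp_neg_mul_norm_sq (V := Herm c 0) one_pos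
      have h0 : ∀ v : Herm c 0, v = 0 := fun v => by ext i; exact i.elim0
      have h2 : Module.finrank ℝ (Herm c 0) = 0 := by rw [Herm.finrank_eq]; simp
      simpa [h2, h0] using this
    have h2 : (volume : Measure (Fin 0 → ℝ)) univ = 1 := by simp [volume_pi]
    have h3 : ∀ x : Fin 0 → ℝ, x = 0 := fun x => Subsingleton.elim _ _
    have h4 : {x : Fin 0 → ℝ | Antitone x} = univ := eq_univ_of_forall fun x => by
      intro i; exact i.elim0
    have h5 : ∀ x : Fin 0 → ℝ, h x = h 0 := fun x => by rw [h3 x]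
    simp [kappa_zero, h4, h5, vdm, h1, h2]
  | succ n ih =>
    classical
    rw [lintegral_class_function (F := fun X : Herm c (n + 1) => h (Herm.spec X))
      (hh.comp Herm.continuous_spec.measurable) fun u X => by rw [Herm.spec_Ad], kappa_succ,
      ENNReal.ofReal_mul (weylRatio_pos c n).le, mul_assoc]
    congr 1
    rw [← lintegral_indicator Herm.isClosed_antitone.measurableSet, lintegral_fin_cons,
      ← lintegral_const_mul' _ _ ENNReal.ofReal_ne_top]
    · refine lintegral_congr fun t => ?_
      let k : (Fin n → ℝ) → ENNReal := fun y => {y | ∀ i, y i < t}.indicator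
        (fun y => h (Fin.cons t y) * ENNReal.ofReal (∏ i, (t - y i) ^ c.scalarDim)) y
      have hk : Measurable k := by
        refine Measurable.indicator ?_ ?_
        · refine (hh.comp ?_).mul (by fun_prop)
          refine Continuous.measurable ?_
          fun_prop
        · rw [ofPred_forall]
          exact MeasurableSet.iInter fun i => measurableSet_lt (measurable_pi_apply i) measurable_const
      have e1 : ∀ Y : Herm c n, h (Herm.spec (border c n (Y, 0, t))) * pdet (t • hone - Y) =
          k (Herm.spec Y) := by
        intro Y
        rw [pdet_sub]
        simp only [k, indicator_apply, mem_ofPred_eq]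
        split_ifs with hY
        · rw [spec_border_diag _ _ fun i => (hY i).le]
        · simp
      simp only [e1]
      rw [ih hk, ← lintegral_indicator Herm.isClosed_antitone.measurableSet]
      congr 1
      refine lintegral_congr fun y => ?_
      simp only [k, indicator_apply, mem_ofPred_eq, antitone_cons, vdm_cons]
      by_cases hy : Antitone y
      · simp only [hy, if_true, and_true]
        by_cases hlt : ∀ i, y i < t
        · rw [if_pos hlt, if_pos fun i => (hlt i).le, mul_assoc, ← ENNReal.ofReal_mul, mul_pow,
            Finset.prod_pow]
          exact Finset.prod_nonneg fun i _ => pow_nonneg (sub_pos.2 (hlt i)).le _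
        -- The two integration domains differ where $t$ equals an eigenvalue of $Y$; there the
        -- Vandermonde product vanishes.
        · rw [if_neg hlt, zero_mul]
          split_ifs with hle
          · push Not at hlt
            obtain ⟨i, hi⟩ := hlt
            rw [Finset.prod_eq_zero (Finset.mem_univ i) (sub_eq_zero.2 (le_antisymm hi (hle i)))]
            simp [(scalarDim_pos c).ne']
          · rfl
      · simp [hy]
    · refine Measurable.indicator ?_ Herm.isClosed_antitone.measurableSet
      exact hh.mul (ENNReal.measurable_ofReal.comp (continuous_vdm.measurable.pow_const _))

end Horn

/-! ### Change of variables with Gram determinants -/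

section Gram

variable {V : Type*} [NormedAddCommGroup V] [InnerProductSpace ℝ V]
  {ι : Type*} [Fintype ι] [DecidableEq ι]

/-- The Gram determinant of a family of vectors. -/
def gramDet (v : ι → V) : ℝ := (Matrix.of fun i j => inner ℝ (v i) (v j)).det

theorem gramDet_eq (e : OrthonormalBasis ι ℝ V) (v : ι → V) :
    gramDet v = (e.toBasis.toMatrix v).det ^ 2 := by
  have h : (Matrix.of fun i j => inner ℝ (v i) (v j) : Matrix ι ι ℝ) =
      (e.toBasis.toMatrix v).transpose * e.toBasis.toMatrix v := by
    ext i j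
    rw [Matrix.mul_apply, Matrix.of_apply, ← OrthonormalBasis.sum_inner_mul_inner e]
    refine Finset.sum_congr rfl fun k _ => ?_
    simp [Module.Basis.toMatrix_apply, OrthonormalBasis.repr_apply_apply, real_inner_comm]
  rw [gramDet, h, Matrix.det_mul, Matrix.det_transpose, sq]

theorem gramDet_sumElim_of_orthonormal {κ : Type*} [Fintype κ] [DecidableEq κ] (v : ι → V)
    {w : κ → V} (hw : Orthonormal ℝ w) (hvw : ∀ i k, inner ℝ (v i) (w k) = 0) :
    gramDet (Sum.elim v w) = gramDet v := by
  have h : (Matrix.of fun i j => inner ℝ (Sum.elim v w i) (Sum.elim v w j) :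
      Matrix (ι ⊕ κ) (ι ⊕ κ) ℝ) =
      Matrix.fromBlocks (Matrix.of fun i j => inner ℝ (v i) (v j)) 0 0 1 := by
    ext i j
    rcases i with i | i <;> rcases j with j | j
    · simp
    · simp [hvw]
    · simp [real_inner_comm, hvw]
    · simp [Matrix.one_apply, orthonormal_iff_ite.1 hw]
  rw [gramDet, h, Matrix.det_fromBlocks_zero₂₁, Matrix.det_one, mul_one, gramDet]

variable [FiniteDimensional ℝ V]

theorem nonempty_orthonormalBasis_of_card {κ : Type*} [Fintype κ]
    (hκ : Module.finrank ℝ V = Fintype.card κ) : Nonempty (OrthonormalBasis κ ℝ V) :=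
  ⟨(stdOrthonormalBasis ℝ V).reindex (Fintype.equivOfCardEq (by simp [hκ]))⟩

theorem gramDet_comp (hι : Module.finrank ℝ V = Fintype.card ι) (L : V →ₗ[ℝ] V) (v : ι → V) :
    gramDet (fun i => L (v i)) = LinearMap.det L ^ 2 * gramDet v := by
  obtain ⟨e⟩ := nonempty_orthonormalBasis_of_card hι
  rw [gramDet_eq e, gramDet_eq e, ← mul_pow]
  congr 1
  rw [← LinearMap.det_toMatrix e.toBasis, ← Matrix.det_mul]
  congr 1
  ext i j
  have h1 : (e.toBasis.toMatrix fun i => L (v i)) i j = e.toBasis.repr (L (v j)) i := rfl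
  rw [h1, Matrix.mul_apply]
  have h2 := congrFun (LinearMap.toMatrix_mulVec_repr e.toBasis e.toBasis L (v j)) i
  rw [← h2, Matrix.mulVec, dotProduct]
  rfl

variable [MeasurableSpace V] [BorelSpace V]
  {P : Type*} [NormedAddCommGroup P] [NormedSpace ℝ P] [FiniteDimensional ℝ P]
  [MeasurableSpace P] [BorelSpace P]

/-- Change of variables for an injective map between spaces of the same dimension. -/
theorem lintegral_image_gramDet (b : Module.Basis ι ℝ P)
    (hι : Module.finrank ℝ V = Fintype.card ι) {s : Set P} (hs : MeasurableSet s) {f : P → V}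
    {f' : P → P →L[ℝ] V} (hf' : ∀ x ∈ s, HasFDerivWithinAt f (f' x) s x) (hf : InjOn f s)
    (g : V → ENNReal) :
    ∫⁻ y in f '' s, g y =
      ∫⁻ x in s, ENNReal.ofReal √(gramDet fun i => f' x (b i)) * g (f x) ∂b.addHaar := by
  obtain ⟨e⟩ := nonempty_orthonormalBasis_of_card hι
  -- Carrying `b` to an orthonormal basis turns `b.addHaar` into the Euclidean volume, and the
  -- Jacobian into the determinant of the vectors `f' x (b i)` in that orthonormal basis.
  let A : P ≃L[ℝ] V := (b.equiv e.toBasis (Equiv.refl ι)).toContinuousLinearEquiv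
  have hA : ∀ i, A.symm (e i) = b i := fun i => by
    rw [ContinuousLinearEquiv.symm_apply_eq]
    exact ((b.equiv_apply i e.toBasis (Equiv.refl ι)).trans (by simp)).symm
  have hb : b.addHaar = Measure.map A.symm volume := by
    rw [← e.addHaar_eq_volume, Module.Basis.map_addHaar]
    congr 1
    refine Module.Basis.eq_of_apply_eq fun i => ?_
    simpa using (hA i).symm
  have hm : MeasurableEmbedding A.symm := A.symm.toHomeomorph.measurableEmbedding
  have h1 : f '' s = (f ∘ A.symm) '' (A.symm ⁻¹' s) := by
    rw [image_comp, image_preimage_eq _ A.symm.surjective]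
  have h2 : ∀ x ∈ A.symm ⁻¹' s, HasFDerivWithinAt (f ∘ A.symm)
      ((f' (A.symm x)).comp (A.symm : V →L[ℝ] P)) (A.symm ⁻¹' s) x := fun x hx =>
    (hf' _ hx).comp x A.symm.hasFDerivAt.hasFDerivWithinAt (mapsTo_preimage _ _)
  have h3 : InjOn (f ∘ A.symm) (A.symm ⁻¹' s) :=
    hf.comp A.symm.injective.injOn (mapsTo_preimage _ _)
  rw [h1, lintegral_image_eq_lintegral_abs_det_fderiv_mul volume (hm.measurable hs) h2 h3 g, hb,
    hm.restrict_map, hm.lintegral_map]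
  refine lintegral_congr fun x => ?_
  congr 2
  rw [gramDet_eq e, Real.sqrt_sq_eq_abs]
  congr 1
  change LinearMap.det _ = _
  rw [← LinearMap.det_toMatrix e.toBasis]
  congr 1
  ext i j
  rw [LinearMap.toMatrix_apply, Module.Basis.toMatrix_apply]
  simp [hA]

end Gram

/-! ### Differentiating a change of eigenvalues -/

namespace Horn

open SelfAdjointCase

variable {c : SelfAdjointCase} {n : ℕ}

namespace Herm

/-- The divided differences of `y` at the nodes `x`, with zeros on the diagonal. -/
def divDiff (x y : Fin n → ℝ) (i j : Fin n) : ℝ := (y j - y i) / (x j - x i)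

theorem divDiff_symm (x y : Fin n → ℝ) (i j : Fin n) : divDiff x y i j = divDiff x y j i := by
  rw [divDiff, divDiff, ← neg_sub (y i), ← neg_sub (x i), neg_div_neg_eq]

/-- In the coordinates of `spectralChart x` the map keeps the frame $\exp(\mathrm{skewOf}\,Z)$ and
replaces the diagonal by $y$. Its derivative is a commutator with $\operatorname{diag}(y)$, whose
factor $y_j-y_i$ meets the denominator $x_j-x_i$. -/
theorem hasStrictFDerivAt_reSpec_diagonal {x : Fin n → ℝ} (hx : StrictAnti x) (y : Fin n → ℝ) :
    HasStrictFDerivAt (fun p : Herm c n × (Fin n → ℝ) => reSpec p.2 p.1)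
      (LinearMap.toContinuousLinearMap ((schur (divDiff x y) (divDiff_symm x y)).coprod diagonal))
      (diagonal x, y) := by
  obtain ⟨g, -, hg0, hg, hs⟩ := exists_spectralChart_inverse (c := c) hx
  have h1 : HasStrictFDerivAt (fun p : Herm c n × (Fin n → ℝ) =>
      Ad (expU (skewOf x p.1)) (diagonal p.2))
      (LinearMap.toContinuousLinearMap ((schur (divDiff x y) (divDiff_symm x y)).coprod diagonal))
      (diagonal x, y) := by
    have hk : ∀ p : Herm c n × (Fin n → ℝ), star ((skewOf x ∘ₗ LinearMap.fst ℝ _ _) p) =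
        -(skewOf x ∘ₗ LinearMap.fst ℝ _ _) p := fun p => star_skewOf x p.1
    have h0 : (skewOf x ∘ₗ LinearMap.fst ℝ (Herm c n) (Fin n → ℝ)) (diagonal x, y) = 0 :=
      skewOf_diagonal x x
    have hD := (LinearMap.toContinuousLinearMap
        (diagonal (c := c) ∘ₗ LinearMap.snd ℝ (Herm c n) (Fin n → ℝ))).hasStrictFDerivAt
        (x := ((diagonal x : Herm c n), y))
    refine hasStrictFDerivAt_Ad_expU _ hk h0 hD fun p => ?_
    ext i j
    change (schur (divDiff x y) (divDiff_symm x y) p.1 + diagonal p.2 : Herm c n).mat i j =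
      (skewOf x p.1 * (diagonal y : Herm c n).mat) i j -
        ((diagonal y : Herm c n).mat * skewOf x p.1) i j + (diagonal p.2 : Herm c n).mat i j
    rw [mul_diagonal_apply, diagonal_mul_apply, skewOf_apply, map_add, Matrix.add_apply,
      schur_apply, smul_smul, smul_smul, ← sub_smul, ← sub_mul, divDiff, div_eq_mul_inv]
  have h2 : HasStrictFDerivAt (fun p : Herm c n × (Fin n → ℝ) => (g p.1, p.2))
      (ContinuousLinearMap.id ℝ _) (diagonal x, y) :=
    ((HasStrictFDerivAt.comp (g := g) (f := Prod.fst) (diagonal x, y) hg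
      hasStrictFDerivAt_fst).prodMk hasStrictFDerivAt_snd).congr_fderiv rfl
  have h3 : (g (diagonal x), y) = ((diagonal x : Herm c n), y) := by rw [hg0]
  rw [← h3] at h1
  refine (HasStrictFDerivAt.comp (f := fun p : Herm c n × (Fin n → ℝ) => (g p.1, p.2))
    (diagonal x, y) h1 h2).congr_of_eventuallyEq ?_
  have hs' : ∀ᶠ p : Herm c n × (Fin n → ℝ) in 𝓝 (diagonal x, y), spectralChart x (g p.1) = p.1 ∧
      StrictAnti (diagPart (g p.1)) :=
    (continuousAt_fst (p := ((diagonal x : Herm c n), y))).eventually hs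
  filter_upwards [hs'] with p hp
  conv_rhs => rw [← hp.1, spectralChart, reSpec_Ad_diagonal _ _ hp.2]

/-- Transport of the diagonal case: `reSpec` commutes with conjugation on the open set of simple
spectra. -/
theorem hasStrictFDerivAt_reSpec (u : unitary (c.Mat n)) {x : Fin n → ℝ} (hx : StrictAnti x)
    (y : Fin n → ℝ) :
    HasStrictFDerivAt (fun p : Herm c n × (Fin n → ℝ) => reSpec p.2 p.1)
      (LinearMap.toContinuousLinearMap (Ad u ∘ₗ
        (schur (divDiff x y) (divDiff_symm x y) ∘ₗ Ad u⁻¹).coprod diagonal))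
      (Ad u (diagonal x), y) := by
  have h1 := hasStrictFDerivAt_reSpec_diagonal (c := c) hx y
  have h2 : HasStrictFDerivAt (fun p : Herm c n × (Fin n → ℝ) => (Ad u⁻¹ p.1, p.2))
      (LinearMap.toContinuousLinearMap ((Ad u⁻¹).prodMap LinearMap.id)) (Ad u (diagonal x), y) :=
    (LinearMap.toContinuousLinearMap ((Ad u⁻¹).prodMap
      (LinearMap.id (R := ℝ) (M := Fin n → ℝ)))).hasStrictFDerivAt
  rw [show ((diagonal x : Herm c n), y) = (Ad u⁻¹ (Ad u (diagonal x)), y) by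
    rw [Ad_inv_Ad]] at h1
  have h3 := (LinearMap.toContinuousLinearMap (Ad (c := c) (n := n) u)).hasStrictFDerivAt.comp _
    (HasStrictFDerivAt.comp (f := fun p : Herm c n × (Fin n → ℝ) => (Ad u⁻¹ p.1, p.2))
      (Ad u (diagonal x), y) h1 h2)
  refine (h3.congr_of_eventuallyEq ?_).congr_fderiv ?_
  · have hs : ∀ᶠ p : Herm c n × (Fin n → ℝ) in 𝓝 (Ad u (diagonal x), y), p.1 ∈ simple c n := by
      refine continuousAt_fst.eventually_mem (isOpen_simple.mem_nhds ?_)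
      change StrictAnti _
      rwa [spec_Ad, spec_diagonal hx.antitone]
    filter_upwards [hs] with p hp
    change Ad u (reSpec p.2 (Ad u⁻¹ p.1)) = _
    rw [reSpec_Ad _ _ hp, Ad_Ad_inv]
  · rfl

end Herm

end Horn

namespace Horn

open SelfAdjointCase

variable {c : SelfAdjointCase} {n : ℕ}

/-! ### Orbits and orbital measures -/

/-- Multiply one column by the conjugate of the determinant, which has modulus $1$. -/
theorem exists_unit_det_mul_diagonal_eq_one {𝕜 : Type*} [RCLike 𝕜]
    (u : unitary (Matrix (Fin n) (Fin n) 𝕜)) :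
    ∃ v : Fin n → 𝕜, (∀ i, star (v i) * v i = 1) ∧
      ((u : Matrix (Fin n) (Fin n) 𝕜) * Matrix.diagonal v).det = 1 := by
  rcases n.eq_zero_or_pos with rfl | hn
  · exact ⟨fun _ => 1, fun i => i.elim0, Matrix.det_isEmpty⟩
  have h1 : star (u : Matrix (Fin n) (Fin n) 𝕜).det * (u : Matrix (Fin n) (Fin n) 𝕜).det = 1 := by
    rw [← Matrix.det_conjTranspose, ← Matrix.det_mul, ← Matrix.star_eq_conjTranspose,
      Unitary.coe_star_mul_self, Matrix.det_one]
  refine ⟨Function.update 1 ⟨0, hn⟩ (star (u : Matrix (Fin n) (Fin n) 𝕜).det), fun i => ?_, ?_⟩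
  · rcases eq_or_ne i ⟨0, hn⟩ with rfl | hi
    · rw [Function.update_self, star_star, mul_comm, h1]
    · simp [hi]
  · rw [Matrix.det_mul, Matrix.det_diagonal, Finset.prod_update_of_mem (Finset.mem_univ _)]
    simp only [Pi.one_apply, Finset.prod_const_one, mul_one]
    rw [mul_comm, h1]

/-- Every unitary matrix is the product of an element of `G` and a diagonal unitary matrix. -/
theorem exists_mul_diagonal_mem_G (u : unitary (c.Mat n)) :
    ∃ v : Fin n → c.K, (∀ i, star (v i) * v i = 1) ∧ ∃ g : c.G n,
      ((g : unitary (c.Mat n)) : c.Mat n) = u * Matrix.diagonal v := by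
  have key : ∀ v : Fin n → c.K, (∀ i, star (v i) * v i = 1) →
      (u : c.Mat n) * Matrix.diagonal v ∈ unitary (c.Mat n) := by
    intro v hv
    refine mul_mem u.2 ?_
    rw [Unitary.mem_iff]
    have h1 : ∀ i, v i * star (v i) = 1 := fun i => by
      rw [mul_star_self_eq, ← star_mul_self_eq, hv]
    rw [Matrix.star_eq_conjTranspose, Matrix.diagonal_conjTranspose, Matrix.diagonal_mul_diagonal,
      Matrix.diagonal_mul_diagonal]
    exact ⟨by simp [hv], by simp [h1]⟩
  cases c with
  | real =>
    obtain ⟨v, hv, hd⟩ := exists_unit_det_mul_diagonal_eq_one (𝕜 := ℝ) u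
    exact ⟨v, hv, ⟨⟨_, key v hv⟩, hd⟩, rfl⟩
  | complex =>
    obtain ⟨v, hv, hd⟩ := exists_unit_det_mul_diagonal_eq_one (𝕜 := ℂ) u
    exact ⟨v, hv, ⟨⟨_, key v hv⟩, hd⟩, rfl⟩
  | quaternionic =>
    exact ⟨fun _ => 1, fun _ => by simp, ⟨u, trivial⟩, by simp⟩

/-- A diagonal unitary matrix commutes with a real diagonal matrix, so restricting the determinant
does not shrink the orbits: $G$-orbits of diagonal matrices are full unitary orbits. -/
theorem exists_G_Ad_diagonal (u : unitary (c.Mat n)) (x : Fin n → ℝ) :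
    ∃ g : c.G n, Herm.Ad (g : unitary (c.Mat n)) (Herm.diagonal x) =
      Herm.Ad u (Herm.diagonal x) := by
  obtain ⟨v, hv, g, hg⟩ := exists_mul_diagonal_mem_G u
  refine ⟨g, ?_⟩
  have h1 : ∀ i, v i * star (v i) = 1 := fun i => by
    rw [mul_star_self_eq, ← star_mul_self_eq, hv]
  ext1
  rw [Herm.mat_Ad, Herm.mat_Ad, hg, star_mul, Herm.mat_diagonal, mul_assoc _ (Matrix.diagonal v),
    Matrix.star_eq_conjTranspose (Matrix.diagonal v), Matrix.diagonal_conjTranspose,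
    Matrix.diagonal_mul_diagonal, mul_assoc (u : c.Mat n), ← mul_assoc (Matrix.diagonal _),
    Matrix.diagonal_mul_diagonal, ← mul_assoc]
  congr 4
  ext1 i
  simp [h1]

instance (c : SelfAdjointCase) (n : ℕ) : IsProbabilityMeasure (haarProb c n) :=
  ⟨by
    have := Measure.haarMeasure_self (K₀ := (⊤ : TopologicalSpace.PositiveCompacts (c.G n)))
    simpa [haarProb] using this⟩

instance (c : SelfAdjointCase) (n : ℕ) : (haarProb c n).IsHaarMeasure := by
  unfold haarProb; infer_instance

/-- Right translation takes a Haar probability measure to a Haar probability measure, and there is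
only one. -/
theorem map_mul_right_haarProb (g : c.G n) : (haarProb c n).map (· * g) = haarProb c n := by
  have : IsProbabilityMeasure ((haarProb c n).map (· * g)) :=
    Measure.isProbabilityMeasure_map (by fun_prop)
  exact Measure.isHaarMeasure_eq_of_isProbabilityMeasure _ _

theorem continuous_Ad_G (X : Herm c n) :
    Continuous fun g : c.G n => Herm.Ad (g : unitary (c.Mat n)) X :=
  Herm.continuous_Ad continuous_subtype_val continuous_const

variable (c) in
/-- The invariant probability measure on the orbit of a diagonal matrix. -/
def orbMeas (x : Fin n → ℝ) : Measure (Herm c n) :=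
  (haarProb c n).map fun g : c.G n => Herm.Ad (g : unitary (c.Mat n)) (Herm.diagonal x)

instance (x : Fin n → ℝ) : IsProbabilityMeasure (orbMeas c x) :=
  Measure.isProbabilityMeasure_map (continuous_Ad_G _).aemeasurable

/-- Right invariance lets the average over $G$ start from any point of the orbit. -/
theorem lintegral_haar_Ad (u : unitary (c.Mat n)) (x : Fin n → ℝ) {f : Herm c n → ENNReal}
    (hf : Measurable f) :
    ∫⁻ g : c.G n, f (Herm.Ad (g : unitary (c.Mat n)) (Herm.Ad u (Herm.diagonal x))) ∂haarProb c n =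
      ∫⁻ X, f X ∂orbMeas c x := by
  obtain ⟨g₀, hg₀⟩ := exists_G_Ad_diagonal u x
  rw [orbMeas, lintegral_map hf (continuous_Ad_G _).measurable]
  conv_rhs => rw [← map_mul_right_haarProb g₀]
  have hm : Measurable fun g : c.G n =>
      f (Herm.Ad (g : unitary (c.Mat n)) (Herm.diagonal x)) :=
    hf.comp (continuous_Ad_G _).measurable
  rw [lintegral_map hm (by fun_prop)]
  refine lintegral_congr fun g => ?_
  rw [← hg₀, ← Herm.Ad_mul]; rfl

open Classical in
/-- The projection of matrices with simple spectrum to the orbit of `x`. -/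
def projOrbit (x : Fin n → ℝ) : Herm c n → Herm c n :=
  (Herm.simple c n).piecewise (Herm.reSpec x) fun _ => 0

theorem measurable_projOrbit (x : Fin n → ℝ) : Measurable (projOrbit x : Herm c n → Herm c n) := by
  classical
  exact ContinuousOn.measurable_piecewise (Herm.continuousOn_reSpec x) continuousOn_const
    Herm.isOpen_simple.measurableSet

theorem projOrbit_Ad_diagonal (x : Fin n → ℝ) (u : unitary (c.Mat n)) {y : Fin n → ℝ}
    (hy : StrictAnti y) :
    projOrbit x (Herm.Ad u (Herm.diagonal y)) = Herm.Ad u (Herm.diagonal x) := by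
  rw [projOrbit, piecewise_eq_of_mem, Herm.reSpec_Ad_diagonal _ _ hy]
  change StrictAnti _
  rwa [Herm.spec_Ad_diagonal _ hy.antitone]

/-- Disintegration of Lebesgue measure into orbital measures. -/
theorem lintegral_projOrbit (x : Fin n → ℝ) {B : Set (Fin n → ℝ)} (hB : MeasurableSet B)
    (hBs : ∀ y ∈ B, StrictAnti y) {f : Herm c n → ENNReal} (hf : Measurable f) :
    ∫⁻ X in Herm.spec ⁻¹' B, f (projOrbit x X) =
      ENNReal.ofReal (c.kappa n) * (∫⁻ y in B, ENNReal.ofReal (vdm y ^ c.scalarDim)) *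
        ∫⁻ X, f X ∂orbMeas c x := by
  have hB' : MeasurableSet (Herm.spec (c := c) ⁻¹' B) := Herm.continuous_spec.measurable hB
  have hm : Measurable fun X : Herm c n => f (projOrbit x X) := hf.comp (measurable_projOrbit x)
  have h1 : ∀ g : c.G n, ∫⁻ X in Herm.spec (c := c) ⁻¹' B, f (projOrbit x X) =
      ∫⁻ X in Herm.spec (c := c) ⁻¹' B, f (projOrbit x (Herm.Ad (g : unitary (c.Mat n)) X)) := by
    intro g
    have hmp := (Herm.AdIso (g : unitary (c.Mat n))).measurePreserving
    rw [← hmp.setLIntegral_comp_preimage hB' hm]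
    congr 2
    ext X
    simp
  have h2 : ∫⁻ X in Herm.spec (c := c) ⁻¹' B, f (projOrbit x X) =
      ∫⁻ _ : c.G n, (∫⁻ X in Herm.spec (c := c) ⁻¹' B, f (projOrbit x X)) ∂haarProb c n := by simp
  -- Lebesgue measure and the spectrum are conjugation invariant, so averaging over $G$ is free.
  -- After the exchange the inner average is the orbital integral, the same for every $X$.
  rw [h2, lintegral_congr h1, lintegral_lintegral_swap]
  · have h3 : ∀ X ∈ Herm.spec (c := c) ⁻¹' B,
        ∫⁻ g : c.G n, f (projOrbit x (Herm.Ad (g : unitary (c.Mat n)) X)) ∂haarProb c n =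
          ∫⁻ X, f X ∂orbMeas c x := by
      intro X hX
      rw [← lintegral_haar_Ad (Herm.frame X) x hf]
      refine lintegral_congr fun g => ?_
      conv_lhs => rw [Herm.eq_Ad_frame X, ← Herm.Ad_mul, projOrbit_Ad_diagonal x _ (hBs _ hX),
        Herm.Ad_mul]
    rw [setLIntegral_congr_fun hB' h3, lintegral_const, Measure.restrict_apply_univ, mul_comm]
    congr 1
    have h4 := lintegral_spec (c := c) (h := B.indicator 1) (measurable_one.indicator hB)
    have h5 : (fun X : Herm c n => B.indicator (1 : (Fin n → ℝ) → ENNReal) (Herm.spec X)) =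
        (Herm.spec ⁻¹' B).indicator 1 := rfl
    rw [h5, lintegral_indicator_one hB'] at h4
    rw [h4, ← lintegral_indicator hB, ← lintegral_indicator Herm.isClosed_antitone.measurableSet]
    congr 2
    ext1 y
    by_cases hy : y ∈ B
    · simp [hy, (hBs y hy).antitone]
    · simp [hy, indicator_apply]
  · refine Measurable.aemeasurable (hm.comp (Continuous.measurable ?_))
    exact Herm.continuous_Ad (continuous_subtype_val.comp continuous_fst) continuous_snd

end Horn

namespace Horn

open SelfAdjointCase

variable {c : SelfAdjointCase} {n : ℕ}

/-! ### The orbital measure in coordinates -/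

/-- An auxiliary set of eigenvalues; positivity and finiteness of its weight are what allow it to be
cancelled later. -/
theorem exists_test_set {x : Fin n → ℝ} (hx : StrictAnti x) (d : ℕ) :
    ∃ B : Set (Fin n → ℝ), MeasurableSet B ∧ (∀ y ∈ B, StrictAnti y) ∧
      (∫⁻ y in B, ENNReal.ofReal (vdm y ^ d)) ≠ 0 ∧
      (∫⁻ y in B, ENNReal.ofReal (vdm y ^ d)) ≠ ⊤ := by
  obtain ⟨r, hr, hB⟩ := Metric.nhds_basis_closedBall.mem_iff.1
    (Herm.isOpen_strictAnti.mem_nhds hx)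
  have hc : Continuous fun y : Fin n → ℝ => vdm y ^ d := continuous_vdm.pow d
  refine ⟨Metric.closedBall x r, Metric.isClosed_closedBall.measurableSet, fun y hy => hB hy, ?_, ?_⟩
  · rw [← pos_iff_ne_zero, setLIntegral_pos_iff (hc.measurable.ennreal_ofReal)]
    refine lt_of_lt_of_le (Metric.measure_ball_pos volume x hr) (measure_mono fun y hy => ?_)
    have hy' := Metric.ball_subset_closedBall hy
    refine ⟨?_, hy'⟩
    rw [Function.mem_support]
    simpa using pow_pos (vdm_pos (hB hy')) d
  · have h := (hc.continuousOn.integrableOn_compact (μ := volume)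
      (isCompact_closedBall x r)).lintegral_lt_top
    exact h.ne

theorem prod_divDiff (x y : Fin n → ℝ) (d : ℕ) :
    ∏ p : {p : Fin n × Fin n // p.1 < p.2}, Herm.divDiff x y p.1.1 p.1.2 ^ d =
      (vdm y / vdm x) ^ d := by
  rw [Finset.prod_pow, prod_pairs (fun i j => Herm.divDiff x y i j), vdm, vdm,
    ← Finset.prod_div_distrib]
  congr 1
  refine Finset.prod_congr rfl fun i _ => ?_
  rw [← Finset.prod_div_distrib]
  refine Finset.prod_congr rfl fun j _ => ?_
  rw [Herm.divDiff_symm, Herm.divDiff]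

/-- The divided differences of `y` at the nodes `x`, with ones on the diagonal. -/
def divDiffOne (x y : Fin n → ℝ) (i j : Fin n) : ℝ := if i = j then 1 else Herm.divDiff x y i j

theorem divDiffOne_symm (x y : Fin n → ℝ) (i j : Fin n) :
    divDiffOne x y i j = divDiffOne x y j i := by
  rw [divDiffOne, divDiffOne, Herm.divDiff_symm]
  simp only [eq_comm]

theorem det_schur_divDiffOne (x y : Fin n → ℝ) :
    LinearMap.det (Herm.schur (divDiffOne x y) (divDiffOne_symm x y) : Herm c n →ₗ[ℝ] Herm c n) =
      (vdm y / vdm x) ^ c.scalarDim := by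
  rw [Herm.det_schur, ← prod_divDiff]
  simp only [divDiffOne, if_true, Finset.prod_const_one, one_mul]
  refine Finset.prod_congr rfl fun p _ => ?_
  rw [if_neg p.2.ne]

theorem inner_diagonal (X : Herm c n) (y : Fin n → ℝ) :
    inner ℝ X (Herm.diagonal y) = ∑ i, Herm.diagPart X i * y i := by
  rw [Herm.inner_eq, traceForm_eq_sum _ (Herm.star_mat _)]
  refine Finset.sum_congr rfl fun i _ => ?_
  rw [Finset.sum_eq_single i, Herm.apply_self, Herm.apply_self, Herm.diagPart_diagonal,
    inner_smul_left, inner_smul_right]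
  · simp
  · intro j _ hj
    rw [Herm.mat_diagonal, Matrix.diagonal_apply_ne _ hj.symm, inner_zero_right]
  · simp

theorem orthonormal_Ad_diagonal_single (u : unitary (c.Mat n)) :
    Orthonormal ℝ fun i : Fin n => (Herm.Ad u (Herm.diagonal (Pi.single i 1)) : Herm c n) := by
  rw [orthonormal_iff_ite]
  intro i j
  rw [Herm.inner_Ad, inner_diagonal, Herm.diagPart_diagonal]
  simp [Pi.single_apply, eq_comm]

theorem det_Ad_conj (u : unitary (c.Mat n)) (L : Herm c n →ₗ[ℝ] Herm c n) :
    LinearMap.det (Herm.Ad u ∘ₗ L ∘ₗ Herm.Ad u⁻¹) = LinearMap.det L := by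
  have h : Herm.Ad (c := c) (n := n) u ∘ₗ Herm.Ad u⁻¹ = LinearMap.id := by
    ext1 X; exact Herm.Ad_Ad_inv u X
  have h1 := congrArg LinearMap.det h
  rw [LinearMap.det_comp, LinearMap.det_id] at h1
  rw [LinearMap.det_comp, LinearMap.det_comp, mul_left_comm, h1, mul_one]

section Coordinates

variable {P : Type*} [NormedAddCommGroup P] [NormedSpace ℝ P]
  {ι : Type*} [Fintype ι] [DecidableEq ι]

/-- The spectrum is constant along `φ`, and its derivative is the diagonal part in the eigenframe;
so vectors tangent to the orbit have zero diagonal there. -/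
theorem diagPart_fderiv_eq_zero {x : Fin n → ℝ} (hx : StrictAnti x) {φ : P → Herm c n} {p : P}
    {φ' : P →L[ℝ] Herm c n} (hφ : HasFDerivAt φ φ' p)
    (hspec : ∀ᶠ q in 𝓝 p, Herm.spec (φ q) = x) {k : unitary (c.Mat n)}
    (hk : φ p = Herm.Ad k (Herm.diagonal x)) (v : P) :
    Herm.diagPart (Herm.Ad k⁻¹ (φ' v)) = 0 := by
  have h1 := (Herm.hasStrictFDerivAt_spec (c := c) k hx).hasFDerivAt
  rw [← hk] at h1
  have h2 := h1.comp p hφ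
  have h3 : HasFDerivAt (Herm.spec ∘ φ) (0 : P →L[ℝ] Fin n → ℝ) p :=
    (hasFDerivAt_const x p).congr_of_eventuallyEq hspec
  exact DFunLike.congr_fun (h2.unique h3) v

theorem exists_hasFDerivAt_reSpec {x : Fin n → ℝ} (hx : StrictAnti x)
    {φ : P → Herm c n} {p : P} {φ' : P →L[ℝ] Herm c n} (hφ : HasFDerivAt φ φ' p)
    {k : unitary (c.Mat n)} (hk : φ p = Herm.Ad k (Herm.diagonal x)) (y : Fin n → ℝ) :
    ∃ F' : P × (Fin n → ℝ) →L[ℝ] Herm c n,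
      HasFDerivAt (fun q : P × (Fin n → ℝ) => Herm.reSpec q.2 (φ q.1)) F' (p, y) ∧
      ∀ v w, F' (v, w) = Herm.Ad k (Herm.schur (Herm.divDiff x y) (Herm.divDiff_symm x y)
        (Herm.Ad k⁻¹ (φ' v)) + Herm.diagonal w) := by
  have h1 := (Herm.hasStrictFDerivAt_reSpec (c := c) k hx y).hasFDerivAt
  rw [← hk] at h1
  have h2 : HasFDerivAt (fun q : P × (Fin n → ℝ) => (φ q.1, q.2))
      (φ'.prodMap (ContinuousLinearMap.id ℝ _)) (p, y) :=
    HasFDerivAt.prodMap (p, y) hφ (hasFDerivAt_id y)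
  have h3 := HasFDerivAt.comp (p, y) (f := fun q : P × (Fin n → ℝ) => (φ q.1, q.2))
    (g := fun q : Herm c n × (Fin n → ℝ) => Herm.reSpec q.2 q.1) h1 h2
  refine ⟨_, h3, fun v w => ?_⟩
  rw [ContinuousLinearMap.comp_apply, LinearMap.coe_toContinuousLinearMap', LinearMap.comp_apply,
    LinearMap.coprod_apply]
  rfl

/-- The Gram determinant of the map `(u, y) ↦ k(u) y k(u)⁻¹`, if `φ u = k(u) x k(u)⁻¹`. -/
theorem gramDet_reSpec (b : ι → P)
    (hι : Fintype.card ι = c.scalarDim * (n * (n - 1) / 2)) {x : Fin n → ℝ} (hx : StrictAnti x)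
    {φ : P → Herm c n} {p : P} {φ' : P →L[ℝ] Herm c n} (hφ : HasFDerivAt φ φ' p)
    (hspec : ∀ᶠ q in 𝓝 p, Herm.spec (φ q) = x) (y : Fin n → ℝ) :
    ∃ F' : P × (Fin n → ℝ) →L[ℝ] Herm c n,
      HasFDerivAt (fun q : P × (Fin n → ℝ) => Herm.reSpec q.2 (φ q.1)) F' (p, y) ∧
      gramDet (Sum.elim (fun i => F' (b i, 0)) fun j => F' (0, Pi.single j 1)) =
        ((vdm y / vdm x) ^ c.scalarDim) ^ 2 * gramDet fun i => φ' (b i) := by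
  obtain ⟨k, hk⟩ : ∃ k, φ p = Herm.Ad k (Herm.diagonal x) :=
    ⟨Herm.frame (φ p), by conv_lhs => rw [Herm.eq_Ad_frame (φ p), hspec.self_of_nhds]⟩
  have h0 := diagPart_fderiv_eq_zero hx hφ hspec hk
  obtain ⟨F', hF', hF⟩ := exists_hasFDerivAt_reSpec hx hφ hk y
  refine ⟨F', hF', ?_⟩
  -- The zeros on the diagonal of the divided differences are replaced by ones. Tangent vectors of
  -- the orbit have no diagonal in this frame and do not notice, while diagonal directions are now
  -- fixed, so `L` carries the frame at $x$ to the frame of $F'$.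
  set L : Herm c n →ₗ[ℝ] Herm c n :=
    Herm.Ad k ∘ₗ Herm.schur (divDiffOne x y) (divDiffOne_symm x y) ∘ₗ Herm.Ad k⁻¹ with hL
  have hcard : Module.finrank ℝ (Herm c n) = Fintype.card (ι ⊕ Fin n) := by
    rw [Herm.finrank_eq, Fintype.card_sum, hι, Fintype.card_fin, add_comm]
  have h3 := gramDet_comp hcard L
    (Sum.elim (fun i => φ' (b i)) fun j => Herm.Ad k (Herm.diagonal (Pi.single j 1)))
  rw [hL, det_Ad_conj, det_schur_divDiffOne, gramDet_sumElim_of_orthonormal _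
    (orthonormal_Ad_diagonal_single k)] at h3
  · rw [← h3]
    congr 1
    ext1 i
    rcases i with i | j
    · simp only [Sum.elim_inl, hF, LinearMap.comp_apply]
      rw [map_zero, add_zero]
      congr 1
      ext i' j'
      rw [Herm.schur_apply, Herm.schur_apply, divDiffOne]
      split_ifs with h
      · subst h; simp [Herm.apply_self, h0]
      · rfl
    · simp only [Sum.elim_inr, hF, LinearMap.comp_apply]
      rw [map_zero, map_zero, map_zero, zero_add, Herm.Ad_inv_Ad]
      congr 1
      ext i' j'
      rw [Herm.schur_apply, divDiffOne, Herm.mat_diagonal]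
      split_ifs with h
      · simp
      · simp [h]
  · intro i j
    rw [← Herm.inner_Ad k⁻¹, Herm.Ad_inv_Ad, inner_diagonal, h0]
    simp

variable [FiniteDimensional ℝ P] [MeasurableSpace P] [BorelSpace P]

/-- The orbital measure in local coordinates. -/
theorem lintegral_orbMeas_image (b : Module.Basis ι ℝ P)
    (hι : Fintype.card ι = c.scalarDim * (n * (n - 1) / 2)) {x : Fin n → ℝ} (hx : StrictAnti x)
    {U : Set P} (hU : IsOpen U) {φ : P → Herm c n} (hφ : DifferentiableOn ℝ φ U)
    (hinj : InjOn φ U) (hspec : ∀ p ∈ U, Herm.spec (φ p) = x) {f : Herm c n → ENNReal}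
    (hf : Measurable f) :
    ∫⁻ X in φ '' U, f X ∂orbMeas c x = ENNReal.ofReal (c.kappa n * vdm x ^ c.scalarDim)⁻¹ *
      ∫⁻ p in U, ENNReal.ofReal √(gramDet fun i => fderiv ℝ φ p (b i)) * f (φ p) ∂b.addHaar := by
  obtain ⟨B, hB, hBs, hB0, hBt⟩ := exists_test_set hx c.scalarDim
  have hPp : ProperSpace P := FiniteDimensional.proper_real P
  have hφU : MeasurableSet (φ '' U) :=
    hU.measurableSet.image_of_continuousOn_injOn hφ.continuousOn hinj
  have hframe : ∀ p ∈ U, ∃ k, φ p = Herm.Ad k (Herm.diagonal x) := fun p hp =>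
    ⟨Herm.frame (φ p), by conv_lhs => rw [Herm.eq_Ad_frame (φ p), hspec p hp]⟩
  -- Thicken the orbit chart to full dimension by letting the eigenvalues vary in the test set $B$.
  let Φ : P × (Fin n → ℝ) → Herm c n := fun q => Herm.reSpec q.2 (φ q.1)
  have hΦ1 : ∀ p ∈ U, ∀ y ∈ B, Herm.spec (Φ (p, y)) = y ∧ projOrbit x (Φ (p, y)) = φ p := by
    intro p hp y hy
    obtain ⟨k, hk⟩ := hframe p hp
    have : Φ (p, y) = Herm.Ad k (Herm.diagonal y) := by
      change Herm.reSpec y (φ p) = _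
      rw [hk, Herm.reSpec_Ad_diagonal _ _ hx]
    rw [this, Herm.spec_Ad_diagonal _ (hBs y hy).antitone, projOrbit_Ad_diagonal _ _ (hBs y hy), hk]
    exact ⟨rfl, rfl⟩
  -- This set is integrated over in two ways: with the Jacobian of $\Phi$, and with the
  -- disintegration `lintegral_projOrbit`.
  have himage : Φ '' (U ×ˢ B) = Herm.spec ⁻¹' B ∩ projOrbit x ⁻¹' (φ '' U) := by
    ext X
    constructor
    · rintro ⟨⟨p, y⟩, ⟨hp, hy⟩, rfl⟩
      obtain ⟨h1, h2⟩ := hΦ1 p hp y hy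
      exact ⟨by rw [mem_preimage, h1]; exact hy, by rw [mem_preimage, h2]; exact ⟨p, hp, rfl⟩⟩
    · rintro ⟨hX, p, hp, hpX⟩
      refine ⟨(p, Herm.spec X), ⟨hp, hX⟩, ?_⟩
      change Herm.reSpec (Herm.spec X) (φ p) = X
      conv_rhs => rw [Herm.eq_Ad_frame X]
      rw [hpX, Herm.eq_Ad_frame X, projOrbit_Ad_diagonal _ _ (hBs _ hX),
        Herm.reSpec_Ad_diagonal _ _ hx, ← Herm.eq_Ad_frame X]
  have hΦinj : InjOn Φ (U ×ˢ B) := by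
    rintro ⟨p, y⟩ ⟨hp, hy⟩ ⟨q, z⟩ ⟨hq, hz⟩ h
    obtain ⟨h1, h2⟩ := hΦ1 p hp y hy
    obtain ⟨h3, h4⟩ := hΦ1 q hq z hz
    rw [h] at h1 h2
    exact Prod.ext (hinj hp hq (h2.symm.trans h4)) (h1.symm.trans h3)
  have key : ∀ q ∈ U ×ˢ B, ∃ F' : P × (Fin n → ℝ) →L[ℝ] Herm c n, HasFDerivAt Φ F' q ∧
      gramDet (fun i => F' (b.prod (Pi.basisFun ℝ (Fin n)) i)) =
        ((vdm q.2 / vdm x) ^ c.scalarDim) ^ 2 * gramDet fun i => fderiv ℝ φ q.1 (b i) := by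
    rintro ⟨p, y⟩ ⟨hp, hy⟩
    obtain ⟨F', h1, h2⟩ := gramDet_reSpec b hι hx
      (hφ.differentiableAt (hU.mem_nhds hp)).hasFDerivAt
      (eventually_of_mem (hU.mem_nhds hp) hspec) y
    refine ⟨F', h1, ?_⟩
    rw [← h2]
    congr 1
    ext1 i
    rcases i with i | i <;> simp
  choose! F' hF' hgram using key
  have hcard : Module.finrank ℝ (Herm c n) = Fintype.card (ι ⊕ Fin n) := by
    rw [Herm.finrank_eq, Fintype.card_sum, hι, Fintype.card_fin, add_comm]
  have hpi : (Pi.basisFun ℝ (Fin n)).addHaar = volume := by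
    rw [Module.Basis.addHaar_def, Module.Basis.parallelepiped_basisFun, addHaarMeasure_eq_volume_pi]
  have h1 := lintegral_image_gramDet (b.prod (Pi.basisFun ℝ (Fin n))) hcard
    (hU.measurableSet.prod hB) (fun q hq => (hF' q hq).hasFDerivWithinAt) hΦinj
    (fun X => f (projOrbit x X))
  have h2 := lintegral_projOrbit (c := c) x hB hBs (f := (φ '' U).indicator f) (hf.indicator hφU)
  have hsp : MeasurableSet (Herm.spec (c := c) ⁻¹' B) := Herm.continuous_spec.measurable hB
  have h3 : ∫⁻ X in Herm.spec ⁻¹' B, (φ '' U).indicator f (projOrbit x X) =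
      ∫⁻ X in Φ '' (U ×ˢ B), f (projOrbit x X) := by
    rw [himage, inter_comm, ← Measure.restrict_restrict (measurable_projOrbit x hφU),
      ← lintegral_indicator (measurable_projOrbit x hφU)]
    rfl
  rw [h3, h1, lintegral_indicator hφU, Module.Basis.prod_addHaar, hpi,
    ← Measure.prod_restrict] at h2
  have hx0 : 0 < vdm x := vdm_pos hx
  have hae : AEMeasurable φ (b.addHaar.restrict U) := hφ.continuousOn.aemeasurable hU.measurableSet
  have hgm : Measurable fun p => gramDet fun i => fderiv ℝ φ p (b i) := by
    simp only [gramDet, Matrix.det_apply, Matrix.of_apply]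
    refine Finset.measurable_sum _ fun σ _ => (Finset.measurable_prod _ fun i _ => ?_).const_smul _
    exact (measurable_fderiv_apply_const ℝ φ _).inner (measurable_fderiv_apply_const ℝ φ _)
  have h4 : ∫⁻ q, ENNReal.ofReal √(gramDet fun i => F' q (b.prod (Pi.basisFun ℝ (Fin n)) i)) *
      f (projOrbit x (Φ q)) ∂(b.addHaar.restrict U).prod (volume.restrict B) =
      ∫⁻ q, (ENNReal.ofReal √(gramDet fun i => fderiv ℝ φ q.1 (b i)) * f (φ q.1)) *
        (ENNReal.ofReal (vdm q.2 ^ c.scalarDim) * ENNReal.ofReal (vdm x ^ c.scalarDim)⁻¹)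
        ∂(b.addHaar.restrict U).prod (volume.restrict B) := by
    rw [Measure.prod_restrict]
    refine setLIntegral_congr_fun (hU.measurableSet.prod hB) fun q hq => ?_
    have hy0 : 0 < vdm q.2 := vdm_pos (hBs _ hq.2)
    rw [hgram q hq, (hΦ1 q.1 hq.1 q.2 hq.2).2, Real.sqrt_mul (sq_nonneg _),
      Real.sqrt_sq (by positivity), ← ENNReal.ofReal_mul (by positivity), div_pow,
      ENNReal.ofReal_mul (by positivity), div_eq_mul_inv]
    ring
  have h6 := lintegral_prod_mul (μ := b.addHaar.restrict U) (ν := volume.restrict B)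
    ((hgm.sqrt.ennreal_ofReal.aemeasurable).mul (hf.comp_aemeasurable hae))
    (((continuous_vdm.pow c.scalarDim).measurable.ennreal_ofReal).mul_const
      (ENNReal.ofReal (vdm x ^ c.scalarDim)⁻¹)).aemeasurable
  replace h2 : (∫⁻ p in U, ENNReal.ofReal √(gramDet fun i => fderiv ℝ φ p (b i)) *
      f (φ p) ∂b.addHaar) * (∫⁻ y in B, ENNReal.ofReal (vdm y ^ c.scalarDim) *
        ENNReal.ofReal (vdm x ^ c.scalarDim)⁻¹) = _ := h6.symm.trans (h4.symm.trans h2)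
  rw [lintegral_mul_const' _ _ ENNReal.ofReal_ne_top] at h2
  set I := ∫⁻ p in U, ENNReal.ofReal √(gramDet fun i => fderiv ℝ φ p (b i)) * f (φ p) ∂b.addHaar
  set J := ∫⁻ X in φ '' U, f X ∂orbMeas c x
  set W := ∫⁻ y in B, ENNReal.ofReal (vdm y ^ c.scalarDim)
  have hκ := kappa_pos c n
  -- Both evaluations contain the weight $W$ of the test set, which is neither $0$ nor infinite.
  have h5 : I * ENNReal.ofReal (vdm x ^ c.scalarDim)⁻¹ = ENNReal.ofReal (c.kappa n) * J := by
    refine (ENNReal.mul_right_inj hB0 hBt).1 ?_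
    calc _ = I * (W * ENNReal.ofReal (vdm x ^ c.scalarDim)⁻¹) := by ring
      _ = _ := h2
      _ = _ := by ring
  rw [mul_inv, ENNReal.ofReal_mul (by positivity), mul_assoc, mul_comm _ I, h5, ← mul_assoc,
    ← ENNReal.ofReal_mul (by positivity), inv_mul_cancel₀ hκ.ne', ENNReal.ofReal_one, one_mul]

end Coordinates

end Horn

namespace Horn

open SelfAdjointCase

variable {c : SelfAdjointCase} {n : ℕ}

/-! ### Orbits, spectra and the map `Ψ` on the space of self-adjoint matrices -/

/-- The entries of a traceless vector. -/
def vec (x : Traceless n) : Fin n → ℝ := x.1.ofLp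

theorem vec_injective : Function.Injective (vec : Traceless n → Fin n → ℝ) := fun _ _ h =>
  Subtype.ext (WithLp.ofLp_injective 2 h)

theorem sum_vec (x : Traceless n) : ∑ i, vec x i = 0 := x.2

theorem mem_chamber {x : Traceless n} : x ∈ chamber n ↔ Antitone (vec x) := Iff.rfl

theorem vandermonde_eq (x : Traceless n) : vandermonde x = vdm (vec x) := rfl

/-- The orthogonal projection of `ℝⁿ` onto the hyperplane of traceless vectors. -/
def tproj : (Fin n → ℝ) →L[ℝ] Traceless n :=
  (Traceless n).orthogonalProjectionOnto ∘L
    ((EuclideanSpace.equiv (Fin n) ℝ).symm : (Fin n → ℝ) →L[ℝ] EuclideanSpace ℝ (Fin n))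

theorem tproj_vec (x : Traceless n) : tproj (vec x) = x :=
  Submodule.orthogonalProjectionOnto_mem_subspace_eq_self x

theorem vec_tproj {x : Fin n → ℝ} (hx : ∑ i, x i = 0) : vec (tproj x) = x :=
  congrArg vec (tproj_vec (⟨WithLp.toLp 2 x, hx⟩ : Traceless n))

theorem conj_eq (u : unitary (c.Mat n)) (x : Traceless n) :
    conj c u x = (Herm.Ad u (Herm.diagonal (vec x)) : Herm c n).mat := rfl

theorem exists_Ad_of_spec {X : Herm c n} {x : Fin n → ℝ} (hX : Herm.spec X = x) :
    ∃ u, X = Herm.Ad u (Herm.diagonal x) :=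
  ⟨Herm.frame X, by conv_lhs => rw [Herm.eq_Ad_frame X, hX]⟩

/-- Isospectral self-adjoint matrices are unitarily conjugate, hence $G$-conjugate by
`exists_G_Ad_diagonal`. Orbits are thereby level sets of the spectrum. -/
theorem mem_orbit_iff {x : Traceless n} (hx : x ∈ chamber n) {B : c.Mat n} :
    B ∈ orbit c x ↔ ∃ X : Herm c n, Herm.spec X = vec x ∧ X.mat = B := by
  constructor
  · rintro ⟨g, rfl⟩
    exact ⟨Herm.Ad (g : unitary (c.Mat n)) (Herm.diagonal (vec x)),
      Herm.spec_Ad_diagonal _ (mem_chamber.1 hx), rfl⟩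
  · rintro ⟨X, hX, rfl⟩
    obtain ⟨u, rfl⟩ := exists_Ad_of_spec hX
    obtain ⟨g, hg⟩ := exists_G_Ad_diagonal u (vec x)
    exact ⟨g, by rw [← hg]; rfl⟩

theorem mat_mem_orbit_iff {x : Traceless n} (hx : x ∈ chamber n) {X : Herm c n} :
    X.mat ∈ orbit c x ↔ Herm.spec X = vec x := by
  rw [mem_orbit_iff hx]
  constructor
  · rintro ⟨Y, hY, h⟩
    rwa [← Herm.mat_injective h]
  · exact fun h => ⟨X, h, rfl⟩

/-- Both sums are the inner product with the identity, which conjugation fixes. -/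
theorem sum_spec (X : Herm c n) : ∑ i, Herm.spec X i = ∑ i, Herm.diagPart X i := by
  have h1 := inner_diagonal X (fun _ => 1)
  have h2 := inner_diagonal (Herm.diagonal (Herm.spec X) : Herm c n) (fun _ => 1)
  rw [Herm.diagPart_diagonal, ← Herm.inner_Ad (Herm.frame X), ← Herm.eq_Ad_frame, diagonal_const,
    one_smul, Ad_hone] at h2
  rw [diagonal_const, one_smul, h2] at h1
  simpa using h1

theorem vec_sortedSpectrum_mat {X : Herm c n} (hX : ∑ i, Herm.spec X i = 0) :
    vec (sortedSpectrum c X.mat) = Herm.spec X := by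
  have h : ∃ x ∈ chamber n, ∃ u : unitary (c.Mat n), X.mat = conj c u x := by
    refine ⟨tproj (Herm.spec X), ?_, Herm.frame X, ?_⟩
    · rw [mem_chamber, vec_tproj hX]
      exact Herm.antitone_spec X
    · rw [conj_eq, vec_tproj hX, ← Herm.eq_Ad_frame]
  rw [sortedSpectrum, dif_pos h]
  obtain ⟨h1, u, h2⟩ := h.choose_spec
  rw [conj_eq] at h2
  have h3 := Herm.mat_injective h2
  conv_rhs => rw [h3]
  rw [Herm.spec_Ad_diagonal _ (mem_chamber.1 h1)]

/-- The map `Ψ`, composed with the projection to traceless vectors, on all self-adjoint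
matrices. -/
def psiH (α : Traceless n) (X : Herm c n) : Traceless n :=
  tproj (Herm.spec (Herm.diagonal (vec α) + X))

theorem continuous_psiH (α : Traceless n) : Continuous (psiH α : Herm c n → Traceless n) :=
  tproj.continuous.comp (Herm.continuous_spec.comp (continuous_const.add continuous_id))

theorem sum_spec_diagonal_add (α : Traceless n) {X : Herm c n} (hX : ∑ i, Herm.spec X i = 0) :
    ∑ i, Herm.spec (Herm.diagonal (vec α) + X) i = 0 := by
  rw [sum_spec, map_add]
  simp only [Pi.add_apply, Finset.sum_add_distrib, Herm.diagPart_diagonal]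
  rw [sum_vec, ← sum_spec, hX, add_zero]

theorem vec_psiH (α : Traceless n) {X : Herm c n} (hX : ∑ i, Herm.spec X i = 0) :
    vec (psiH α X) = Herm.spec (Herm.diagonal (vec α) + X) :=
  vec_tproj (sum_spec_diagonal_add α hX)

theorem Psi_mat (α : Traceless n) {X : Herm c n} (hX : ∑ i, Herm.spec X i = 0) :
    Psi c α X.mat = psiH α X := by
  apply vec_injective
  rw [vec_psiH α hX, ← vec_sortedSpectrum_mat (sum_spec_diagonal_add α hX), map_add]
  rfl

theorem sum_spec_of_eq {X : Herm c n} {β : Traceless n} (hX : Herm.spec X = vec β) :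
    ∑ i, Herm.spec X i = 0 := by rw [hX]; exact sum_vec β

/-- The fiber of `Ψ`, in the space of self-adjoint matrices. -/
def fiberH (c : SelfAdjointCase) (α β γ : Traceless n) : Set (Herm c n) :=
  {X | Herm.spec X = vec β ∧ psiH α X = γ}

variable {α β γ : Traceless n}

theorem mem_fiber_iff (hβ : β ∈ chamber n) {B : c.Mat n} :
    B ∈ fiber c α β γ ↔ ∃ X ∈ fiberH c α β γ, X.mat = B := by
  change B ∈ orbit c β ∧ _ ↔ _
  rw [mem_orbit_iff hβ]
  constructor
  · rintro ⟨⟨X, hX, rfl⟩, h⟩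
    exact ⟨X, ⟨hX, by rwa [← Psi_mat α (sum_spec_of_eq hX)]⟩, rfl⟩
  · rintro ⟨X, ⟨hX, h⟩, rfl⟩
    exact ⟨⟨X, hX, rfl⟩, by rwa [Psi_mat α (sum_spec_of_eq hX)]⟩

theorem mat_mem_fiber_iff (hβ : β ∈ chamber n) {X : Herm c n} :
    X.mat ∈ fiber c α β γ ↔ X ∈ fiberH c α β γ := by
  rw [mem_fiber_iff hβ]
  constructor
  · rintro ⟨Y, hY, h⟩
    rwa [← Herm.mat_injective h]
  · exact fun h => ⟨X, h, rfl⟩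

theorem isCompact_spec_eq (x : Fin n → ℝ) : IsCompact {X : Herm c n | Herm.spec X = x} := by
  refine Metric.isCompact_of_isClosed_isBounded
    (isClosed_eq Herm.continuous_spec continuous_const) ?_
  refine (Metric.isBounded_closedBall (x := (0 : Herm c n))
    (r := ‖(Herm.diagonal x : Herm c n)‖)).subset fun X hX => ?_
  obtain ⟨u, rfl⟩ := exists_Ad_of_spec (show Herm.spec X = x from hX)
  rw [mem_closedBall_zero_iff, Herm.norm_Ad]

theorem isCompact_fiberH : IsCompact (fiberH c α β γ) :=
  (isCompact_spec_eq (vec β)).inter_right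
    (isClosed_eq (continuous_psiH α) continuous_const)

end Horn

/-! ### Trivialization of a smooth map near a compact regular level set -/

/-- A smooth map that is injective on a compact set, with invertible derivatives there, has a smooth
inverse on a neighborhood. -/
theorem exists_contDiffOn_leftInvOn {Z Z' : Type*} [NormedAddCommGroup Z] [NormedSpace ℝ Z]
    [FiniteDimensional ℝ Z] [NormedAddCommGroup Z'] [NormedSpace ℝ Z'] [FiniteDimensional ℝ Z']
    (hdim : Module.finrank ℝ Z = Module.finrank ℝ Z') {Φ : Z → Z'} {U K : Set Z} (hU : IsOpen U)
    (hΦ : ContDiffOn ℝ ∞ Φ U) (hK : IsCompact K) (hKU : K ⊆ U) (hinj : InjOn Φ K)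
    (hder : ∀ z ∈ K, Function.Injective (fderiv ℝ Φ z)) :
    ∃ (O : Set Z) (g : Z' → Z), IsOpen O ∧ K ⊆ O ∧ O ⊆ U ∧ LeftInvOn g Φ O ∧
      (∀ O' ⊆ O, IsOpen O' → IsOpen (Φ '' O')) ∧ ContDiffOn ℝ ∞ g (Φ '' O) := by
  have : CompleteSpace Z := FiniteDimensional.complete ℝ Z
  let I : Set (Z →L[ℝ] Z') := range ((↑) : (Z ≃L[ℝ] Z') → Z →L[ℝ] Z')
  have hI : ∀ A : Z →L[ℝ] Z', Function.Injective A → A ∈ I := fun A hA =>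
    ⟨(LinearMap.linearEquivOfInjective (A : Z →ₗ[ℝ] Z') hA hdim).toContinuousLinearEquiv,
      by ext z; rfl⟩
  have hcd : ∀ z ∈ U, ContDiffAt ℝ ∞ Φ z := fun z hz => hΦ.contDiffAt (hU.mem_nhds hz)
  have hstrict : ∀ z ∈ U, ∀ e : Z ≃L[ℝ] Z', (e : Z →L[ℝ] Z') = fderiv ℝ Φ z →
      HasStrictFDerivAt Φ (e : Z →L[ℝ] Z') z := fun z hz e he => by
    rw [he]; exact (hcd z hz).hasStrictFDerivAt (by simp)
  -- Injectivity on a compact set together with local injectivity at its points extends to a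
  -- neighborhood.
  obtain ⟨t, ht, htinj⟩ := hinj.exists_mem_nhdsSet hK
    (fun z hz => (hcd z (hKU hz)).continuousAt) (fun z hz => by
      obtain ⟨e, he⟩ := hI _ (hder z hz)
      have h1 := hstrict z (hKU hz) e he
      exact ⟨_, (h1.toOpenPartialHomeomorph Φ).open_source.mem_nhds
        h1.mem_toOpenPartialHomeomorph_source, (h1.toOpenPartialHomeomorph Φ).injOn⟩)
  obtain ⟨t', ht'o, hKt', ht't⟩ := mem_nhdsSet_iff_exists.1 ht
  have hfd : ContinuousOn (fderiv ℝ Φ) U := hΦ.continuousOn_fderiv_of_isOpen hU (by simp)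
  -- Invertibility of the derivative is an open condition, so it may be imposed on all of `O`.
  let O : Set Z := t' ∩ (U ∩ fderiv ℝ Φ ⁻¹' I)
  have hO : IsOpen O := ht'o.inter (hfd.isOpen_inter_preimage hU ContinuousLinearEquiv.isOpen)
  have hOinj : InjOn Φ O := htinj.mono (inter_subset_left.trans ht't)
  have hleft : LeftInvOn (Function.invFunOn Φ O) Φ O := hOinj.leftInvOn_invFunOn
  refine ⟨O, Function.invFunOn Φ O, hO, fun z hz => ⟨hKt' hz, hKU hz, hI _ (hder z hz)⟩,
    fun z hz => hz.2.1, hleft, fun O' hO'O hO' => ?_, ?_⟩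
  · rw [isOpen_iff_mem_nhds]
    rintro _ ⟨z, hz, rfl⟩
    obtain ⟨e, he⟩ := (hO'O hz).2.2
    rw [← (hstrict z (hO'O hz).2.1 e he).map_nhds_eq_of_equiv]
    exact image_mem_map (hO'.mem_nhds hz)
  · rintro _ ⟨z, hz, rfl⟩
    obtain ⟨e, he⟩ := hz.2.2
    have h1 := hstrict z hz.2.1 e he
    have h2 := (hcd z hz.2.1).to_localInverse h1.hasFDerivAt (by simp)
    have h3 : ∀ᶠ y in 𝓝 z, Function.invFunOn Φ O (Φ y) = y :=
      eventually_of_mem (hO.mem_nhds hz) hleft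
    exact (h2.congr_of_eventuallyEq (h1.localInverse_unique h3)).contDiffWithinAt

section LevelSet

variable {V W : Type*} [NormedAddCommGroup V] [InnerProductSpace ℝ V] [FiniteDimensional ℝ V]
  [NormedAddCommGroup W] [InnerProductSpace ℝ W] [FiniteDimensional ℝ W]

variable (V W) in
/-- The adjoint, as a linear map. -/
def adjointL : (V →L[ℝ] W) →L[ℝ] (W →L[ℝ] V) :=
  LinearMap.toContinuousLinearMap
    { toFun := fun A => LinearMap.toContinuousLinearMap (LinearMap.adjoint (A : V →ₗ[ℝ] W))
      map_add' := fun A B => by ext w; simp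
      map_smul' := fun r A => by ext w; simp }

theorem inner_adjointL (A : V →L[ℝ] W) (w : W) (v : V) :
    inner ℝ (adjointL V W A w) v = inner ℝ w (A v) :=
  LinearMap.adjoint_inner_left (A : V →ₗ[ℝ] W) v w

/-- If $AA^*w=0$ then $|A^*w|^2=\langle w,AA^*w\rangle=0$, so $w$ is orthogonal to the range of $A$.
-/
theorem adjointL_injective {A : V →L[ℝ] W} (hA : Function.Surjective A) {w : W}
    (h : A (adjointL V W A w) = 0) : w = 0 := by
  have h1 : adjointL V W A w = 0 := by
    rw [← inner_self_eq_zero (𝕜 := ℝ), inner_adjointL, h, inner_zero_right]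
  obtain ⟨v, rfl⟩ := hA w
  rw [← inner_self_eq_zero (𝕜 := ℝ), ← inner_adjointL, h1, inner_zero_left]

/-- Displacement of a point in a direction normal to the level sets of `H`. -/
def normalShift (H : V → W) (p : V × W) : V := p.1 + adjointL V W (fderiv ℝ H p.1) p.2

variable {H : V → W} {U : Set V}

theorem contDiffOn_normalShift (hU : IsOpen U) (hH : ContDiffOn ℝ ∞ H U) :
    ContDiffOn ℝ ∞ (normalShift H) (U ×ˢ univ) := by
  have h1 : ContDiffOn ℝ ∞ (fderiv ℝ H) U := hH.fderiv_of_isOpen hU (by simp)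
  have h2 : ContDiffOn ℝ ∞ (fun p : V × W => adjointL V W (fderiv ℝ H p.1)) (U ×ˢ univ) :=
    (adjointL V W).contDiff.comp_contDiffOn
      (h1.comp contDiffOn_fst fun p hp => hp.1)
  exact contDiffOn_fst.add (h2.clm_apply contDiffOn_snd)

theorem hasFDerivAt_normalShift (hU : IsOpen U) (hH : ContDiffOn ℝ ∞ H U) {x : V} (hx : x ∈ U) :
    HasFDerivAt (normalShift H) ((ContinuousLinearMap.fst ℝ V W) +
      (adjointL V W (fderiv ℝ H x)).comp (ContinuousLinearMap.snd ℝ V W)) (x, 0) := by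
  have h1 : ContDiffOn ℝ ∞ (fderiv ℝ H) U := hH.fderiv_of_isOpen hU (by simp)
  have h2 : DifferentiableAt ℝ (fun p : V × W => adjointL V W (fderiv ℝ H p.1)) (x, 0) := by
    refine (adjointL V W).differentiableAt.comp _ ?_
    refine DifferentiableAt.comp (x, 0) (g := fderiv ℝ H) ?_ differentiableAt_fst
    exact (h1.contDiffAt (hU.mem_nhds hx)).differentiableAt (by simp)
  have h3 := h2.hasFDerivAt.clm_apply (hasFDerivAt_snd (𝕜 := ℝ) (p := (x, (0 : W))))
  refine (hasFDerivAt_fst.add h3).congr_fderiv ?_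
  ext p <;> simp

/-- A smooth map is trivial in a neighborhood of a compact regular level set. -/
theorem exists_trivialization (hU : IsOpen U) (hH : ContDiffOn ℝ ∞ H U) {F : Set V} {h₀ : W}
    (hF : IsCompact F) (hFU : F ⊆ U) (hFH : ∀ x ∈ F, H x = h₀)
    (hsurj : ∀ x ∈ F, Function.Surjective (fderiv ℝ H x)) :
    ∃ (R : Set W) (N : Set V) (f : V × W → V) (g : V → V), IsOpen R ∧ h₀ ∈ R ∧ IsOpen N ∧ F ⊆ N ∧
      ContDiffOn ℝ ∞ f (F ×ˢ R) ∧ ContDiffOn ℝ ∞ g N ∧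
      (∀ x ∈ F, ∀ h ∈ R, f (x, h) ∈ N ∧ H (f (x, h)) = h ∧ g (f (x, h)) = x) ∧
      ∀ y ∈ N, y ∈ U ∧ g y ∈ U ∧ H (g y) = h₀ ∧ f (g y, H y) = y := by
  let ν := normalShift H
  have hν := contDiffOn_normalShift hU hH
  have hU1 : IsOpen (U ×ˢ (univ : Set W)) := hU.prod isOpen_univ
  let U₂ : Set (V × W) := (U ×ˢ univ) ∩ ν ⁻¹' U
  have hU₂ : IsOpen U₂ := hν.continuousOn.isOpen_inter_preimage hU1 hU
  let K : Set (V × W) := (fun x => (x, 0)) '' F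
  have hK : IsCompact K := hF.image (by fun_prop)
  have hν0 : ∀ x, ν (x, 0) = x := fun x => by simp [ν, normalShift]
  have hKU₂ : K ⊆ U₂ := by
    rintro _ ⟨x, hx, rfl⟩
    exact ⟨⟨hFU hx, trivial⟩, by rw [mem_preimage, hν0]; exact hFU hx⟩
  -- Inverting `Nt` at $(y,h_0)$ finds the foot of $y$: the point of the level set from which a
  -- normal shift reaches $y$.
  let Nt : V × W → V × W := fun p => (ν p, H p.1)
  -- Inverting `Om` at $(x,h)$ finds the normal shift from $x$ that reaches the level $h$.
  let Om : V × W → V × W := fun p => (p.1, H (ν p))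
  have hNt : ContDiffOn ℝ ∞ Nt U₂ :=
    (hν.mono inter_subset_left).prodMk (hH.comp contDiffOn_fst fun p hp => hp.1.1)
  have hOm : ContDiffOn ℝ ∞ Om U₂ :=
    contDiffOn_fst.prodMk (hH.comp (hν.mono inter_subset_left) fun p hp => hp.2)
  have hHd : ∀ x ∈ F, HasFDerivAt H (fderiv ℝ H x) x := fun x hx =>
    ((hH.contDiffAt (hU.mem_nhds (hFU hx))).differentiableAt (by simp)).hasFDerivAt
  obtain ⟨O₁, g₁, hO₁, hKO₁, -, hl₁, ho₁, hs₁⟩ := exists_contDiffOn_leftInvOn rfl hU₂ hNt hK hKU₂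
    (by
      rintro _ ⟨x, hx, rfl⟩ _ ⟨y, hy, rfl⟩ h
      have := congrArg Prod.fst h
      simp only [Nt, hν0] at this
      rw [this])
    (by
      rintro _ ⟨x, hx, rfl⟩
      have h1 := hasFDerivAt_normalShift hU hH (hFU hx)
      have h2 : HasFDerivAt (fun p : V × W => H p.1) _ (x, 0) :=
        HasFDerivAt.comp (x, (0 : W)) (hHd x hx) hasFDerivAt_fst
      rw [(h1.prodMk h2).fderiv, injective_iff_map_eq_zero]
      rintro ⟨v, w⟩ h
      have e1 : v + adjointL V W (fderiv ℝ H x) w = 0 := congrArg Prod.fst h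
      have e2 : fderiv ℝ H x v = 0 := congrArg Prod.snd h
      have e3 := congrArg (fderiv ℝ H x) e1
      rw [map_add, e2, zero_add, map_zero] at e3
      have e4 := adjointL_injective (hsurj x hx) e3
      rw [e4, map_zero, add_zero] at e1
      rw [e1, e4]; rfl)
  obtain ⟨O₂, g₂, hO₂, hKO₂, hO₂U, hl₂, ho₂, hs₂⟩ := exists_contDiffOn_leftInvOn rfl hU₂ hOm hK hKU₂
    (by
      rintro _ ⟨x, hx, rfl⟩ _ ⟨y, hy, rfl⟩ h
      have : x = y := congrArg Prod.fst h
      rw [this])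
    (by
      rintro _ ⟨x, hx, rfl⟩
      have h1 := hasFDerivAt_normalShift hU hH (hFU hx)
      have h2 : HasFDerivAt (fun p : V × W => H (ν p)) _ (x, 0) :=
        HasFDerivAt.comp (x, (0 : W)) (by rw [hν0]; exact hHd x hx) h1
      rw [(hasFDerivAt_fst.prodMk h2).fderiv, injective_iff_map_eq_zero]
      rintro ⟨v, w⟩ h
      have e1 : v = 0 := congrArg Prod.fst h
      have e2 : fderiv ℝ H x (v + adjointL V W (fderiv ℝ H x) w) = 0 := congrArg Prod.snd h
      rw [e1, zero_add] at e2
      rw [e1, adjointL_injective (hsurj x hx) e2]; rfl)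
  let O := O₁ ∩ O₂
  have hO : IsOpen O := hO₁.inter hO₂
  have hKO : K ⊆ O := subset_inter hKO₁ hKO₂
  have hΩ : IsOpen (Om '' O) := ho₂ O inter_subset_right hO
  have hNo : IsOpen (Nt '' O) := ho₁ O inter_subset_left hO
  have hFΩ : F ×ˢ {h₀} ⊆ Om '' O := by
    rintro ⟨x, h⟩ ⟨hx, hh⟩
    refine ⟨(x, 0), hKO ⟨x, hx, rfl⟩, ?_⟩
    have hh' : h = h₀ := hh
    simp only [Om, hν0, hFH x hx, hh']
  -- Compactness of the level set gives one range of levels `R` valid at all its points.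
  obtain ⟨u, R, -, hR, hFu, hhR, huR⟩ := generalized_tube_lemma hF isCompact_singleton hΩ hFΩ
  have hFRO : F ×ˢ R ⊆ Om '' O := (prod_mono hFu le_rfl).trans huR
  let N : Set V := {y | (y, h₀) ∈ Nt '' O}
  have hN : IsOpen N := hNo.preimage (by fun_prop : Continuous fun y : V => (y, h₀))
  have key : ∀ p ∈ O, g₂ (Om p) = p ∧ g₁ (Nt p) = p := fun p hp => ⟨hl₂ hp.2, hl₁ hp.1⟩
  refine ⟨R, N, fun p => ν (g₂ p), fun y => (g₁ (y, h₀)).1, hR, hhR rfl, hN, ?_, ?_, ?_, ?_, ?_⟩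
  · intro x hx
    exact ⟨(x, 0), hKO ⟨x, hx, rfl⟩, by simp only [Nt, hν0, hFH x hx]⟩
  · refine hν.comp (hs₂.mono (hFRO.trans (image_mono inter_subset_right))) fun p hp => ?_
    obtain ⟨q, hq, hqp⟩ := hFRO hp
    rw [← hqp, (key q hq).1]
    exact (hO₂U hq.2).1
  · refine contDiffOn_fst.comp (hs₁.comp (contDiffOn_id.prodMk contDiffOn_const) ?_)
      (mapsTo_univ _ _)
    intro y hy
    exact image_mono inter_subset_left hy
  · intro x hx h hh
    obtain ⟨q, hq, hqp⟩ := hFRO (mk_mem_prod hx hh)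
    have e1 : q.1 = x := congrArg Prod.fst hqp
    have e2 : H (ν q) = h := congrArg Prod.snd hqp
    have e3 : Nt q = (ν q, h₀) := by simp only [Nt, e1, hFH x hx]
    simp only [← hqp, (key q hq).1]
    refine ⟨⟨q, hq, e3⟩, e2, ?_⟩
    rw [← e3, (key q hq).2]; exact e1
  · rintro y ⟨q, hq, hqy⟩
    have e1 : ν q = y := congrArg Prod.fst hqy
    have e2 : H q.1 = h₀ := congrArg Prod.snd hqy
    simp only [← hqy, (key q hq).2]
    rw [← e1]
    refine ⟨(hO₂U hq.2).2, (hO₂U hq.2).1.1, e2, ?_⟩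
    exact congrArg ν (key q hq).1

/-- A regular level set is locally parametrized by the space of the expected dimension. -/
theorem exists_levelSet_chart (hU : IsOpen U) (hH : ContDiffOn ℝ ∞ H U) {x : V} (hx : x ∈ U)
    (hsurj : Function.Surjective (fderiv ℝ H x)) {m : ℕ}
    (hm : m + Module.finrank ℝ W = Module.finrank ℝ V) :
    ∃ (O : Set V) (D : Set (EuclideanSpace ℝ (Fin m))) (f : EuclideanSpace ℝ (Fin m) → V)
      (A : V →L[ℝ] EuclideanSpace ℝ (Fin m)), IsOpen O ∧ x ∈ O ∧ O ⊆ U ∧ IsOpen D ∧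
      ContDiffOn ℝ ∞ f D ∧ f '' D = {y ∈ O | H y = H x} ∧ LeftInvOn A f D := by
  let L := fderiv ℝ H x
  have hker : Module.finrank ℝ (LinearMap.ker (L : V →ₗ[ℝ] W)) =
      Module.finrank ℝ (EuclideanSpace ℝ (Fin m)) := by
    have h1 := LinearMap.finrank_range_add_finrank_ker (L : V →ₗ[ℝ] W)
    rw [LinearMap.range_eq_top.2 hsurj, finrank_top] at h1
    rw [finrank_euclideanSpace_fin]
    omega
  let e := (LinearEquiv.ofFinrankEq _ _ hker).toContinuousLinearEquiv
  -- Projection to the tangent space supplies the coordinates complementary to `H`; the kernel of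
  -- the derivative has dimension `m` by surjectivity.
  let A : V →L[ℝ] EuclideanSpace ℝ (Fin m) :=
    (e : _ →L[ℝ] EuclideanSpace ℝ (Fin m)).comp
      (LinearMap.ker (L : V →ₗ[ℝ] W)).orthogonalProjectionOnto
  let Φ : V → EuclideanSpace ℝ (Fin m) × W := fun y => (A y, H y)
  have hΦ : ContDiffOn ℝ ∞ Φ U := A.contDiff.contDiffOn.prodMk hH
  obtain ⟨O, g, hO, hxO, hOU, hl, ho, hs⟩ := exists_contDiffOn_leftInvOn
    (by rw [Module.finrank_prod, finrank_euclideanSpace_fin]; exact hm.symm) hU hΦ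
    (isCompact_singleton (x := x)) (singleton_subset_iff.2 hx) (injOn_singleton _ _)
    (by
      intro z hz
      rw [mem_singleton_iff.1 hz]
      have h1 : HasFDerivAt H L x :=
        ((hH.contDiffAt (hU.mem_nhds hx)).differentiableAt (by simp)).hasFDerivAt
      rw [(A.hasFDerivAt.prodMk h1).fderiv, injective_iff_map_eq_zero]
      intro v hv
      have e1 : e ((LinearMap.ker (L : V →ₗ[ℝ] W)).orthogonalProjectionOnto v) = 0 :=
        congrArg Prod.fst hv
      have e2 : L v = 0 := congrArg Prod.snd hv
      have e3 := (map_eq_zero_iff e e.injective).1 e1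
      have e4 := Submodule.orthogonalProjectionOnto_mem_subspace_eq_self
        (⟨v, e2⟩ : LinearMap.ker (L : V →ₗ[ℝ] W))
      rw [e3] at e4
      exact (congrArg Subtype.val e4).symm)
  have hΦO : IsOpen (Φ '' O) := ho O le_rfl hO
  let D : Set (EuclideanSpace ℝ (Fin m)) := {z | (z, H x) ∈ Φ '' O}
  refine ⟨O, D, fun z => g (z, H x), A, hO, hxO rfl, hOU, hΦO.preimage (by fun_prop),
    hs.comp (contDiffOn_id.prodMk contDiffOn_const) fun z hz => hz, ?_, ?_⟩
  · ext y
    constructor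
    · rintro ⟨z, ⟨q, hq, hqz⟩, rfl⟩
      simp only [← hqz, hl hq]
      exact ⟨hq, congrArg Prod.snd hqz⟩
    · rintro ⟨hy, hyx⟩
      have e1 : Φ y = (A y, H x) := by simp only [Φ, hyx]
      exact ⟨A y, ⟨y, hy, e1⟩, by simp only [← e1, hl hy]⟩
  · rintro z ⟨q, hq, hqz⟩
    simp only [← hqz, hl hq]
    exact congrArg Prod.fst hqz

end LevelSet

namespace Horn

open SelfAdjointCase

variable {c : SelfAdjointCase} {n : ℕ} {α β γ₀ : Traceless n}

/-! ### Regular values of `Ψ` -/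

attribute [local instance] Matrix.normedAddCommGroup Matrix.normedSpace

variable (c n) in
/-- The inclusion of the self-adjoint matrices. -/
def matL : Herm c n →L[ℝ] c.Mat n := LinearMap.toContinuousLinearMap Herm.mat

variable (c n) in
/-- The projection to the self-adjoint matrices. -/
def ofMatL : c.Mat n →L[ℝ] Herm c n := LinearMap.toContinuousLinearMap Herm.ofMat

theorem matL_apply (X : Herm c n) : matL c n X = X.mat := rfl

theorem ofMatL_mat (X : Herm c n) : ofMatL c n X.mat = X := Herm.ofMat_mat X

/-- The tangent space of an orbit, in the space of self-adjoint matrices. -/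
def tangentH (k : unitary (c.Mat n)) : Submodule ℝ (Herm c n) :=
  LinearMap.ker (Herm.diagPart ∘ₗ Herm.Ad k⁻¹)

theorem mem_tangentH {k : unitary (c.Mat n)} {Z : Herm c n} :
    Z ∈ tangentH k ↔ Herm.diagPart (Herm.Ad k⁻¹ Z) = 0 := Iff.rfl

/-- A curve in the orbit of `x`. -/
def orbitCurve (k : unitary (c.Mat n)) (x : Fin n → ℝ) (Z : Herm c n) (t : ℝ) : Herm c n :=
  Herm.Ad k (Herm.spectralChart x (Herm.diagonal x + t • Herm.Ad k⁻¹ Z))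

/-- A tangent direction leaves the diagonal fed to `spectralChart` equal to $x$, so the curve only
conjugates $\operatorname{diag}(x)$. -/
theorem spec_orbitCurve {k : unitary (c.Mat n)} {x : Fin n → ℝ} (hx : Antitone x) {Z : Herm c n}
    (hZ : Z ∈ tangentH k) (t : ℝ) : Herm.spec (orbitCurve k x Z t) = x := by
  rw [orbitCurve, Herm.spec_Ad, Herm.spectralChart, map_add Herm.diagPart,
    map_smul Herm.diagPart, mem_tangentH.1 hZ, smul_zero, add_zero,
    Herm.diagPart_diagonal, Herm.spec_Ad_diagonal _ hx]

theorem orbitCurve_zero (k : unitary (c.Mat n)) (x : Fin n → ℝ) (Z : Herm c n) :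
    orbitCurve k x Z 0 = Herm.Ad k (Herm.diagonal x) := by
  rw [orbitCurve, zero_smul, add_zero, Herm.spectralChart_diagonal]

theorem hasDerivAt_orbitCurve (k : unitary (c.Mat n)) {x : Fin n → ℝ} (hx : StrictAnti x)
    (Z : Herm c n) : HasDerivAt (orbitCurve k x Z) Z 0 := by
  have h1 : HasDerivAt (fun t : ℝ => (Herm.diagonal x + t • Herm.Ad k⁻¹ Z : Herm c n))
      (Herm.Ad k⁻¹ Z) 0 := by
    simpa using ((hasDerivAt_id (0 : ℝ)).smul_const (Herm.Ad k⁻¹ Z)).const_add (Herm.diagonal x)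
  have h2 := (Herm.hasStrictFDerivAt_spectralChart (c := c) hx).hasFDerivAt
  have h3 : (Herm.diagonal x + (0 : ℝ) • Herm.Ad k⁻¹ Z : Herm c n) = Herm.diagonal x := by simp
  rw [← h3] at h2
  have h4 := (LinearMap.toContinuousLinearMap (Herm.Ad (c := c) (n := n) k)).hasFDerivAt.comp_hasDerivAt
    (0 : ℝ) (h2.comp_hasDerivAt (0 : ℝ) h1)
  refine h4.congr_deriv ?_
  exact Herm.Ad_Ad_inv k Z

/-- Two functions are constant on the orbit, namely the deviation from the self-adjoint part and the
spectrum of that part. Their derivatives must vanish on the tangent cone. -/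
theorem tangentCone_orbit_subset (hβ : StrictAnti (vec β)) {k : unitary (c.Mat n)} {X : Herm c n}
    (hX : X = Herm.Ad k (Herm.diagonal (vec β))) {v : c.Mat n}
    (hv : v ∈ tangentConeAt ℝ (orbit c β) X.mat) : ∃ Z ∈ tangentH k, Z.mat = v := by
  have hβ' : β ∈ chamber n := hβ.antitone
  have hmem : X.mat ∈ orbit c β := by
    rw [mat_mem_orbit_iff hβ', hX, Herm.spec_Ad_diagonal _ hβ.antitone]
  have h1 : HasFDerivWithinAt (fun B => B - matL c n (ofMatL c n B))
      (ContinuousLinearMap.id ℝ _ - (matL c n).comp (ofMatL c n)) (orbit c β) X.mat :=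
    (ContinuousLinearMap.id ℝ _ - (matL c n).comp (ofMatL c n)).hasFDerivWithinAt
  have h2 : HasFDerivWithinAt (fun B => B - matL c n (ofMatL c n B)) (0 : c.Mat n →L[ℝ] c.Mat n)
      (orbit c β) X.mat := by
    have h0 : ∀ B ∈ orbit c β, B - matL c n (ofMatL c n B) = 0 := by
      intro B hB
      obtain ⟨Y, -, rfl⟩ := (mem_orbit_iff hβ').1 hB
      rw [ofMatL_mat, matL_apply, sub_self]
    exact (hasFDerivWithinAt_const (0 : c.Mat n) X.mat (orbit c β)).congr h0 (h0 _ hmem)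
  have h3 : v = (ofMatL c n v).mat := sub_eq_zero.1 (h1.unique_on h2 hv)
  refine ⟨ofMatL c n v, ?_, h3.symm⟩
  have h4 := (Herm.hasStrictFDerivAt_spec (c := c) k hβ).hasFDerivAt
  rw [← hX, ← ofMatL_mat X] at h4
  have h5 := (h4.comp X.mat (ofMatL c n).hasFDerivAt).hasFDerivWithinAt (s := orbit c β)
  have h6 : HasFDerivWithinAt (Herm.spec ∘ ofMatL c n) (0 : c.Mat n →L[ℝ] Fin n → ℝ)
      (orbit c β) X.mat := by
    have h0 : ∀ B ∈ orbit c β, (Herm.spec ∘ ofMatL c n) B = vec β := by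
      intro B hB
      obtain ⟨Y, hY, rfl⟩ := (mem_orbit_iff hβ').1 hB
      rw [Function.comp_apply, ofMatL_mat, hY]
    exact (hasFDerivWithinAt_const (vec β) X.mat (orbit c β)).congr h0 (h0 _ hmem)
  exact h5.unique_on h6 hv

/-- At a regular value, `Ψ` has derivatives along curves in the orbit, in all directions. -/
theorem exists_deriv_psiH (hβ : StrictAnti (vec β)) (hreg : IsRegularValue c α β γ₀)
    {X : Herm c n} (hX : X ∈ fiberH c α β γ₀) {k : unitary (c.Mat n)}
    (hk : X = Herm.Ad k (Herm.diagonal (vec β))) :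
    ∃ L : Herm c n →L[ℝ] Traceless n, (tangentH k).map (L : Herm c n →ₗ[ℝ] Traceless n) = ⊤ ∧
      ∀ Z ∈ tangentH k, HasDerivAt (fun t => psiH α (orbitCurve k (vec β) Z t)) (L Z) 0 := by
  have hβ' : β ∈ chamber n := hβ.antitone
  obtain ⟨L, hL, hLs⟩ := hreg X.mat ((mat_mem_fiber_iff hβ').2 hX)
  refine ⟨L.comp (matL c n), ?_, fun Z hZ => ?_⟩
  · rw [eq_top_iff, ← hLs, Submodule.map_le_iff_le_comap, tangentSpace, Submodule.span_le]
    intro v hv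
    obtain ⟨Z, hZ, rfl⟩ := tangentCone_orbit_subset hβ hk hv
    exact ⟨Z, hZ, rfl⟩
  · have h1 := (matL c n).hasFDerivAt.comp_hasDerivAt (0 : ℝ) (hasDerivAt_orbitCurve k hβ Z)
    have hs : ∀ t, Herm.spec (orbitCurve k (vec β) Z t) = vec β := spec_orbitCurve hβ.antitone hZ
    have h0 : (matL c n ∘ orbitCurve k (vec β) Z) 0 = X.mat := by
      rw [Function.comp_apply, orbitCurve_zero, ← hk]; rfl
    have h2 : HasDerivAt (Psi c α ∘ (matL c n ∘ orbitCurve k (vec β) Z)) (L Z.mat) 0 := by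
      rw [← h0] at hL
      exact hL.comp_hasDerivAt (0 : ℝ) h1
        (Eventually.of_forall fun t => (mat_mem_orbit_iff hβ').2 (hs t))
    refine h2.congr_of_eventuallyEq (Eventually.of_forall fun t => ?_)
    exact (Psi_mat α (sum_spec_of_eq (hs t))).symm

/-- If two entries of $\gamma_0$ coincided, the gap between these eigenvalues, nonnegative on the
orbit, would attain its minimum $0$ at a fiber point. Its differential would vanish in every tangent
direction, so the differential of $\Psi$ could not be onto. -/
theorem strictAnti_of_regular (hβ : StrictAnti (vec β)) (hreg : IsRegularValue c α β γ₀)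
    (hne : (fiberH c α β γ₀).Nonempty) : StrictAnti (vec γ₀) := by
  obtain ⟨X, hX⟩ := hne
  obtain ⟨k, hk⟩ := exists_Ad_of_spec hX.1
  obtain ⟨L, hL, hd⟩ := exists_deriv_psiH hβ hreg hX hk
  have hγ₀ : vec γ₀ = Herm.spec (Herm.diagonal (vec α) + X) := by
    rw [← hX.2, vec_psiH α (sum_spec_of_eq hX.1)]
  have hanti : Antitone (vec γ₀) := hγ₀ ▸ Herm.antitone_spec _
  intro i j hij
  refine lt_of_le_of_ne (hanti hij.le) fun heq => ?_
  let ℓ : Traceless n →L[ℝ] ℝ := LinearMap.toContinuousLinearMap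
    { toFun := fun x => vec x i - vec x j
      map_add' := fun x y => by simp [vec]; ring
      map_smul' := fun r x => by simp [vec]; ring }
  have hℓ : ∀ x, ℓ x = vec x i - vec x j := fun x => rfl
  have key : ∀ Z ∈ tangentH k, ℓ (L Z) = 0 := by
    intro Z hZ
    have h1 : HasDerivAt (fun t => ℓ (psiH α (orbitCurve k (vec β) Z t))) (ℓ (L Z)) 0 :=
      ℓ.hasFDerivAt.comp_hasDerivAt (0 : ℝ) (hd Z hZ)
    refine IsLocalMin.hasDerivAt_eq_zero (Eventually.of_forall fun t => ?_) h1
    have h2 : psiH α (orbitCurve k (vec β) Z 0) = γ₀ := by rw [orbitCurve_zero, ← hk, hX.2]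
    simp only [h2, hℓ]
    rw [heq, sub_self, vec_psiH α (sum_spec_of_eq (spec_orbitCurve hβ.antitone hZ t))]
    exact sub_nonneg.2 (Herm.antitone_spec _ hij.le)
  -- The traceless vector $e_i-e_j$, on which `ℓ` equals $2$, would have to be in the image.
  have hsum : ∑ l, (Pi.single i 1 - Pi.single j 1 : Fin n → ℝ) l = 0 := by simp
  obtain ⟨Z, hZ, hZe⟩ : tproj (Pi.single i 1 - Pi.single j 1) ∈
      (tangentH k).map (L : Herm c n →ₗ[ℝ] Traceless n) := hL ▸ Submodule.mem_top
  have h3 := key Z hZ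
  rw [show L Z = _ from hZe, hℓ, vec_tproj hsum] at h3
  simp [hij.ne, hij.ne'] at h3

/-- The map whose level sets are the fibers of `Ψ`. -/
def levelMap (α : Traceless n) (X : Herm c n) : (Fin n → ℝ) × Traceless n :=
  (Herm.spec X, psiH α X)

variable (c) in
/-- The matrices `X` such that `X` and `α + X` have simple spectra. -/
def regularSet (α : Traceless n) : Set (Herm c n) :=
  {X | X ∈ Herm.simple c n ∧ Herm.diagonal (vec α) + X ∈ Herm.simple c n}

theorem isOpen_regularSet : IsOpen (regularSet c α) :=
  Herm.isOpen_simple.inter (Herm.isOpen_simple.preimage (by fun_prop))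

theorem contDiffAt_psiH {X : Herm c n} (hX : X ∈ regularSet c α) : ContDiffAt ℝ ∞ (psiH α) X := by
  refine tproj.contDiff.contDiffAt.comp X ?_
  exact (Herm.contDiffAt_spec hX.2).comp X (contDiffAt_const.add contDiffAt_id)

theorem contDiffOn_levelMap : ContDiffOn ℝ ∞ (levelMap α) (regularSet c α) := fun _ hX =>
  ((Herm.contDiffAt_spec hX.1).prodMk (contDiffAt_psiH hX)).contDiffWithinAt

theorem fiberH_subset_regularSet (hβ : StrictAnti (vec β)) (hγ₀ : StrictAnti (vec γ₀)) :
    fiberH c α β γ₀ ⊆ regularSet c α := fun X hX => by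
  refine ⟨?_, ?_⟩
  · change StrictAnti _
    rwa [hX.1]
  · change StrictAnti _
    rwa [← vec_psiH α (sum_spec_of_eq hX.1), hX.2]

/-- Directions diagonal in the eigenframe realize any change of the spectrum; a tangent direction,
which leaves the spectrum alone, then corrects the $\Psi$-component by regularity. -/
theorem surjective_fderiv_levelMap (hβ : StrictAnti (vec β)) (hreg : IsRegularValue c α β γ₀)
    {X : Herm c n} (hX : X ∈ fiberH c α β γ₀) :
    Function.Surjective (fderiv ℝ (levelMap α) X) := by
  have hγ₀ := strictAnti_of_regular hβ hreg ⟨X, hX⟩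
  have hXr := fiberH_subset_regularSet hβ hγ₀ hX
  obtain ⟨k, hk⟩ := exists_Ad_of_spec hX.1
  obtain ⟨L, hL, hd⟩ := exists_deriv_psiH hβ hreg hX hk
  have h1 := (Herm.hasStrictFDerivAt_spec (c := c) k hβ).hasFDerivAt
  rw [← hk] at h1
  have h2 : HasFDerivAt (psiH α) (fderiv ℝ (psiH α) X) X :=
    ((contDiffAt_psiH hXr).differentiableAt (by simp)).hasFDerivAt
  have h3 : HasFDerivAt (levelMap α) _ X := h1.prodMk h2
  rw [h3.fderiv]
  have hT : ∀ Z ∈ tangentH k, fderiv ℝ (psiH α) X Z = L Z := by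
    intro Z hZ
    have h4 : HasFDerivAt (psiH α) (fderiv ℝ (psiH α) X) (orbitCurve k (vec β) Z 0) := by
      rw [orbitCurve_zero, ← hk]; exact h2
    exact (h4.comp_hasDerivAt (0 : ℝ) (hasDerivAt_orbitCurve k hβ Z)).unique (hd Z hZ)
  rintro ⟨a, γ⟩
  have hmem : γ - fderiv ℝ (psiH α) X (Herm.Ad k (Herm.diagonal a)) ∈
      (tangentH k).map (L : Herm c n →ₗ[ℝ] Traceless n) := hL ▸ Submodule.mem_top
  obtain ⟨Z, hZ, hZe⟩ := hmem
  refine ⟨Herm.Ad k (Herm.diagonal a) + Z, Prod.ext ?_ ?_⟩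
  · change Herm.diagPart (Herm.Ad k⁻¹ (Herm.Ad k (Herm.diagonal a) + Z)) = a
    rw [map_add, map_add, mem_tangentH.1 hZ, Herm.Ad_inv_Ad, Herm.diagPart_diagonal, add_zero]
  · change fderiv ℝ (psiH α) X (Herm.Ad k (Herm.diagonal a) + Z) = γ
    rw [map_add, hT Z hZ, show L Z = _ from hZe, add_sub_cancel]

end Horn

namespace Horn

open SelfAdjointCase

variable {c : SelfAdjointCase} {n : ℕ} {α β γ₀ : Traceless n}

/-! ### Existence of trivializations and atlases -/

theorem finrank_traceless (hn : 0 < n) : Module.finrank ℝ (Traceless n) = n - 1 := by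
  let φ : EuclideanSpace ℝ (Fin n) →ₗ[ℝ] ℝ :=
    { toFun := fun x => ∑ i, x i
      map_add' := fun x y => by simp [Finset.sum_add_distrib]
      map_smul' := fun r x => by simp [Finset.mul_sum] }
  have h1 : Traceless n = LinearMap.ker φ := rfl
  have h2 : LinearMap.range φ = ⊤ := by
    rw [LinearMap.range_eq_top]
    intro r
    exact ⟨EuclideanSpace.single ⟨0, hn⟩ r, by simp [φ]⟩
  have h3 := LinearMap.finrank_range_add_finrank_ker φ
  rw [h2, finrank_top, Module.finrank_self, finrank_euclideanSpace_fin, ← h1] at h3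
  omega

/-- The subtraction in `fiberDim` is never truncated, because $n-1\le n(n-1)/2$ unless $n-1=0$, when
both are $0$. -/
theorem fiberDim_add (c : SelfAdjointCase) (n : ℕ) :
    c.fiberDim n + (n - 1) = c.scalarDim * (n * (n - 1) / 2) := by
  have h1 : n - 1 ≤ n * (n - 1) / 2 := by
    rcases n with _ | _ | n
    · simp
    · simp
    · rw [Nat.le_div_iff_mul_le (by norm_num)]
      simp only [Nat.add_sub_cancel]
      nlinarith
  have h2 : n * (n - 1) / 2 ≤ c.scalarDim * (n * (n - 1) / 2) :=
    Nat.le_mul_of_pos_left _ (scalarDim_pos c)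
  rw [fiberDim]
  omega

attribute [local instance] Matrix.normedAddCommGroup Matrix.normedSpace

/-- The map `levelMap`, with values in a Euclidean space. -/
def levelMapE (α : Traceless n) (X : Herm c n) :
    EuclideanSpace ℝ (Fin (Module.finrank ℝ ((Fin n → ℝ) × Traceless n))) :=
  toEuclidean (levelMap α X)

theorem contDiffOn_levelMapE : ContDiffOn ℝ ∞ (levelMapE α) (regularSet c α) :=
  (toEuclidean : ((Fin n → ℝ) × Traceless n) ≃L[ℝ] _).contDiff.comp_contDiffOn contDiffOn_levelMap

theorem levelMapE_eq_iff {X : Herm c n} {x : Fin n → ℝ} {γ : Traceless n} :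
    levelMapE α X = toEuclidean (x, γ) ↔ Herm.spec X = x ∧ psiH α X = γ := by
  rw [levelMapE, toEuclidean.injective.eq_iff, levelMap, Prod.mk_inj]

theorem fiberH_subset_of_regular (hβ : StrictAnti (vec β)) (hreg : IsRegularValue c α β γ₀) :
    fiberH c α β γ₀ ⊆ regularSet c α := fun _ hX =>
  fiberH_subset_regularSet hβ (strictAnti_of_regular hβ hreg ⟨_, hX⟩) hX

/-- Normal shifts use adjoints, so the target needs an inner product; composing with `toEuclidean`
provides one and preserves surjectivity. -/
theorem surjective_fderiv_levelMapE (hβ : StrictAnti (vec β)) (hreg : IsRegularValue c α β γ₀)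
    {X : Herm c n} (hX : X ∈ fiberH c α β γ₀) :
    Function.Surjective (fderiv ℝ (levelMapE α) X) := by
  have hXr := fiberH_subset_of_regular hβ hreg hX
  have h1 : HasFDerivAt (levelMap α) (fderiv ℝ (levelMap α) X) X :=
    ((contDiffOn_levelMap.contDiffAt (isOpen_regularSet.mem_nhds hXr)).differentiableAt
      (by simp)).hasFDerivAt
  have h2 : HasFDerivAt (levelMapE α) _ X :=
    (toEuclidean : ((Fin n → ℝ) × Traceless n) ≃L[ℝ] _).hasFDerivAt.comp X h1
  rw [h2.fderiv]
  exact toEuclidean.surjective.comp (surjective_fderiv_levelMap hβ hreg hX)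

/-- `exists_trivialization` trivializes a neighborhood `N` of the fiber for the pair of spectrum and
$\Psi$; freezing the spectrum at $\beta$ restricts it to the orbit. It remains to choose $E$ with
$\Psi^{-1}(E)$ inside `N`. -/
theorem nonempty_fiberTrivialization (hβ : StrictAnti (vec β)) (hreg : IsRegularValue c α β γ₀) :
    Nonempty (FiberTrivialization c α β γ₀) := by
  have hβ' : β ∈ chamber n := hβ.antitone
  obtain ⟨R, N, f, g, hR, h₀R, hN, hFN, hf, hg, hfg, hgf⟩ := exists_trivialization
    (H := levelMapE α) (h₀ := toEuclidean (vec β, γ₀)) isOpen_regularSet contDiffOn_levelMapE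
    (isCompact_fiberH (c := c) (α := α) (β := β) (γ := γ₀))
    (fiberH_subset_of_regular hβ hreg) (fun X hX => levelMapE_eq_iff.2 hX)
    (fun X hX => surjective_fderiv_levelMapE hβ hreg hX)
  -- The part of the orbit outside `N` is compact and misses the fiber, so its image is closed and
  -- misses $\gamma_0$; removing it from `E` keeps $\Psi^{-1}(E)$ inside `N`.
  let C : Set (Traceless n) := psiH α '' ({X : Herm c n | Herm.spec X = vec β} \ N)
  have hC : IsClosed C :=
    (((isCompact_spec_eq (vec β)).diff hN).image (continuous_psiH α)).isClosed
  have hcont : Continuous fun γ : Traceless n => toEuclidean ((vec β, γ) : (Fin n → ℝ) × Traceless n) :=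
    toEuclidean.continuous.comp (by fun_prop)
  have hcd : ContDiff ℝ ∞ fun γ : Traceless n => toEuclidean ((vec β, γ) : (Fin n → ℝ) × Traceless n) :=
    toEuclidean.contDiff.comp (contDiff_const.prodMk contDiff_id)
  let E : Set (Traceless n) := {γ | toEuclidean ((vec β, γ) : (Fin n → ℝ) × Traceless n) ∈ R} ∩ Cᶜ
  have hmemN : ∀ Y : Herm c n, Herm.spec Y = vec β → psiH α Y ∈ E → Y ∈ N := by
    intro Y hY hYE
    by_contra h
    exact hYE.2 ⟨Y, ⟨hY, h⟩, rfl⟩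
  have hS : ∀ B : c.Mat n, B ∈ orbit c β ∧ Psi c α B ∈ E →
      ∃ Y : Herm c n, Y ∈ N ∧ Herm.spec Y = vec β ∧ psiH α Y ∈ E ∧ Y.mat = B := by
    rintro B ⟨hB, hBE⟩
    obtain ⟨Y, hY, rfl⟩ := (mem_orbit_iff hβ').1 hB
    rw [Psi_mat α (sum_spec_of_eq hY)] at hBE
    exact ⟨Y, hmemN Y hY hBE, hY, hBE, rfl⟩
  have hF : ∀ p ∈ fiber c α β γ₀ ×ˢ E, ∃ X ∈ fiberH c α β γ₀, X.mat = p.1 ∧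
      toEuclidean ((vec β, p.2) : (Fin n → ℝ) × Traceless n) ∈ R := by
    rintro ⟨B, γ⟩ ⟨hB, hγ⟩
    obtain ⟨X, hX, h⟩ := (mem_fiber_iff hβ').1 hB
    exact ⟨X, hX, h, hγ.1⟩
  refine ⟨{
    E := E
    isOpen_E := (hR.preimage hcont).inter hC.isOpen_compl
    mem_E := ⟨h₀R, ?_⟩
    toFun := fun p => matL c n (f (ofMatL c n p.1, toEuclidean (vec β, p.2)))
    invFun := fun B => (matL c n (g (ofMatL c n B)), psiH α (ofMatL c n B))
    isDiffeo := ⟨?_, ?_, ?_, ?_, ?_, ?_⟩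
    psi_toFun := ?_ }⟩
  · rintro ⟨X, ⟨hX, hXN⟩, h⟩
    exact hXN (hFN ⟨hX, h⟩)
  · intro p hp
    obtain ⟨X, hX, hXp, hR⟩ := hF p hp
    obtain ⟨h1, h2, h3⟩ := hfg X hX _ hR
    rw [levelMapE_eq_iff] at h2
    simp only [← hXp, ofMatL_mat, matL_apply]
    refine ⟨(mat_mem_orbit_iff hβ').2 h2.1, ?_⟩
    rw [Psi_mat α (sum_spec_of_eq h2.1), h2.2]
    exact hp.2
  · intro B hB
    obtain ⟨Y, hYN, hY, hYE, rfl⟩ := hS B hB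
    obtain ⟨-, -, h1, -⟩ := hgf Y hYN
    simp only [ofMatL_mat, matL_apply]
    exact ⟨(mat_mem_fiber_iff hβ').2 (levelMapE_eq_iff.1 h1), hYE⟩
  · intro p hp
    obtain ⟨X, hX, hXp, hR⟩ := hF p hp
    obtain ⟨h1, h2, h3⟩ := hfg X hX _ hR
    rw [levelMapE_eq_iff] at h2
    simp only [← hXp, ofMatL_mat, matL_apply, h2.2, h3]
    exact Prod.ext hXp rfl
  · intro B hB
    obtain ⟨Y, hYN, hY, hYE, rfl⟩ := hS B hB
    obtain ⟨-, -, -, h1⟩ := hgf Y hYN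
    rw [levelMapE, levelMap, hY] at h1
    simp only [ofMatL_mat, matL_apply, h1]
  · refine (matL c n).contDiff.comp_contDiffOn (hf.comp ?_ ?_)
    · exact ((ofMatL c n).contDiff.comp contDiff_fst).contDiffOn.prodMk
        (hcd.comp contDiff_snd).contDiffOn
    · intro p hp
      obtain ⟨X, hX, hXp, hR⟩ := hF p hp
      refine ⟨?_, hR⟩
      simp only [← hXp, ofMatL_mat]
      exact hX
  · have h1 : MapsTo (ofMatL c n) {B | B ∈ orbit c β ∧ Psi c α B ∈ E} N := by
      intro B hB
      obtain ⟨Y, hYN, -, -, rfl⟩ := hS B hB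
      rwa [ofMatL_mat]
    have h2 : ContDiffOn ℝ ∞ (psiH α) N := fun Y hY =>
      (contDiffAt_psiH (hgf Y hY).1).contDiffWithinAt
    exact ((matL c n).contDiff.comp_contDiffOn
      (hg.comp (ofMatL c n).contDiff.contDiffOn h1)).prodMk
      (h2.comp (ofMatL c n).contDiff.contDiffOn h1)
  · intro B hB γ hγ
    obtain ⟨X, hX, hXp, hR⟩ := hF (B, γ) ⟨hB, hγ⟩
    obtain ⟨h1, h2, h3⟩ := hfg X hX _ hR
    rw [levelMapE_eq_iff] at h2
    simp only at hXp
    simp only [← hXp, ofMatL_mat, matL_apply]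
    rw [Psi_mat α (sum_spec_of_eq h2.1), h2.2]

/-- Level set charts exist around each point and compactness of the fiber selects finitely many. For
an empty fiber the family is empty. -/
theorem nonempty_fiberAtlas (hn : 0 < n) (hβ : StrictAnti (vec β))
    (hreg : IsRegularValue c α β γ₀) : Nonempty (FiberAtlas c α β γ₀) := by
  classical
  have hβ' : β ∈ chamber n := hβ.antitone
  have hdim : c.fiberDim n + Module.finrank ℝ
      (EuclideanSpace ℝ (Fin (Module.finrank ℝ ((Fin n → ℝ) × Traceless n)))) =
      Module.finrank ℝ (Herm c n) := by
    rw [finrank_euclideanSpace_fin, Module.finrank_prod, Module.finrank_fin_fun,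
      finrank_traceless hn, Herm.finrank_eq, ← fiberDim_add]
    omega
  have hch : ∀ X ∈ fiberH c α β γ₀, _ := fun X hX => exists_levelSet_chart isOpen_regularSet
    contDiffOn_levelMapE (fiberH_subset_of_regular hβ hreg hX)
    (surjective_fderiv_levelMapE hβ hreg hX) hdim
  choose! O D f A hO hXO hOU hD hf himg hA using hch
  obtain ⟨t, htF, hcov⟩ := isCompact_fiberH.elim_nhds_subcover O
    fun X hX => (hO X hX).mem_nhds (hXO X hX)
  let pt : Fin t.card → Herm c n := fun i => (t.equivFin.symm i).1
  have hpt : ∀ i, pt i ∈ fiberH c α β γ₀ := fun i => htF _ (t.equivFin.symm i).2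
  have himg' : ∀ i, f (pt i) '' D (pt i) = {Y ∈ O (pt i) | Y ∈ fiberH c α β γ₀} := by
    intro i
    rw [himg _ (hpt i)]
    ext Y
    simp only [mem_ofPred_eq]
    rw [levelMapE_eq_iff.2 (hpt i), levelMapE_eq_iff]
    rfl
  -- The weights need only be measurable, so normalized indicators of the charts suffice.
  let ind : Fin t.card → c.Mat n → ℝ := fun i => (ofMatL c n ⁻¹' O (pt i)).indicator 1
  have hind0 : ∀ i B, 0 ≤ ind i B := fun i B => indicator_nonneg (fun _ _ => zero_le_one) B
  have hindm : ∀ i, Measurable (ind i) := fun i =>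
    measurable_one.indicator (((hO _ (hpt i)).preimage (ofMatL c n).continuous).measurableSet)
  refine ⟨{
    k := t.card
    domain := fun i => D (pt i)
    isOpen_domain := fun i => hD _ (hpt i)
    param := fun i z => matL c n (f (pt i) z)
    coord := fun i B => A (pt i) (ofMatL c n B)
    isDiffeo := fun i => ⟨fun z hz => ⟨z, hz, rfl⟩, ?_, ?_, ?_, ?_, ?_⟩
    isOpen_image := fun i => ⟨ofMatL c n ⁻¹' O (pt i),
      (hO _ (hpt i)).preimage (ofMatL c n).continuous, ?_⟩
    weight := fun i B => ind i B / ∑ j, ind j B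
    measurable_weight := fun i => (hindm i).div (Finset.measurable_sum _ fun j _ => hindm j)
    weight_nonneg := fun i B => div_nonneg (hind0 i B) (Finset.sum_nonneg fun j _ => hind0 j B)
    weight_eq_zero := ?_
    sum_weight := ?_ }⟩
  · rintro _ ⟨z, hz, rfl⟩
    simp only [matL_apply, ofMatL_mat]
    rwa [hA _ (hpt i) hz]
  · intro z hz
    simp only [matL_apply, ofMatL_mat]
    exact hA _ (hpt i) hz
  · rintro _ ⟨z, hz, rfl⟩
    simp only [matL_apply, ofMatL_mat]
    rw [hA _ (hpt i) hz]
  · exact (matL c n).contDiff.comp_contDiffOn (hf _ (hpt i))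
  · exact ((A (pt i)).contDiff.comp (ofMatL c n).contDiff).contDiffOn
  · ext B
    constructor
    · rintro ⟨z, hz, rfl⟩
      have h1 : f (pt i) z ∈ f (pt i) '' D (pt i) := ⟨z, hz, rfl⟩
      rw [himg'] at h1
      exact ⟨by simp only [mem_preimage, matL_apply, ofMatL_mat]; exact h1.1,
        (mat_mem_fiber_iff hβ').2 h1.2⟩
    · rintro ⟨hB, hBF⟩
      obtain ⟨Y, hY, rfl⟩ := (mem_fiber_iff hβ').1 hBF
      rw [mem_preimage, ofMatL_mat] at hB
      have h1 : Y ∈ f (pt i) '' D (pt i) := by rw [himg']; exact ⟨hB, hY⟩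
      obtain ⟨z, hz, rfl⟩ := h1
      exact ⟨z, hz, rfl⟩
  · intro i B hB hBi
    obtain ⟨Y, hY, rfl⟩ := (mem_fiber_iff hβ').1 hB
    have h1 : ind i Y.mat = 0 := by
      refine indicator_of_notMem (fun h => hBi ?_) _
      rw [mem_preimage, ofMatL_mat] at h
      have h1 : Y ∈ f (pt i) '' D (pt i) := by rw [himg']; exact ⟨h, hY⟩
      obtain ⟨z, hz, rfl⟩ := h1
      exact ⟨z, hz, rfl⟩
    rw [h1, zero_div]
  · intro B hB
    obtain ⟨Y, hY, rfl⟩ := (mem_fiber_iff hβ').1 hB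
    rw [← Finset.sum_div, div_self]
    obtain ⟨X, hX, hYX⟩ := mem_iUnion₂.1 (hcov hY)
    have h1 : ind (t.equivFin ⟨X, hX⟩) Y.mat = 1 := by
      refine indicator_of_mem ?_ _
      rw [mem_preimage, ofMatL_mat]
      simpa [pt] using hYX
    refine (lt_of_lt_of_le zero_lt_one ?_).ne'
    rw [← h1]
    exact Finset.single_le_sum (f := fun j => ind j Y.mat) (fun j _ => hind0 j _)
      (Finset.mem_univ _)

end Horn

namespace Horn

open SelfAdjointCase

variable {c : SelfAdjointCase} {n : ℕ} {α β γ₀ : Traceless n}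

/-! ### The Horn measure as an image of the orbital measure -/

instance (c : SelfAdjointCase) (n : ℕ) : SecondCountableTopology (c.Mat n) :=
  inferInstanceAs (SecondCountableTopology (Fin n → Fin n → c.K))

theorem orbitalMeasure_eq (x : Traceless n) :
    orbitalMeasure c x = (orbMeas c (vec x)).map fun X : Herm c n => X.mat := by
  rw [orbMeas, Measure.map_map Herm.continuous_mat.measurable (continuous_Ad_G _).measurable]
  rfl

variable (c n) in
/-- The traceless self-adjoint matrices. -/
def tracelessMat : Set (c.Mat n) :=
  {C | (ofMatL c n C).mat = C ∧ ∑ i, Herm.diagPart (ofMatL c n C) i = 0}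

theorem isClosed_tracelessMat : IsClosed (tracelessMat c n) := by
  have h1 : Continuous (Herm.diagPart : Herm c n → Fin n → ℝ) :=
    LinearMap.continuous_of_finiteDimensional _
  refine (isClosed_eq (Herm.continuous_mat.comp (ofMatL c n).continuous) continuous_id).inter
    (isClosed_eq ?_ continuous_const)
  exact continuous_finsetSum _ fun i _ => (continuous_apply i).comp
    (h1.comp (ofMatL c n).continuous)

-- Replaces the choice in `sortedSpectrum` by a continuous function on a closed set, which makes it
-- measurable.
open Classical in
theorem sortedSpectrum_eq (C : c.Mat n) : sortedSpectrum c C =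
    if C ∈ tracelessMat c n then tproj (Herm.spec (ofMatL c n C)) else 0 := by
  split_ifs with h
  · apply vec_injective
    have h1 : ∑ i, Herm.spec (ofMatL c n C) i = 0 := by rw [sum_spec, h.2]
    rw [vec_tproj h1, ← vec_sortedSpectrum_mat h1, h.1]
  · rw [sortedSpectrum, dif_neg]
    rintro ⟨x, hx, u, rfl⟩
    refine h ?_
    rw [conj_eq]
    refine ⟨by rw [ofMatL_mat], ?_⟩
    rw [ofMatL_mat, ← sum_spec, Herm.spec_Ad_diagonal _ (mem_chamber.1 hx)]
    exact sum_vec x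

theorem measurable_sortedSpectrum : Measurable (sortedSpectrum c : c.Mat n → Traceless n) := by
  classical
  rw [funext (sortedSpectrum_eq (c := c) (n := n))]
  refine Measurable.ite isClosed_tracelessMat.measurableSet ?_ measurable_const
  exact (tproj.continuous.comp (Herm.continuous_spec.comp (ofMatL c n).continuous)).measurable

theorem ae_spec_orbMeas {x : Fin n → ℝ} (hx : Antitone x) :
    ∀ᵐ X ∂orbMeas c x, Herm.spec X = x := by
  rw [orbMeas, ae_map_iff (continuous_Ad_G _).aemeasurable
    (isClosed_eq Herm.continuous_spec continuous_const).measurableSet]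
  exact Eventually.of_forall fun g => Herm.spec_Ad_diagonal _ hx

/-- For $A=g\alpha g^{-1}$, left invariance of Haar measure replaces $B$ by $gBg^{-1}$. The spectrum
of the sum is then that of $\alpha+B$, so the integral over $A$ is of a constant. -/
theorem lintegral_hornMeasure (hβ : β ∈ chamber n) {f : Traceless n → ENNReal}
    (hf : Measurable f) :
    ∫⁻ γ, f γ ∂hornMeasure c α β = ∫⁻ X, f (psiH α X) ∂orbMeas c (vec β) := by
  have hs := measurable_sortedSpectrum (c := c) (n := n)
  have hadd : Measurable fun p : c.Mat n × c.Mat n => p.1 + p.2 :=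
    (continuous_fst.add continuous_snd).measurable
  have hm : Measurable fun X : Herm c n => X.mat := Herm.continuous_mat.measurable
  have : IsProbabilityMeasure (orbitalMeasure c β) := by
    rw [orbitalMeasure_eq]; exact Measure.isProbabilityMeasure_map hm.aemeasurable
  have hfp : Measurable fun p : c.Mat n × c.Mat n => f (sortedSpectrum c (p.1 + p.2)) :=
    hf.comp (hs.comp hadd)
  have hsp : Measurable fun p : c.Mat n × c.Mat n => sortedSpectrum c (p.1 + p.2) := hs.comp hadd
  have key : ∀ g : c.G n, ∫⁻ B, f (sortedSpectrum c (conj c g α + B)) ∂orbitalMeasure c β =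
      ∫⁻ X, f (psiH α X) ∂orbMeas c (vec β) := by
    intro g
    have hg : Measurable fun B : c.Mat n => f (sortedSpectrum c (conj c g α + B)) :=
      hf.comp (hs.comp (continuous_const.add continuous_id).measurable)
    have hgm : Measurable fun X : Herm c n => f (sortedSpectrum c (conj c g α + X.mat)) :=
      hg.comp hm
    have hfm : Measurable fun X : Herm c n => f (psiH α X) :=
      hf.comp (continuous_psiH α).measurable
    rw [orbitalMeasure_eq, lintegral_map hg hm, orbMeas,
      lintegral_map hgm (continuous_Ad_G _).measurable,
      lintegral_map hfm (continuous_Ad_G _).measurable,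
      ← lintegral_mul_left_eq_self _ g]
    refine lintegral_congr fun h => ?_
    congr 1
    have h1 : ∑ i, Herm.spec (Herm.Ad (h : unitary (c.Mat n)) (Herm.diagonal (vec β))) i = 0 :=
      sum_spec_of_eq (Herm.spec_Ad_diagonal _ (mem_chamber.1 hβ))
    have h2 : Herm.spec (Herm.Ad (g : unitary (c.Mat n)) (Herm.diagonal (vec α)) +
        Herm.Ad ((g * h : c.G n) : unitary (c.Mat n)) (Herm.diagonal (vec β)) : Herm c n) =
        Herm.spec (Herm.diagonal (vec α) +
          Herm.Ad (h : unitary (c.Mat n)) (Herm.diagonal (vec β))) := by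
      rw [Subgroup.coe_mul, Herm.Ad_mul, ← map_add, Herm.spec_Ad]
    apply vec_injective
    rw [vec_psiH α h1, conj_eq, ← map_add, vec_sortedSpectrum_mat, h2]
    rw [h2]
    exact sum_spec_diagonal_add α h1
  have hcj : Measurable fun g : c.G n => conj c (g : unitary (c.Mat n)) α :=
    (Herm.continuous_mat.comp (continuous_Ad_G (Herm.diagonal (vec α)))).measurable
  rw [hornMeasure, lintegral_map hf hsp, lintegral_prod _ hfp.aemeasurable]
  conv_lhs => rw [orbitalMeasure, lintegral_map hfp.lintegral_prod_right' hcj]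
  simp only [key]
  simp

end Horn

namespace Horn

open SelfAdjointCase

variable {c : SelfAdjointCase} {n : ℕ} {α β γ₀ : Traceless n}

/-! ### The coordinates `(z, γ)` -/

attribute [local instance] Matrix.normedAddCommGroup Matrix.normedSpace

theorem param_mem_fiber (A : FiberAtlas c α β γ₀) {i : Fin A.k}
    {z : EuclideanSpace ℝ (Fin (c.fiberDim n))} (hz : z ∈ A.domain i) :
    A.param i z ∈ fiber c α β γ₀ := by
  obtain ⟨V, -, hV⟩ := A.isOpen_image i
  have h : A.param i z ∈ A.param i '' A.domain i := mem_image_of_mem _ hz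
  rw [hV] at h
  exact h.2

variable (T : FiberTrivialization c α β γ₀) (A : FiberAtlas c α β γ₀) (i : Fin A.k)

/-- The range of the coordinates `(z, γ)`. -/
def coordDomain : Set (EuclideanSpace ℝ (Fin (c.fiberDim n)) × Traceless n) :=
  A.domain i ×ˢ T.E

/-- The coordinate system `(z, γ)`, in the space of self-adjoint matrices. -/
def coordMapH (p : EuclideanSpace ℝ (Fin (c.fiberDim n)) × Traceless n) : Herm c n :=
  ofMatL c n (coordMap T A i p)

theorem isOpen_coordDomain : IsOpen (coordDomain T A i) :=
  (A.isOpen_domain i).prod T.isOpen_E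

variable {T A i} {p : EuclideanSpace ℝ (Fin (c.fiberDim n)) × Traceless n}

theorem pair_mem (hp : p ∈ coordDomain T A i) :
    (A.param i p.1, p.2) ∈ fiber c α β γ₀ ×ˢ T.E :=
  ⟨param_mem_fiber A hp.1, hp.2⟩

theorem coordMap_mem (hp : p ∈ coordDomain T A i) :
    coordMap T A i p ∈ {B | B ∈ orbit c β ∧ Psi c α B ∈ T.E} :=
  T.isDiffeo.mapsTo (pair_mem hp)

theorem Psi_coordMap (hp : p ∈ coordDomain T A i) : Psi c α (coordMap T A i p) = p.2 :=
  T.psi_toFun _ (param_mem_fiber A hp.1) _ hp.2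

theorem invFun_coordMap (hp : p ∈ coordDomain T A i) :
    T.invFun (coordMap T A i p) = (A.param i p.1, p.2) :=
  T.isDiffeo.leftInv (pair_mem hp)

theorem coord_param {z : EuclideanSpace ℝ (Fin (c.fiberDim n))} (hz : z ∈ A.domain i) :
    A.coord i (A.param i z) = z :=
  (A.isDiffeo i).leftInv hz

theorem injOn_coordMap : InjOn (coordMap T A i) (coordDomain T A i) := by
  intro p hp q hq h
  have h1 := congrArg T.invFun h
  rw [invFun_coordMap hp, invFun_coordMap hq, Prod.mk_inj] at h1
  refine Prod.ext ?_ h1.2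
  rw [← coord_param hp.1, ← coord_param hq.1, h1.1]

theorem contDiffOn_coordMap : ContDiffOn ℝ ∞ (coordMap T A i) (coordDomain T A i) :=
  T.isDiffeo.smooth.comp
    (f := fun p : EuclideanSpace ℝ (Fin (c.fiberDim n)) × Traceless n => (A.param i p.1, p.2))
    (((A.isDiffeo i).smooth.comp contDiffOn_fst fun _ hp => hp.1).prodMk contDiffOn_snd)
    fun _ hp => pair_mem hp

theorem contDiffOn_coordMapH : ContDiffOn ℝ ∞ (coordMapH T A i) (coordDomain T A i) :=
  (ofMatL c n).contDiff.comp_contDiffOn contDiffOn_coordMap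

theorem mat_ofMatL (hβ : β ∈ chamber n) {B : c.Mat n} (hB : B ∈ orbit c β) :
    (ofMatL c n B).mat = B := by
  obtain ⟨X, -, rfl⟩ := (mem_orbit_iff hβ).1 hB
  rw [ofMatL_mat]

theorem mat_coordMapH (hβ : β ∈ chamber n) (hp : p ∈ coordDomain T A i) :
    (coordMapH T A i p).mat = coordMap T A i p :=
  mat_ofMatL hβ (coordMap_mem hp).1

theorem spec_coordMapH (hβ : β ∈ chamber n) (hp : p ∈ coordDomain T A i) :
    Herm.spec (coordMapH T A i p) = vec β := by
  rw [← mat_mem_orbit_iff hβ, mat_coordMapH hβ hp]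
  exact (coordMap_mem hp).1

theorem psiH_coordMapH (hβ : β ∈ chamber n) (hp : p ∈ coordDomain T A i) :
    psiH α (coordMapH T A i p) = p.2 := by
  rw [← Psi_mat α (sum_spec_of_eq (spec_coordMapH hβ hp)), mat_coordMapH hβ hp, Psi_coordMap hp]

theorem injOn_coordMapH (hβ : β ∈ chamber n) :
    InjOn (coordMapH T A i) (coordDomain T A i) := by
  intro p hp q hq h
  refine injOn_coordMap hp hq ?_
  rw [← mat_coordMapH hβ hp, ← mat_coordMapH hβ hq, h]

theorem fderiv_coordMap (hβ : β ∈ chamber n) (hp : p ∈ coordDomain T A i)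
    (v : EuclideanSpace ℝ (Fin (c.fiberDim n)) × Traceless n) :
    fderiv ℝ (coordMap T A i) p v = (fderiv ℝ (coordMapH T A i) p v).mat := by
  have hU : coordDomain T A i ∈ 𝓝 p := (isOpen_coordDomain T A i).mem_nhds hp
  have h1 : HasFDerivAt (coordMapH T A i) (fderiv ℝ (coordMapH T A i) p) p :=
    ((contDiffOn_coordMapH.contDiffAt hU).differentiableAt (by simp)).hasFDerivAt
  have h2 : HasFDerivAt (coordMap T A i) (matL c n ∘L fderiv ℝ (coordMapH T A i) p) p := by
    refine ((matL c n).hasFDerivAt.comp p h1).congr_of_eventuallyEq ?_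
    filter_upwards [hU] with q hq
    exact (mat_coordMapH hβ hq).symm
  rw [h2.fderiv]
  rfl

/-- The orbit lies in the self-adjoint matrices, where the trace form is the inner product. -/
theorem metricDet_eq (hβ : β ∈ chamber n) (hp : p ∈ coordDomain T A i) :
    metricDet T A i p.1 p.2 =
      gramDet fun a => fderiv ℝ (coordMapH T A i) p (coordDir (c.fiberDim n) n a) := by
  rw [metricDet, gramDet]
  congr 1
  ext a b
  rw [Matrix.of_apply, Matrix.of_apply, fderiv_coordMap hβ hp, fderiv_coordMap hβ hp,
    Herm.inner_eq]

theorem continuousOn_metricDet (hβ : β ∈ chamber n) :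
    ContinuousOn (fun p : EuclideanSpace ℝ (Fin (c.fiberDim n)) × Traceless n =>
      metricDet T A i p.1 p.2) (coordDomain T A i) := by
  have h1 := contDiffOn_coordMapH (T := T) (A := A) (i := i).continuousOn_fderiv_of_isOpen
    (isOpen_coordDomain T A i) (by simp)
  refine ContinuousOn.congr (f := fun p => gramDet fun a =>
    fderiv ℝ (coordMapH T A i) p (coordDir (c.fiberDim n) n a)) ?_
    fun p hp => metricDet_eq hβ hp
  have h2 : ∀ a, ContinuousOn (fun p => fderiv ℝ (coordMapH T A i) p
      (coordDir (c.fiberDim n) n a)) (coordDomain T A i) :=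
    fun a => h1.clm_apply continuousOn_const
  rw [continuousOn_iff_continuous_domRestrict] at h1 ⊢
  simp only [continuousOn_iff_continuous_domRestrict] at h2
  refine Continuous.matrix_det (continuous_matrix fun a b => ?_)
  exact (h2 a).inner (h2 b)

/-- The basis of coordinate directions. -/
def coordBasis (m n : ℕ) : Module.Basis (Fin m ⊕ Fin (Module.finrank ℝ (Traceless n))) ℝ
    (EuclideanSpace ℝ (Fin m) × Traceless n) :=
  (EuclideanSpace.basisFun (Fin m) ℝ).toBasis.prod (stdOrthonormalBasis ℝ (Traceless n)).toBasis

theorem coordBasis_apply (m n : ℕ) (a) : coordBasis m n a = coordDir m n a := by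
  rcases a with a | a <;> simp [coordBasis, coordDir]

theorem addHaar_coordBasis (m n : ℕ) : (coordBasis m n).addHaar = volume := by
  rw [coordBasis, Module.Basis.prod_addHaar, OrthonormalBasis.addHaar_eq_volume,
    OrthonormalBasis.addHaar_eq_volume]
  rfl

theorem card_coordBasis (hn : 0 < n) :
    Fintype.card (Fin (c.fiberDim n) ⊕ Fin (Module.finrank ℝ (Traceless n))) =
      c.scalarDim * (n * (n - 1) / 2) := by
  rw [Fintype.card_sum, Fintype.card_fin, Fintype.card_fin, finrank_traceless hn, fiberDim_add]

end Horn

namespace Horn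

open SelfAdjointCase

variable {c : SelfAdjointCase} {n : ℕ} {α β γ₀ : Traceless n}

/-! ### Integration along the fibers -/

attribute [local instance] Matrix.normedAddCommGroup Matrix.normedSpace

/-- `Ψ⁻¹(E)`, in the space of self-adjoint matrices. -/
def preimageH (T : FiberTrivialization c α β γ₀) : Set (Herm c n) :=
  {X | Herm.spec X = vec β ∧ psiH α X ∈ T.E}

open Classical in
/-- The partition of unity on the fiber over `γ₀`, extended to `Ψ⁻¹(E)`. -/
def weightH (T : FiberTrivialization c α β γ₀) (A : FiberAtlas c α β γ₀) (i : Fin A.k)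
    (X : Herm c n) : ENNReal :=
  if X ∈ preimageH T then ENNReal.ofReal (A.weight i (T.invFun X.mat).1) else 0

/-- The fiber integral, as a Lebesgue integral of a nonnegative function. -/
def fiberLIntegral (T : FiberTrivialization c α β γ₀) (A : FiberAtlas c α β γ₀)
    (γ : Traceless n) : ENNReal :=
  ∑ i, ∫⁻ z in A.domain i, ENNReal.ofReal (fiberIntegrand T A γ i z)

variable {T : FiberTrivialization c α β γ₀} {A : FiberAtlas c α β γ₀} {i : Fin A.k}

theorem measurableSet_preimageH : MeasurableSet (preimageH T) :=
  (isClosed_eq Herm.continuous_spec continuous_const).measurableSet.inter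
    (T.isOpen_E.preimage (continuous_psiH α)).measurableSet

theorem mat_mem_preimage_iff (hβ : β ∈ chamber n) {X : Herm c n} :
    X.mat ∈ {B | B ∈ orbit c β ∧ Psi c α B ∈ T.E} ↔ X ∈ preimageH T := by
  change X.mat ∈ orbit c β ∧ _ ↔ _ ∧ _
  rw [mat_mem_orbit_iff hβ]
  refine and_congr_right fun h => ?_
  rw [Psi_mat α (sum_spec_of_eq h)]

theorem invFun_mem (hβ : β ∈ chamber n) {X : Herm c n} (hX : X ∈ preimageH T) :
    (T.invFun X.mat).1 ∈ fiber c α β γ₀ :=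
  (T.isDiffeo.mapsTo_inv ((mat_mem_preimage_iff hβ).2 hX)).1

theorem measurable_weightH (hβ : β ∈ chamber n) : Measurable (weightH T A i) := by
  classical
  have h1 : ContinuousOn (fun X : Herm c n => (T.invFun X.mat).1) (preimageH T) :=
    continuous_fst.comp_continuousOn (T.isDiffeo.smooth_inv.continuousOn.comp
      Herm.continuous_mat.continuousOn fun X hX => (mat_mem_preimage_iff hβ).2 hX)
  have h2 : Measurable ((preimageH T).piecewise (fun X : Herm c n => (T.invFun X.mat).1)
      fun _ => 0) :=
    h1.measurable_piecewise continuousOn_const measurableSet_preimageH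
  have h3 : weightH T A i = (preimageH T).indicator fun X => ENNReal.ofReal (A.weight i
      ((preimageH T).piecewise (fun X : Herm c n => (T.invFun X.mat).1) (fun _ => 0) X)) := by
    ext X
    by_cases hX : X ∈ preimageH T <;> simp [weightH, hX]
  rw [h3]
  exact (ENNReal.measurable_ofReal.comp ((A.measurable_weight i).comp h2)).indicator
    measurableSet_preimageH

theorem sum_weightH (hβ : β ∈ chamber n) {X : Herm c n} (hX : X ∈ preimageH T) :
    ∑ i, weightH T A i X = 1 := by
  simp only [weightH, if_pos hX]
  rw [← ENNReal.ofReal_sum_of_nonneg fun i _ => A.weight_nonneg i _,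
    A.sum_weight _ (invFun_mem hβ hX), ENNReal.ofReal_one]

theorem coordMapH_mem (hβ : β ∈ chamber n)
    {p : EuclideanSpace ℝ (Fin (c.fiberDim n)) × Traceless n} (hp : p ∈ coordDomain T A i) :
    coordMapH T A i p ∈ preimageH T := by
  rw [← mat_mem_preimage_iff hβ, mat_coordMapH hβ hp]
  exact coordMap_mem hp

theorem weightH_coordMapH (hβ : β ∈ chamber n)
    {p : EuclideanSpace ℝ (Fin (c.fiberDim n)) × Traceless n} (hp : p ∈ coordDomain T A i) :
    weightH T A i (coordMapH T A i p) = ENNReal.ofReal (A.weight i (A.param i p.1)) := by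
  rw [weightH, if_pos (coordMapH_mem hβ hp), mat_coordMapH hβ hp, invFun_coordMap hp]

/-- The trivialization carries the support of a weight from the fiber to nearby fibers, so each
weighted integral may be taken over a single coordinate patch. -/
theorem weightH_eq_zero (hβ : β ∈ chamber n) {X : Herm c n}
    (hX : X ∉ coordMapH T A i '' coordDomain T A i) : weightH T A i X = 0 := by
  rw [weightH]
  split_ifs with h
  · have h1 := (mat_mem_preimage_iff hβ).2 h
    rw [A.weight_eq_zero i _ (invFun_mem hβ h), ENNReal.ofReal_zero]
    rintro ⟨z, hz, hzX⟩
    have hp : (z, (T.invFun X.mat).2) ∈ coordDomain T A i :=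
      ⟨hz, (T.isDiffeo.mapsTo_inv h1).2⟩
    refine hX ⟨_, hp, ?_⟩
    rw [coordMapH, coordMap, hzX, Prod.mk.eta, T.isDiffeo.rightInv h1, ofMatL_mat]
  · rfl

theorem aemeasurable_fiberIntegrand (hβ : β ∈ chamber n) :
    AEMeasurable (fun p : EuclideanSpace ℝ (Fin (c.fiberDim n)) × Traceless n =>
      ENNReal.ofReal (fiberIntegrand T A p.2 i p.1)) (volume.restrict (coordDomain T A i)) := by
  have hU : MeasurableSet (coordDomain T A i) := (isOpen_coordDomain T A i).measurableSet
  refine ENNReal.measurable_ofReal.comp_aemeasurable (AEMeasurable.mul ?_ ?_)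
  · refine (A.measurable_weight i).comp_aemeasurable (ContinuousOn.aemeasurable ?_ hU)
    exact (A.isDiffeo i).smooth.continuousOn.comp continuousOn_fst fun _ hp => hp.1
  · exact (continuousOn_metricDet hβ).sqrt.aemeasurable hU

theorem aemeasurable_fiberIntegrand_right (hβ : β ∈ chamber n) {γ : Traceless n} (hγ : γ ∈ T.E) :
    AEMeasurable (fiberIntegrand T A γ i) (volume.restrict (A.domain i)) := by
  have hD : MeasurableSet (A.domain i) := (A.isOpen_domain i).measurableSet
  have h1 : ContinuousOn (fun z => √(metricDet T A i z γ)) (A.domain i) :=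
    (continuousOn_metricDet (T := T) (A := A) (i := i) hβ).sqrt.comp
      (f := fun z => (z, γ)) (Continuous.prodMk_left γ).continuousOn fun z hz => ⟨hz, hγ⟩
  refine AEMeasurable.mul ?_ (h1.aemeasurable hD)
  refine (A.measurable_weight i).comp_aemeasurable (ContinuousOn.aemeasurable ?_ hD)
  exact (A.isDiffeo i).smooth.continuousOn

theorem volume_restrict_coordDomain (T : FiberTrivialization c α β γ₀) (A : FiberAtlas c α β γ₀)
    (i : Fin A.k) :
    (volume : Measure (EuclideanSpace ℝ (Fin (c.fiberDim n)) × Traceless n)).restrict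
      (coordDomain T A i) = (volume.restrict (A.domain i)).prod (volume.restrict T.E) := by
  rw [Measure.prod_restrict]
  rfl

/-- Split the orbital integral by the partition of unity and apply `lintegral_orbMeas_image` in each
system $(z,\gamma)$. As $\Psi$ is the second coordinate, Tonelli's theorem isolates the integral
over $z$. -/
theorem lintegral_hornMeasure_restrict (hn : 0 < n) (hβ : StrictAnti (vec β))
    (T : FiberTrivialization c α β γ₀) (A : FiberAtlas c α β γ₀)
    {f : Traceless n → ENNReal} (hf : Measurable f) :
    ∫⁻ γ in T.E, f γ ∂hornMeasure c α β =
      ENNReal.ofReal (c.kappa n * vdm (vec β) ^ c.scalarDim)⁻¹ *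
        ∫⁻ γ in T.E, f γ * fiberLIntegral T A γ := by
  classical
  have hβ' : β ∈ chamber n := hβ.antitone
  have hE : MeasurableSet T.E := T.isOpen_E.measurableSet
  have hg : Measurable fun X : Herm c n => f (psiH α X) :=
    hf.comp (continuous_psiH α).measurable
  have hwg : ∀ i ∈ Finset.univ, Measurable fun X => weightH T A i X * f (psiH α X) :=
    fun i _ => (measurable_weightH hβ').mul hg
  have h1 : ∫⁻ γ in T.E, f γ ∂hornMeasure c α β =
      ∑ i, ∫⁻ X, weightH T A i X * f (psiH α X) ∂orbMeas c (vec β) := by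
    rw [← lintegral_indicator hE, lintegral_hornMeasure hβ' (hf.indicator hE),
      ← lintegral_finsetSum _ hwg]
    refine lintegral_congr_ae ?_
    filter_upwards [ae_spec_orbMeas (c := c) hβ.antitone] with X hX
    rw [← Finset.sum_mul]
    by_cases h : psiH α X ∈ T.E
    · rw [indicator_of_mem h, sum_weightH hβ' ⟨hX, h⟩, one_mul]
    · rw [indicator_of_notMem h, Finset.sum_eq_zero, zero_mul]
      intro i _
      rw [weightH, if_neg fun h' => h h'.2]
  have h2 : ∀ i, ∫⁻ X, weightH T A i X * f (psiH α X) ∂orbMeas c (vec β) =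
      ENNReal.ofReal (c.kappa n * vdm (vec β) ^ c.scalarDim)⁻¹ *
        ∫⁻ γ in T.E, f γ * ∫⁻ z in A.domain i, ENNReal.ofReal (fiberIntegrand T A γ i z) := by
    intro i
    have hU := isOpen_coordDomain T A i
    have hm := hwg i (Finset.mem_univ i)
    have himg : MeasurableSet (coordMapH T A i '' coordDomain T A i) :=
      hU.measurableSet.image_of_continuousOn_injOn contDiffOn_coordMapH.continuousOn
        (injOn_coordMapH hβ')
    have h3 : ∫⁻ X, weightH T A i X * f (psiH α X) ∂orbMeas c (vec β) =
        ∫⁻ X in coordMapH T A i '' coordDomain T A i, weightH T A i X * f (psiH α X)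
          ∂orbMeas c (vec β) := by
      rw [← lintegral_indicator himg]
      congr 1
      ext X
      by_cases hX : X ∈ coordMapH T A i '' coordDomain T A i
      · rw [indicator_of_mem hX]
      · rw [indicator_of_notMem hX, weightH_eq_zero hβ' hX, zero_mul]
    rw [h3, lintegral_orbMeas_image (coordBasis (c.fiberDim n) n) (card_coordBasis hn) hβ hU
      (contDiffOn_coordMapH.differentiableOn (by simp)) (injOn_coordMapH hβ')
      (fun p hp => spec_coordMapH hβ' hp) hm, addHaar_coordBasis]
    congr 1
    have h4 : ∫⁻ p in coordDomain T A i, ENNReal.ofReal √(gramDet fun a =>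
          fderiv ℝ (coordMapH T A i) p (coordBasis (c.fiberDim n) n a)) *
          (weightH T A i (coordMapH T A i p) * f (psiH α (coordMapH T A i p))) =
        ∫⁻ p in coordDomain T A i, f p.2 * ENNReal.ofReal (fiberIntegrand T A p.2 i p.1) := by
      refine setLIntegral_congr_fun hU.measurableSet fun p hp => ?_
      simp only [coordBasis_apply]
      rw [← metricDet_eq hβ' hp, weightH_coordMapH hβ' hp, psiH_coordMapH hβ' hp, fiberIntegrand,
        ENNReal.ofReal_mul (A.weight_nonneg i _)]
      ring
    have hvol := volume_restrict_coordDomain T A i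
    have hae := aemeasurable_fiberIntegrand (T := T) (A := A) (i := i) hβ'
    have hfe : AEMeasurable (fun p : EuclideanSpace ℝ (Fin (c.fiberDim n)) × Traceless n =>
        f p.2 * ENNReal.ofReal (fiberIntegrand T A p.2 i p.1))
        ((volume.restrict (A.domain i)).prod (volume.restrict T.E)) := by
      rw [← hvol]
      exact (hf.comp measurable_snd).aemeasurable.mul hae
    rw [h4, hvol, lintegral_prod_symm _ hfe]
    refine setLIntegral_congr_fun hE fun γ hγ => ?_
    exact lintegral_const_mul'' (f γ) (f := fun z => ENNReal.ofReal (fiberIntegrand T A γ i z))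
      (aemeasurable_fiberIntegrand_right hβ' hγ).ennreal_ofReal
  rw [h1, Finset.sum_congr rfl fun i _ => h2 i, ← Finset.mul_sum, ← lintegral_finsetSum' _ ?_]
  · simp only [fiberLIntegral, Finset.mul_sum]
  · intro i _
    have hae := aemeasurable_fiberIntegrand (T := T) (A := A) (i := i) hβ'
    have hvol := volume_restrict_coordDomain T A i
    rw [hvol] at hae
    exact hf.aemeasurable.mul hae.lintegral_prod_left'

end Horn

namespace Horn

open SelfAdjointCase

variable {c : SelfAdjointCase} {n : ℕ} {α β γ₀ : Traceless n}

/-! ### Dependence of the metric determinant on `γ` -/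

theorem gramDet_basis_comp {ι V P : Type*} [Fintype ι] [DecidableEq ι] [NormedAddCommGroup V]
    [InnerProductSpace ℝ V] [AddCommGroup P] [Module ℝ P] (b : Module.Basis ι ℝ P)
    (L : P →ₗ[ℝ] V) (M : P →ₗ[ℝ] P) :
    gramDet (fun a => L (M (b a))) = LinearMap.det M ^ 2 * gramDet fun a => L (b a) := by
  have h : (Matrix.of fun i j => inner ℝ (L (M (b i))) (L (M (b j))) : Matrix ι ι ℝ) =
      (LinearMap.toMatrix b b M).transpose *
        (Matrix.of fun i j => inner ℝ (L (b i)) (L (b j))) * LinearMap.toMatrix b b M := by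
    have hM : ∀ a, L (M (b a)) = ∑ k, LinearMap.toMatrix b b M k a • L (b k) := fun a => by
      conv_lhs => rw [← b.sum_repr (M (b a)), map_sum]
      simp only [map_smul, LinearMap.toMatrix_apply]
    ext i j
    simp only [Matrix.of_apply, hM, sum_inner, inner_sum, inner_smul_left, inner_smul_right,
      Matrix.mul_apply, Matrix.transpose_apply, Finset.sum_mul, Finset.mul_sum, conj_trivial]
    refine Finset.sum_congr rfl fun k _ => Finset.sum_congr rfl fun l _ => ?_
    ring
  rw [gramDet, gramDet, h, Matrix.det_mul, Matrix.det_mul, Matrix.det_transpose,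
    LinearMap.det_toMatrix]
  ring

theorem gramDet_pos {ι V : Type*} [Fintype ι] [DecidableEq ι] [NormedAddCommGroup V]
    [InnerProductSpace ℝ V] {v : ι → V} (hv : LinearIndependent ℝ v) : 0 < gramDet v :=
  (Matrix.posDef_gram_of_linearIndependent (𝕜 := ℝ) hv).det_pos

theorem injective_fderiv_of_leftInvOn {P Y : Type*} [NormedAddCommGroup P] [NormedSpace ℝ P]
    [NormedAddCommGroup Y] [NormedSpace ℝ Y] {f : P → Y} {g : Y → P} {U : Set P} {S : Set Y} {p : P}
    (hU : U ∈ 𝓝 p) (hf : DifferentiableAt ℝ f p) (hg : DifferentiableWithinAt ℝ g S (f p))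
    (hm : MapsTo f U S) (hgf : LeftInvOn g f U) : Function.Injective (fderiv ℝ f p) := by
  have h1 := (hg.hasFDerivWithinAt.comp p hf.hasFDerivAt.hasFDerivWithinAt hm).hasFDerivAt hU
  have h2 : HasFDerivAt (fun q : P => q) _ p := h1.congr_of_eventuallyEq (by
    filter_upwards [hU] with q hq
    exact (hgf hq).symm)
  have h3 := h2.unique (hasFDerivAt_id p)
  intro v w h
  have h4 := DFunLike.congr_fun h3 v
  have h5 := DFunLike.congr_fun h3 w
  simp only [ContinuousLinearMap.comp_apply, ContinuousLinearMap.id_apply] at h4 h5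
  rw [← h4, ← h5, h]

attribute [local instance] Matrix.normedAddCommGroup Matrix.normedSpace

variable {T : FiberTrivialization c α β γ₀} {A : FiberAtlas c α β γ₀} {i j : Fin A.k}

theorem injective_fderiv_coordMap {p : EuclideanSpace ℝ (Fin (c.fiberDim n)) × Traceless n}
    (hp : p ∈ coordDomain T A i) : Function.Injective (fderiv ℝ (coordMap T A i) p) := by
  have hU : coordDomain T A i ∈ 𝓝 p := (isOpen_coordDomain T A i).mem_nhds hp
  refine injective_fderiv_of_leftInvOn (g := fun B => (A.coord i (T.invFun B).1, (T.invFun B).2))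
    (S := coordMap T A i '' coordDomain T A i) hU
    ((contDiffOn_coordMap.contDiffAt hU).differentiableAt (by simp)) ?_ (mapsTo_image _ _) ?_
  · have h1 : DifferentiableOn ℝ T.invFun (coordMap T A i '' coordDomain T A i) :=
      (T.isDiffeo.smooth_inv.differentiableOn (by simp)).mono
        (image_subset_iff.2 fun q hq => coordMap_mem hq)
    have h2 : DifferentiableOn ℝ (fun B => A.coord i (T.invFun B).1)
        (coordMap T A i '' coordDomain T A i) := by
      refine ((A.isDiffeo i).smooth_inv.differentiableOn (by simp)).comp h1.fst ?_
      rintro _ ⟨q, hq, rfl⟩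
      simp only [invFun_coordMap hq]
      exact mem_image_of_mem _ hq.1
    exact (h2.prodMk h1.snd) _ (mem_image_of_mem _ hp)
  · intro q hq
    simp only [invFun_coordMap hq, coord_param hq.1]

/-- The coordinates have a smooth inverse, so their directions are linearly independent. Positivity
is what permits a relative estimate. -/
theorem metricDet_pos (hβ : β ∈ chamber n)
    {p : EuclideanSpace ℝ (Fin (c.fiberDim n)) × Traceless n} (hp : p ∈ coordDomain T A i) :
    0 < metricDet T A i p.1 p.2 := by
  rw [metricDet_eq hβ hp]
  refine gramDet_pos ?_
  have h1 : Function.Injective (fderiv ℝ (coordMapH T A i) p) := by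
    intro v w h
    refine injective_fderiv_coordMap hp ?_
    rw [fderiv_coordMap hβ hp, fderiv_coordMap hβ hp, h]
  have h2 := (coordBasis (c.fiberDim n) n).linearIndependent.map'
    (fderiv ℝ (coordMapH T A i) p).toLinearMap (LinearMap.ker_eq_bot.2 h1)
  have h3 : (fun a => fderiv ℝ (coordMapH T A i) p (coordDir (c.fiberDim n) n a)) =
      (fderiv ℝ (coordMapH T A i) p).toLinearMap ∘ coordBasis (c.fiberDim n) n := by
    ext1 a
    simp [coordBasis_apply]
  rw [h3]
  exact h2

/-- Changing charts acts on $z$ only and leaves $\gamma$ fixed, so the squared Jacobian $J$ is the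
same for all $\gamma$. -/
theorem exists_metricDet_eq_mul (hβ : β ∈ chamber n) (T : FiberTrivialization c α β γ₀)
    {z : EuclideanSpace ℝ (Fin (c.fiberDim n))} (hz : z ∈ A.domain i)
    (hzj : A.param i z ∈ A.param j '' A.domain j) :
    ∃ J : ℝ, 0 ≤ J ∧ ∀ γ ∈ T.E,
      metricDet T A i z γ = J * metricDet T A j (A.coord j (A.param i z)) γ := by
  obtain ⟨V, hV, hVj⟩ := A.isOpen_image j
  let τ : EuclideanSpace ℝ (Fin (c.fiberDim n)) → EuclideanSpace ℝ (Fin (c.fiberDim n)) :=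
    fun w => A.coord j (A.param i w)
  let W := A.domain i ∩ A.param i ⁻¹' V
  have hW : IsOpen W :=
    (A.isDiffeo i).smooth.continuousOn.isOpen_inter_preimage (A.isOpen_domain i) hV
  have hWj : ∀ w ∈ W, A.param i w ∈ A.param j '' A.domain j := fun w hw => by
    rw [hVj]
    exact ⟨hw.2, param_mem_fiber A hw.1⟩
  have hzW : z ∈ W := by
    refine ⟨hz, ?_⟩
    rw [hVj] at hzj
    exact hzj.1
  have hτ : ContDiffOn ℝ ∞ τ W :=
    (A.isDiffeo j).smooth_inv.comp ((A.isDiffeo i).smooth.mono inter_subset_left) hWj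
  have hτd : HasFDerivAt τ (fderiv ℝ τ z) z :=
    ((hτ.contDiffAt (hW.mem_nhds hzW)).differentiableAt (by simp)).hasFDerivAt
  let M : (EuclideanSpace ℝ (Fin (c.fiberDim n)) × Traceless n) →L[ℝ]
      (EuclideanSpace ℝ (Fin (c.fiberDim n)) × Traceless n) :=
    (fderiv ℝ τ z).prodMap (ContinuousLinearMap.id ℝ _)
  have hτD : ∀ w ∈ W, τ w ∈ A.domain j := fun w hw => (A.isDiffeo j).mapsTo_inv (hWj w hw)
  refine ⟨LinearMap.det M.toLinearMap ^ 2, sq_nonneg _, fun γ hγ => ?_⟩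
  have hp : (z, γ) ∈ coordDomain T A i := ⟨hz, hγ⟩
  have hq : (τ z, γ) ∈ coordDomain T A j := ⟨hτD z hzW, hγ⟩
  have h1 : HasFDerivAt (coordMapH T A j) (fderiv ℝ (coordMapH T A j) (τ z, γ)) (τ z, γ) :=
    ((contDiffOn_coordMapH.contDiffAt
      ((isOpen_coordDomain T A j).mem_nhds hq)).differentiableAt (by simp)).hasFDerivAt
  have h2 : HasFDerivAt (Prod.map τ (id : Traceless n → Traceless n)) M (z, γ) :=
    HasFDerivAt.prodMap (p := (z, γ)) hτd (hasFDerivAt_id γ)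
  have h3 : HasFDerivAt (coordMapH T A i) (fderiv ℝ (coordMapH T A j) (τ z, γ) ∘L M) (z, γ) := by
    refine (HasFDerivAt.comp (z, γ) (g := coordMapH T A j) h1 h2).congr_of_eventuallyEq ?_
    filter_upwards [(hW.prod T.isOpen_E).mem_nhds (show (z, γ) ∈ W ×ˢ T.E from ⟨hzW, hγ⟩)]
      with q hq
    change ofMatL c n (T.toFun (A.param i q.1, q.2)) =
      ofMatL c n (T.toFun (A.param j (A.coord j (A.param i q.1)), q.2))
    rw [(A.isDiffeo j).rightInv (hWj _ hq.1)]
  have h4 := metricDet_eq hβ hp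
  have h5 := metricDet_eq hβ hq
  simp only at h4 h5
  rw [h4, h5, h3.fderiv]
  have h6 := gramDet_basis_comp (coordBasis (c.fiberDim n) n)
    (fderiv ℝ (coordMapH T A j) (τ z, γ)).toLinearMap M.toLinearMap
  simp only [coordBasis_apply] at h6
  exact h6

theorem exists_mem_image (A : FiberAtlas c α β γ₀) {B : c.Mat n} (hB : B ∈ fiber c α β γ₀) :
    ∃ j, B ∈ A.param j '' A.domain j := by
  by_contra! h
  have := A.sum_weight B hB
  rw [Finset.sum_eq_zero fun j _ => A.weight_eq_zero j B hB (h j)] at this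
  exact zero_ne_one this

/-- Coordinate domains are not compact, so continuity in one chart is not uniform. The relative
estimate is unaffected by a change of chart, by `exists_metricDet_eq_mul`; it can be proved near
each point of the fiber in one convenient chart, and compactness of the fiber makes it uniform. -/
theorem eventually_sqrt_metricDet (hβ : β ∈ chamber n) (T : FiberTrivialization c α β γ₀)
    (A : FiberAtlas c α β γ₀) {γ₁ : Traceless n} (hγ₁ : γ₁ ∈ T.E) {ε : ℝ} (hε : 0 < ε) :
    ∀ᶠ γ in 𝓝 γ₁, ∀ i, ∀ z ∈ A.domain i,
      |√(metricDet T A i z γ) - √(metricDet T A i z γ₁)| ≤ ε * √(metricDet T A i z γ₁) := by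
  -- Membership is repeated because the compactness principle asks for the claim at all nearby `X`;
  -- off the fiber it is now vacuous.
  have key : ∀ᶠ γ in 𝓝 γ₁, ∀ X ∈ fiberH c α β γ₀, X ∈ fiberH c α β γ₀ →
      ∀ i, ∀ z ∈ A.domain i, A.param i z = X.mat →
      |√(metricDet T A i z γ) - √(metricDet T A i z γ₁)| ≤ ε * √(metricDet T A i z γ₁) := by
    refine IsCompact.eventually_forall_of_forall_eventually isCompact_fiberH fun X hX => ?_
    obtain ⟨j, hj⟩ := exists_mem_image A ((mat_mem_fiber_iff hβ).2 hX)
    obtain ⟨V, hV, hVj⟩ := A.isOpen_image j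
    have hzX : A.coord j X.mat ∈ A.domain j := (A.isDiffeo j).mapsTo_inv hj
    have hU := isOpen_coordDomain T A j
    let s : EuclideanSpace ℝ (Fin (c.fiberDim n)) × Traceless n → ℝ :=
      fun p => √(metricDet T A j p.1 p.2)
    have hs : ContinuousOn s (coordDomain T A j) := (continuousOn_metricDet hβ).sqrt
    have hp₀ : (A.coord j X.mat, γ₁) ∈ coordDomain T A j := ⟨hzX, hγ₁⟩
    have hs1 : ContinuousAt s (A.coord j X.mat, γ₁) := hs.continuousAt (hU.mem_nhds hp₀)
    have hs2 : ContinuousAt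
        (fun p : EuclideanSpace ℝ (Fin (c.fiberDim n)) × Traceless n => s (p.1, γ₁))
        (A.coord j X.mat, γ₁) :=
      ContinuousAt.comp (g := s) hs1 (continuous_fst.prodMk continuous_const).continuousAt
    have hs3 : 0 < s (A.coord j X.mat, γ₁) := Real.sqrt_pos.2 (metricDet_pos hβ hp₀)
    have h1 : ∀ᶠ p : EuclideanSpace ℝ (Fin (c.fiberDim n)) × Traceless n in
        𝓝 (A.coord j X.mat, γ₁), |s p - s (p.1, γ₁)| < ε * s (p.1, γ₁) := by
      refine ContinuousAt.eventually_lt (hs1.sub hs2).abs (continuousAt_const.mul hs2) ?_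
      simpa using mul_pos hε hs3
    have hVX : ∀ᶠ Y in 𝓝[fiberH c α β γ₀] X, Herm.mat Y ∈ A.param j '' A.domain j := by
      have hXV : X.mat ∈ V := by rw [hVj] at hj; exact hj.1
      filter_upwards [self_mem_nhdsWithin, mem_nhdsWithin_of_mem_nhds
        ((hV.preimage Herm.continuous_mat).mem_nhds hXV)] with Y hY hYV
      rw [hVj]
      exact ⟨hYV, (mat_mem_fiber_iff hβ).2 hY⟩
    have hcoord : Tendsto (fun Y : Herm c n => A.coord j Y.mat)
        (𝓝[fiberH c α β γ₀] X) (𝓝 (A.coord j X.mat)) := by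
      have h2 : ContinuousWithinAt (A.coord j) (A.param j '' A.domain j) X.mat :=
        (A.isDiffeo j).smooth_inv.continuousOn X.mat hj
      have h3 : Tendsto (fun Y : Herm c n => Y.mat) (𝓝[fiberH c α β γ₀] X)
          (𝓝[A.param j '' A.domain j] X.mat) := by
        exact tendsto_nhdsWithin_iff.2
          ⟨Herm.continuous_mat.continuousAt.continuousWithinAt, hVX⟩
      exact h2.tendsto.comp h3
    have hE : ∀ᶠ γ in 𝓝 γ₁, γ ∈ T.E := T.isOpen_E.mem_nhds hγ₁
    have h2 : ∀ᶠ q : Traceless n × Herm c n in 𝓝 γ₁ ×ˢ 𝓝[fiberH c α β γ₀] X,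
        |s (A.coord j q.2.mat, q.1) - s (A.coord j q.2.mat, γ₁)| <
          ε * s (A.coord j q.2.mat, γ₁) := by
      have h3 : Tendsto (fun q : Traceless n × Herm c n => (A.coord j q.2.mat, q.1))
          (𝓝 γ₁ ×ˢ 𝓝[fiberH c α β γ₀] X) (𝓝 (A.coord j X.mat, γ₁)) :=
        (hcoord.comp tendsto_snd).prodMk_nhds tendsto_fst
      exact h3.eventually h1
    have h4 : ∀ᶠ q : Traceless n × Herm c n in 𝓝 γ₁ ×ˢ 𝓝[fiberH c α β γ₀] X,
        ∀ i, ∀ z ∈ A.domain i, A.param i z = q.2.mat →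
        |√(metricDet T A i z q.1) - √(metricDet T A i z γ₁)| ≤
          ε * √(metricDet T A i z γ₁) := by
      filter_upwards [h2, hE.prod_inl _, hVX.prod_inr _] with q hq hqE hqV i z hz hzq
      rw [← hzq] at hqV
      obtain ⟨J, hJ, hJe⟩ := exists_metricDet_eq_mul hβ T hz hqV
      rw [hJe _ hqE, hJe _ hγ₁, Real.sqrt_mul hJ, Real.sqrt_mul hJ, ← mul_sub, abs_mul,
        abs_of_nonneg (Real.sqrt_nonneg _), mul_left_comm, hzq]
      exact mul_le_mul_of_nonneg_left hq.le (Real.sqrt_nonneg _)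
    rw [← nhdsWithin_univ, ← nhdsWithin_prod_eq, eventually_nhdsWithin_iff] at h4
    filter_upwards [h4] with q hq hqF
    exact hq ⟨mem_univ _, hqF⟩
  filter_upwards [key] with γ hγ i z hz
  obtain ⟨X, hX, hXz⟩ := (mem_fiber_iff hβ).1 (param_mem_fiber A hz)
  exact hγ X hX hX i z hz hXz.symm

end Horn

/-! ### Averages over shrinking balls -/

theorem tendsto_setLIntegral_closedBall_div {X : Type*} [PseudoMetricSpace X] [MeasurableSpace X]
    [OpensMeasurableSpace X] {μ : Measure X} {x : X}
    (h0 : ∀ r > 0, μ (Metric.closedBall x r) ≠ 0) (htop : ∀ r, μ (Metric.closedBall x r) ≠ ⊤)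
    {g : X → ENNReal} (hg : ContinuousAt g x) :
    Tendsto (fun r => (∫⁻ y in Metric.closedBall x r, g y ∂μ) / μ (Metric.closedBall x r))
      (𝓝[>] 0) (𝓝 (g x)) := by
  have hball : ∀ s ∈ 𝓝 x, ∀ᶠ r in 𝓝[>] (0 : ℝ), 0 < r ∧ Metric.closedBall x r ⊆ s := by
    intro s hs
    obtain ⟨R, hR, hRs⟩ := Metric.nhds_basis_closedBall.mem_iff.1 hs
    filter_upwards [Ioc_mem_nhdsGT hR] with r hr
    exact ⟨hr.1, (Metric.closedBall_subset_closedBall hr.2).trans hRs⟩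
  refine tendsto_order.2 ⟨fun a ha => ?_, fun a ha => ?_⟩
  · obtain ⟨b, hab, hb⟩ := exists_between ha
    filter_upwards [hball _ (hg (lt_mem_nhds hb))] with r ⟨hr, hrs⟩
    refine hab.trans_le ?_
    rw [ENNReal.le_div_iff_mul_le (Or.inl (h0 r hr)) (Or.inl (htop r)), ← setLIntegral_const]
    exact setLIntegral_mono' Metric.isClosed_closedBall.measurableSet fun y hy => (hrs hy).le
  · obtain ⟨b, hb, hab⟩ := exists_between ha
    filter_upwards [hball _ (hg (gt_mem_nhds hb))] with r ⟨hr, hrs⟩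
    refine lt_of_le_of_lt ?_ hab
    rw [ENNReal.div_le_iff_le_mul (Or.inl (h0 r hr)) (Or.inl (htop r)), ← setLIntegral_const]
    exact setLIntegral_mono' Metric.isClosed_closedBall.measurableSet fun y hy => (hrs hy).le

namespace Horn

open SelfAdjointCase

variable {c : SelfAdjointCase} {n : ℕ} {α β γ₀ : Traceless n}

/-! ### The density of the Horn measure -/

variable (c β) in
/-- The normalizing constant of the invariant measure on the orbit of `β`. -/
def orbitConst : ENNReal := ENNReal.ofReal (c.kappa n * vdm (vec β) ^ c.scalarDim)⁻¹

theorem orbitConst_ne_top : orbitConst c β ≠ ⊤ := ENNReal.ofReal_ne_top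

theorem orbitConst_ne_zero (hβ : StrictAnti (vec β)) : orbitConst c β ≠ 0 := by
  have h1 := vdm_pos hβ
  have h2 := kappa_pos c n
  rw [orbitConst, ne_eq, ENNReal.ofReal_eq_zero, not_le]
  positivity

theorem hornMeasure_univ (hβ : β ∈ chamber n) : hornMeasure c α β univ = 1 := by
  have h := lintegral_hornMeasure (c := c) (α := α) hβ (f := fun _ => 1) measurable_const
  simpa using h

theorem hornMeasure_apply (hn : 0 < n) (hβ : StrictAnti (vec β))
    (T : FiberTrivialization c α β γ₀) (A : FiberAtlas c α β γ₀) {s : Set (Traceless n)}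
    (hs : MeasurableSet s) (hsE : s ⊆ T.E) :
    hornMeasure c α β s = ∫⁻ γ in s, orbitConst c β * fiberLIntegral T A γ := by
  have h1 := lintegral_hornMeasure_restrict hn hβ T A (f := s.indicator 1)
    (measurable_one.indicator hs)
  have h2 : ∀ γ, s.indicator (1 : Traceless n → ENNReal) γ * fiberLIntegral T A γ =
      s.indicator (fiberLIntegral T A) γ := fun γ => by
    by_cases hγ : γ ∈ s <;> simp [hγ]
  simp only [h2] at h1
  rw [lintegral_indicator_one hs, Measure.restrict_apply hs, inter_eq_left.2 hsE,
    lintegral_indicator hs, Measure.restrict_restrict hs, inter_eq_left.2 hsE] at h1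
  rw [h1, lintegral_const_mul' _ _ orbitConst_ne_top, orbitConst]

theorem fiberIntegrand_nonneg (T : FiberTrivialization c α β γ₀) (A : FiberAtlas c α β γ₀)
    (γ : Traceless n) (i : Fin A.k) (z : EuclideanSpace ℝ (Fin (c.fiberDim n))) :
    0 ≤ fiberIntegrand T A γ i z :=
  mul_nonneg (A.weight_nonneg i _) (Real.sqrt_nonneg _)

/-- The pointwise relative bound integrates to a relative bound that makes sense before finiteness
is known. -/
theorem eventually_fiberLIntegral (hβ : β ∈ chamber n) (T : FiberTrivialization c α β γ₀)
    (A : FiberAtlas c α β γ₀) {γ₁ : Traceless n} (hγ₁ : γ₁ ∈ T.E) {ε : ℝ} (hε : 0 < ε) :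
    ∀ᶠ γ in 𝓝 γ₁, ENNReal.ofReal (1 - ε) * fiberLIntegral T A γ₁ ≤ fiberLIntegral T A γ ∧
      fiberLIntegral T A γ ≤ ENNReal.ofReal (1 + ε) * fiberLIntegral T A γ₁ := by
  filter_upwards [eventually_sqrt_metricDet hβ T A hγ₁ hε] with γ hγ
  have h1 : ∀ i, ∀ z ∈ A.domain i,
      (1 - ε) * fiberIntegrand T A γ₁ i z ≤ fiberIntegrand T A γ i z ∧
      fiberIntegrand T A γ i z ≤ (1 + ε) * fiberIntegrand T A γ₁ i z := by
    intro i z hz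
    obtain ⟨h2, h3⟩ := abs_le.1 (hγ i z hz)
    have hw := A.weight_nonneg i (A.param i z)
    rw [fiberIntegrand, fiberIntegrand, mul_left_comm, mul_left_comm (1 + ε)]
    exact ⟨mul_le_mul_of_nonneg_left (by linarith) hw, mul_le_mul_of_nonneg_left (by linarith) hw⟩
  have hD : ∀ i, MeasurableSet (A.domain i) := fun i => (A.isOpen_domain i).measurableSet
  simp only [fiberLIntegral, Finset.mul_sum]
  refine ⟨Finset.sum_le_sum fun i _ => ?_, Finset.sum_le_sum fun i _ => ?_⟩
  all_goals
    rw [← lintegral_const_mul' _ _ ENNReal.ofReal_ne_top]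
    refine setLIntegral_mono' (hD i) fun z hz => ?_
    rw [← ENNReal.ofReal_mul' (fiberIntegrand_nonneg T A γ₁ i z)]
  exacts [ENNReal.ofReal_le_ofReal (h1 i z hz).1, ENNReal.ofReal_le_ofReal (h1 i z hz).2]

/-- By the lower bound, an infinite value would be infinite on an open neighborhood, giving it
infinite Horn mass; the total mass is $1$. -/
theorem fiberLIntegral_ne_top (hn : 0 < n) (hβ : StrictAnti (vec β))
    (T : FiberTrivialization c α β γ₀) (A : FiberAtlas c α β γ₀) {γ : Traceless n} (hγ : γ ∈ T.E) :
    fiberLIntegral T A γ ≠ ⊤ := by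
  intro h
  have h1 := (eventually_fiberLIntegral hβ.antitone T A hγ (ε := 1 / 2) (by norm_num)).and
    (T.isOpen_E.mem_nhds hγ)
  obtain ⟨N, hN, hNo, hγN⟩ := eventually_nhds_iff.1 h1
  have h2 : ∀ γ' ∈ N, fiberLIntegral T A γ' = ⊤ := fun γ' hγ' => by
    have h3 := (hN γ' hγ').1.1
    rwa [h, ENNReal.mul_top (by norm_num), top_le_iff] at h3
  have h4 := hornMeasure_apply hn hβ T A hNo.measurableSet fun γ' hγ' => (hN γ' hγ').2
  rw [setLIntegral_congr_fun hNo.measurableSet (g := fun _ => ⊤) fun γ' hγ' => by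
    simp only [h2 γ' hγ', ENNReal.mul_top (orbitConst_ne_zero hβ)], setLIntegral_const,
    ENNReal.top_mul (hNo.measure_pos volume ⟨γ, hγN⟩).ne'] at h4
  have h5 : hornMeasure c α β N ≤ 1 := by
    rw [← hornMeasure_univ (c := c) (α := α) hβ.antitone]
    exact measure_mono (subset_univ _)
  rw [h4] at h5
  exact absurd h5 (by simp)

theorem continuousAt_fiberLIntegral (hn : 0 < n) (hβ : StrictAnti (vec β))
    (T : FiberTrivialization c α β γ₀) (A : FiberAtlas c α β γ₀) {γ : Traceless n} (hγ : γ ∈ T.E) :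
    ContinuousAt (fiberLIntegral T A) γ := by
  have hI := fiberLIntegral_ne_top hn hβ T A hγ
  have hlim : ∀ f : ℝ → ℝ, Continuous f → f 0 = 1 → Tendsto (fun ε =>
      ENNReal.ofReal (f ε) * fiberLIntegral T A γ) (𝓝[>] 0) (𝓝 (fiberLIntegral T A γ)) := by
    intro f hf hf0
    have h1 : Continuous fun ε => ENNReal.ofReal (f ε) * fiberLIntegral T A γ :=
      ENNReal.continuous_mul_const hI |>.comp (ENNReal.continuous_ofReal.comp hf)
    have h2 := h1.tendsto 0
    rw [hf0, ENNReal.ofReal_one, one_mul] at h2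
    exact h2.mono_left nhdsWithin_le_nhds
  refine tendsto_order.2 ⟨fun a ha => ?_, fun a ha => ?_⟩
  · obtain ⟨ε, h1, h2⟩ := (((hlim (fun ε => 1 - ε) (by fun_prop) (by simp)).eventually
      (lt_mem_nhds ha)).and self_mem_nhdsWithin).exists
    filter_upwards [eventually_fiberLIntegral hβ.antitone T A hγ h2] with γ' h
    exact h1.trans_le h.1
  · obtain ⟨ε, h1, h2⟩ := (((hlim (fun ε => 1 + ε) (by fun_prop) (by simp)).eventually
      (gt_mem_nhds ha)).and self_mem_nhdsWithin).exists
    filter_upwards [eventually_fiberLIntegral hβ.antitone T A hγ h2] with γ' h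
    exact h.2.trans_lt h1

/-- The density is a limit of averages over balls, so its value at every point, not only almost
everywhere, comes from continuity of the fiber integral. -/
theorem hornDensity_eq (hn : 0 < n) (hβ : StrictAnti (vec β))
    (T : FiberTrivialization c α β γ₀) (A : FiberAtlas c α β γ₀) {γ : Traceless n} (hγ : γ ∈ T.E) :
    hornDensity c α β γ = (orbitConst c β * fiberLIntegral T A γ).toReal := by
  have hne : orbitConst c β * fiberLIntegral T A γ ≠ ⊤ :=
    ENNReal.mul_ne_top orbitConst_ne_top (fiberLIntegral_ne_top hn hβ T A hγ)
  have h1 : ContinuousAt (fun γ => orbitConst c β * fiberLIntegral T A γ) γ :=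
    (ENNReal.continuous_const_mul orbitConst_ne_top).continuousAt.comp
      (continuousAt_fiberLIntegral hn hβ T A hγ)
  have h2 := tendsto_setLIntegral_closedBall_div (μ := volume) (x := γ)
    (fun r hr => (Metric.measure_closedBall_pos volume γ hr).ne')
    (fun r => (isCompact_closedBall γ r).measure_lt_top.ne) h1
  refine Tendsto.limUnder_eq (((ENNReal.tendsto_toReal hne).comp h2).congr' ?_)
  obtain ⟨R, hR, hRE⟩ := Metric.nhds_basis_closedBall.mem_iff.1 (T.isOpen_E.mem_nhds hγ)
  filter_upwards [Ioc_mem_nhdsGT hR] with r hr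
  simp only [Function.comp_apply]
  rw [hornMeasure_apply hn hβ T A Metric.isClosed_closedBall.measurableSet
    ((Metric.closedBall_subset_closedBall hr.2).trans hRE)]

theorem hornMeasure_restrict_eq (hn : 0 < n) (hβ : StrictAnti (vec β))
    (T : FiberTrivialization c α β γ₀) (A : FiberAtlas c α β γ₀) :
    (hornMeasure c α β).restrict T.E = (volume.restrict T.E).withDensity
      (fun γ => ENNReal.ofReal (hornDensity c α β γ)) := by
  have hE : MeasurableSet T.E := T.isOpen_E.measurableSet
  ext s hs
  rw [Measure.restrict_apply hs, withDensity_apply _ hs, Measure.restrict_restrict hs,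
    hornMeasure_apply hn hβ T A (hs.inter hE) inter_subset_right]
  refine setLIntegral_congr_fun (hs.inter hE) fun γ hγ => ?_
  rw [hornDensity_eq hn hβ T A hγ.2, ENNReal.ofReal_toReal
    (ENNReal.mul_ne_top orbitConst_ne_top (fiberLIntegral_ne_top hn hβ T A hγ.2))]

theorem lintegral_fiberIntegrand_ne_top (hn : 0 < n) (hβ : StrictAnti (vec β))
    (T : FiberTrivialization c α β γ₀) (A : FiberAtlas c α β γ₀) {γ : Traceless n} (hγ : γ ∈ T.E)
    (i : Fin A.k) : ∫⁻ z in A.domain i, ENNReal.ofReal (fiberIntegrand T A γ i z) ≠ ⊤ :=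
  ne_top_of_le_ne_top (fiberLIntegral_ne_top hn hβ T A hγ)
    (Finset.single_le_sum (f := fun i => ∫⁻ z in A.domain i, ENNReal.ofReal
      (fiberIntegrand T A γ i z)) (fun _ _ => zero_le) (Finset.mem_univ i))

theorem integrableOn_fiberIntegrand (hn : 0 < n) (hβ : StrictAnti (vec β))
    (T : FiberTrivialization c α β γ₀) (A : FiberAtlas c α β γ₀) {γ : Traceless n} (hγ : γ ∈ T.E)
    (i : Fin A.k) : IntegrableOn (fiberIntegrand T A γ i) (A.domain i) := by
  refine ⟨(aemeasurable_fiberIntegrand_right hβ.antitone hγ).aestronglyMeasurable, ?_⟩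
  rw [hasFiniteIntegral_iff_ofReal (Eventually.of_forall (fiberIntegrand_nonneg T A γ i))]
  exact (lintegral_fiberIntegrand_ne_top hn hβ T A hγ i).lt_top

theorem fiberIntegral_eq (hn : 0 < n) (hβ : StrictAnti (vec β))
    (T : FiberTrivialization c α β γ₀) (A : FiberAtlas c α β γ₀) {γ : Traceless n} (hγ : γ ∈ T.E) :
    fiberIntegral T A γ = (fiberLIntegral T A γ).toReal := by
  rw [fiberIntegral, fiberLIntegral, ENNReal.toReal_sum fun i _ =>
    lintegral_fiberIntegrand_ne_top hn hβ T A hγ i]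
  refine Finset.sum_congr rfl fun i _ => ?_
  exact integral_eq_lintegral_of_nonneg_ae (Eventually.of_forall (fiberIntegrand_nonneg T A γ i))
    (aemeasurable_fiberIntegrand_right hβ.antitone hγ).aestronglyMeasurable

theorem hornDensity_eq_fiberIntegral (hn : 0 < n) (hβ : StrictAnti (vec β))
    (T : FiberTrivialization c α β γ₀) (A : FiberAtlas c α β γ₀) {γ : Traceless n} (hγ : γ ∈ T.E) :
    hornDensity c α β γ =
      (c.kappa n)⁻¹ * vandermonde β ^ (-2 * c.θ) * fiberIntegral T A γ := by
  have h1 := vdm_pos hβ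
  have h2 := kappa_pos c n
  rw [hornDensity_eq hn hβ T A hγ, ENNReal.toReal_mul, ← fiberIntegral_eq hn hβ T A hγ, orbitConst,
    ENNReal.toReal_ofReal (by positivity), vandermonde_eq, neg_mul, two_theta, Real.rpow_neg h1.le,
    Real.rpow_natCast, mul_inv]

theorem volumeFunction_eq_fiberIntegral (hn : 0 < n) (hα : StrictAnti (vec α))
    (hβ : StrictAnti (vec β)) (T : FiberTrivialization c α β γ₀) (A : FiberAtlas c α β γ₀)
    {γ : Traceless n} (hγ : γ ∈ T.E) (hγ' : γ ∈ chamber n) :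
    volumeFunction c α β γ =
      (2 * Real.pi) ^ (c.θ * n * (n - 1) : ℝ) /
          (c.kappa n * c.kappa n ^ 2 * (c.deltaRho n : ℝ) ^ 3) *
        (vandermonde α / (vandermonde β * vandermonde γ)) ^ c.θ * fiberIntegral T A γ := by
  rw [volumeFunction, hornDensity_eq_fiberIntegral hn hβ T A hγ]
  simp only [vandermonde_eq]
  have ha := vdm_pos hα
  have hb := vdm_pos hβ
  have hg := vdm_nonneg (mem_chamber.1 hγ')
  -- Valid also when $\Delta(\gamma)=0$: division by zero gives $0$ on both sides.
  have h1 : vdm (vec α) * vdm (vec β) / vdm (vec γ) =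
      vdm (vec α) / (vdm (vec β) * vdm (vec γ)) * vdm (vec β) ^ (2 : ℝ) := by
    rw [Real.rpow_two]
    field_simp
  have h2 : vdm (vec β) ^ (2 * c.θ) ≠ 0 := (Real.rpow_pos_of_pos hb _).ne'
  have h3 : (vdm (vec α) * vdm (vec β) / vdm (vec γ)) ^ c.θ * vdm (vec β) ^ (-2 * c.θ) =
      (vdm (vec α) / (vdm (vec β) * vdm (vec γ))) ^ c.θ := by
    rw [h1, Real.mul_rpow (z := c.θ) (by positivity) (by positivity), ← Real.rpow_mul hb.le,
      neg_mul, Real.rpow_neg hb.le, mul_assoc, mul_inv_cancel₀ h2, mul_one]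
  rw [← h3]
  ring

end Horn

end

/-- Let `α`, `β` be regular (distinct entries, in decreasing order) and traceless, and let `γ₀ ∈ C₊`
be a regular value of `Ψ : O_β → C₊`. Then `Ψ` is trivial over some neighborhood of `γ₀`, the fiber
over `γ₀` is covered by finitely many coordinate systems, and for every trivialization over a
neighborhood `E` of `γ₀` and every choice of coordinates, the Horn density and the volume function
are given on `E` by the fiber integral of `√g_β`. -/
theorem mainTheorem2 (c : Horn.SelfAdjointCase) (n : ℕ) (hn : 0 < n)
    (α β γ₀ : Horn.Traceless n)
    (hα : StrictAnti fun i => α.1 i) (hβ : StrictAnti fun i => β.1 i)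
    (hγ₀ : γ₀ ∈ Horn.chamber n) (hreg : Horn.IsRegularValue c α β γ₀) :
    Nonempty (Horn.FiberTrivialization c α β γ₀) ∧
    Nonempty (Horn.FiberAtlas c α β γ₀) ∧
    ∀ (T : Horn.FiberTrivialization c α β γ₀) (A : Horn.FiberAtlas c α β γ₀),
      (Horn.hornMeasure c α β).restrict T.E =
        (volume.restrict T.E).withDensity
          (fun γ => ENNReal.ofReal (Horn.hornDensity c α β γ)) ∧
      ∀ γ ∈ T.E, γ ∈ Horn.chamber n →
        (∀ i, IntegrableOn (Horn.fiberIntegrand T A γ i) (A.domain i)) ∧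
        Horn.hornDensity c α β γ =
          (c.kappa n)⁻¹ * Horn.vandermonde β ^ (-2 * c.θ) * Horn.fiberIntegral T A γ ∧
        Horn.volumeFunction c α β γ =
          (2 * Real.pi) ^ (c.θ * n * (n - 1) : ℝ) /
              (c.kappa n * c.kappa n ^ 2 * (c.deltaRho n : ℝ) ^ 3) *
            (Horn.vandermonde α / (Horn.vandermonde β * Horn.vandermonde γ)) ^ c.θ *
            Horn.fiberIntegral T A γ := by
  have hα' : StrictAnti (Horn.vec α) := hα
  have hβ' : StrictAnti (Horn.vec β) := hβ
  refine ⟨Horn.nonempty_fiberTrivialization hβ' hreg, Horn.nonempty_fiberAtlas hn hβ' hreg,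
    fun T A => ⟨Horn.hornMeasure_restrict_eq hn hβ' T A, fun γ hγ hγ' => ⟨?_, ?_, ?_⟩⟩⟩
  · exact Horn.integrableOn_fiberIntegrand hn hβ' T A hγ
  · exact Horn.hornDensity_eq_fiberIntegral hn hβ' T A hγ
  · exact Horn.volumeFunction_eq_fiberIntegral hn hα' hβ' T A hγ hγ'
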